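/- **Setting.** A structured matrix has entries that are fixed zeros or independent free real parameters ($*$). A realization of a structured system $(A,B,C)$ is a system $\dot x=\tilde Ax+\tilde Bu$, $y=\tilde Cx$ obtained by assigning values to the parameters. It is state and input observable if $y(t)=0$ for all $t\ge 0$ implies $x(t)=0$ and $u(t)=0$ for all $t\ge 0$ ($u$ is an unknown input). $(A,B,C)$ is *generically state and input observable* (GSIO) if all its realizations outside a proper algebraic variety of the parameter space are state and input observable. The minimal GSIO problem $\mathcal P$ of $(A,B)$ is to minimize the number $\|C\|_0$ of free parameters of $C\in\{0,*\}^{n\times n}$ subject to: $(A,B,C)$ is GSIO and each row of $C$ has at most one free parameter. $(A,C)$ is structurally observable if some realization of it (without input) is observable. The digraph of a system has a vertex for each state, input and sensor, and an edge for each free parameter ($x_j\to x_i$ if $A_{ij}=*$, and so on). Let $(A',e_i)$ be a structured system with $n$ states $x_1,\dots,x_n$ and one dedicated input $u$, which drives only the state $x^*=x_i$, such that every state has a self-loop ($A'_{jj}=*$ for all $j$). The *auxiliary system* $\hat A'$ has the $n+1$ states $x_1,\dots,x_n,u$; its digraph arises from that of $(A',e_i)$ by deleting all edges from states to $x^*$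 (the self-loop of $x^*$ included) and regarding $u$ as a state. A sink-SCC is a strongly connected component that no edge leaves; let $L(\hat A')$ be the number of sink-SCCs of the digraph of $\hat A'$ that are reachable from $u$. For vertex sets $V_1,V_2$ of a digraph, $\rho(V_1,V_2)$ is the maximum number of mutually vertex-disjoint $V_1$–$V_2$ paths, and $\mathcal V_{ess}(V_1,V_2)$ is the set of vertices covered by every family of $\rho(V_1,V_2)$ mutually vertex-disjoint $V_1$–$V_2$ paths. **Algorithm 1.** Input: $(A',e_i)$. (1) Construct $\hat A'$. (2) Find a set $\hat Y_{min}$ of dedicated sensors (each measuring one state of $\hat A'$) of minimum cardinality such that $\hat A'$ with these sensors is structurally observable. (3)–(4) In the digraph of $\hat A'$ with the sensors $\hat Y_{min}$, check whether there is a state $x_j$, $1\le j\le n$, with $x_j\notin\mathcal V_{ess}(\{u\},\hat Y_{min})$ and $\rho(\{u,x_j\},\hat Y_{min})=\rho(\{u\},\hat Y_{min})$. If so, return $\hat Y_{min}\cup\{y^*\}$, where $y^*$ is a sensor measuring $x^*$; otherwise return $\hat Y_{min}$. **Theorem 4.** (a) *Correctness.* If $L(\hat A')>1$, then Algorithm 1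 has a result, and, whichever minimum placement $\hat Y_{min}$ is chosen in step (2), the returned sensors measure only states among $x_1,\dots,x_n$ and form an optimal solution of $\mathcal P$ for $(A',e_i)$: with $C$ the corresponding output matrix, $(A',e_i,C)$ is GSIO and $\|C\|_0$ is minimum. (b) *Running time.* Algorithm 1 can be completed in time $O(n^{3.5})$: there are a program of a random access machine (unit-cost operations on words of $O(\log n)$ bits, the system being given by $n$, $i$ and the $n\times n$ zero pattern of $A'$) and a constant $K$ such that for every such system $(A',e_i)$ with $n$ states the program halts after at most $K n^{3.5}$ steps with a possible result of Algorithm 1 as its output. -/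

import Mathlib

noncomputable section

/-! ## Linear systems with unknown inputs, and structured systems -/

/-- State and input observability of `ẋ = A x + B u`, `y = C x`: a zero output on `[0, ∞)` forces
the state and the (arbitrary, unknown) input to vanish on `[0, ∞)`. -/
def IsSIO {X U Y : Type} [Fintype X] [Fintype U]
    (A : Matrix X X ℝ) (B : Matrix X U ℝ) (C : Matrix Y X ℝ) : Prop :=
  ∀ (x : ℝ → X → ℝ) (u : ℝ → U → ℝ),
    (∀ t, 0 ≤ t → HasDerivWithinAt x (A.mulVec (x t) + B.mulVec (u t)) (Set.Ici 0) t) →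
    (∀ t, 0 ≤ t → C.mulVec (x t) = 0) →
    ∀ t, 0 ≤ t → x t = 0 ∧ u t = 0

/-- A structured matrix: `true` marks a free parameter `*`, `false` a fixed zero. -/
abbrev StructMatrix (m n : Type) := Matrix m n Bool

/-- The free positions of a structured matrix. -/
abbrev StructMatrix.Free {m n : Type} (M : StructMatrix m n) : Type :=
  {p : m × n // M p.1 p.2 = true}

/-- The realization of a structured matrix at given values of its free parameters. -/
def StructMatrix.realize {m n : Type} (M : StructMatrix m n) (θ : M.Free → ℝ) : Matrix m n ℝ :=
  fun i j => if h : M i j = true then θ ⟨(i, j), h⟩ else 0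

/-- The number of free parameters of a structured matrix. -/
def StructMatrix.norm0 {m n : Type} (M : StructMatrix m n) : ℕ := Nat.card M.Free

/-- Generic state and input observability: all realizations are state and input observable, except
for parameter values in a proper algebraic variety of the parameter space. -/
def IsGSIO {X U Y : Type} [Fintype X] [Fintype U]
    (A : StructMatrix X X) (B : StructMatrix X U) (C : StructMatrix Y X) : Prop :=
  ∃ P : MvPolynomial (A.Free ⊕ B.Free ⊕ C.Free) ℝ, P ≠ 0 ∧
    ∀ θ : A.Free ⊕ B.Free ⊕ C.Free → ℝ, MvPolynomial.eval θ P ≠ 0 →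
      IsSIO (A.realize fun p => θ (Sum.inl p))
        (B.realize fun p => θ (Sum.inr (Sum.inl p)))
        (C.realize fun p => θ (Sum.inr (Sum.inr p)))

/-- Structural observability of `(A, C)` (no inputs): some realization is observable. -/
def IsStructObservable {X Y : Type} [Fintype X]
    (A : StructMatrix X X) (C : StructMatrix Y X) : Prop :=
  ∃ (a : A.Free → ℝ) (c : C.Free → ℝ),
    IsSIO (A.realize a) (0 : Matrix X Empty ℝ) (C.realize c)

/-- The output matrix of the dedicated sensors `y_x`, `x ∈ S`, where `y_x` measures the state `x`:
row `x` has its only free parameter in column `x` if `x ∈ S`, and is a zero row (no sensor)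
otherwise. -/
def sensorMatrix {X : Type} [DecidableEq X] (S : Finset X) : StructMatrix X X :=
  fun y x => decide (y = x ∧ x ∈ S)

/-- The feasible output matrices of the minimal GSIO problem of `(A, B)`: each sensor measures at
most one state, and `(A, B, C)` is GSIO. -/
def IsFeasible {X U : Type} [Fintype X] [Fintype U]
    (A : StructMatrix X X) (B : StructMatrix X U) (C : StructMatrix X X) : Prop :=
  IsGSIO A B C ∧ ∀ y x x', C y x = true → C y x' = true → x = x'

/-- The optimal solutions of the minimal GSIO problem of `(A, B)`. -/
def IsOptimal {X U : Type} [Fintype X] [Fintype U]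
    (A : StructMatrix X X) (B : StructMatrix X U) (C : StructMatrix X X) : Prop :=
  IsFeasible A B C ∧ ∀ C' : StructMatrix X X, IsFeasible A B C' → C.norm0 ≤ C'.norm0

/-- The minimum sensor placements for structural observability of `A`. -/
def IsMinPlacement {X : Type} [Fintype X] [DecidableEq X]
    (A : StructMatrix X X) (S : Finset X) : Prop :=
  IsStructObservable A (sensorMatrix S) ∧
    ∀ S' : Finset X, IsStructObservable A (sensorMatrix S') → S.card ≤ S'.card

/-! ## Digraphs, linkings, essential vertices, sink components -/

/-- The digraph of `A` on the state vertices: an edge `x_j → x_i` for each free entry `(i, j)`. -/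
def stateDigraph {X : Type} (A : StructMatrix X X) : Digraph X where
  Adj j i := A i j = true

/-- The digraph of `(A, C)`: state vertices `Sum.inl x` and output vertices `Sum.inr y`. -/
def outputDigraph {X Y : Type} (A : StructMatrix X X) (C : StructMatrix Y X) :
    Digraph (X ⊕ Y) where
  Adj v w := match v, w with
    | Sum.inl j, Sum.inl i => A i j = true
    | Sum.inl j, Sum.inr y => C y j = true
    | Sum.inr _, _ => False

/-- A `V₁ - V₂` path, as its nonempty list of vertices: consecutive vertices are joined by edges
and no vertex is repeated. -/
def IsPath {V : Type} (G : Digraph V) (V₁ V₂ : Set V) (p : List V) : Prop :=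
  p.IsChain G.Adj ∧ p.Nodup ∧ (∃ v ∈ V₁, p.head? = some v) ∧ (∃ w ∈ V₂, p.getLast? = some w)

/-- A set of mutually (vertex-)disjoint `V₁ - V₂` paths. -/
def IsLinking {V : Type} (G : Digraph V) (V₁ V₂ : Set V) (L : Finset (List V)) : Prop :=
  (∀ p ∈ L, IsPath G V₁ V₂ p) ∧ ∀ p ∈ L, ∀ q ∈ L, p ≠ q → List.Disjoint p q

/-- `ρ(V₁, V₂)`, the maximum number of mutually disjoint `V₁ - V₂` paths (finite digraphs). -/
def rho {V : Type} [Finite V] (G : Digraph V) (V₁ V₂ : Set V) : ℕ :=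
  sSup {k | ∃ L : Finset (List V), IsLinking G V₁ V₂ L ∧ L.card = k}

/-- The essential vertices: those covered by every maximum `V₁ - V₂` linking. -/
def essentialVertices {V : Type} [Finite V] (G : Digraph V) (V₁ V₂ : Set V) : Set V :=
  {v | ∀ L : Finset (List V), IsLinking G V₁ V₂ L → L.card = rho G V₁ V₂ → ∃ p ∈ L, v ∈ p}

/-- There is a path (possibly of length zero) from `v` to `w`. -/
def Reaches {V : Type} (G : Digraph V) (v w : V) : Prop := Relation.ReflTransGen G.Adj v w

/-- The vertex sets of the strongly connected components. -/
def IsSCC {V : Type} (G : Digraph V) (S : Set V) : Prop :=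
  ∃ v, S = {w | Reaches G v w ∧ Reaches G w v}

/-- A sink component: a strongly connected component that no edge leaves. -/
def IsSinkSCC {V : Type} (G : Digraph V) (S : Set V) : Prop :=
  IsSCC G S ∧ ∀ v ∈ S, ∀ w, G.Adj v w → w ∈ S

/-- The number of sink components that can be reached from the vertex `u`. -/
def numReachableSinkSCC {V : Type} (G : Digraph V) (u : V) : ℕ :=
  Set.ncard {S : Set V | IsSinkSCC G S ∧ ∃ v ∈ S, Reaches G u v}

/-! ## One dedicated input, the auxiliary system, and the sensor placement algorithm -/

/-- The input matrix of a single dedicated input that drives the state `x`. -/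
def dedicatedInput {X : Type} [DecidableEq X] (x : X) : StructMatrix X Unit :=
  fun i _ => decide (i = x)

/-- The auxiliary system of `(A, e)`, `e` being the single dedicated input that drives `x`:
delete all edges from state vertices (`x` included) to `x`, and count the input vertex `u`,
here `Sum.inr ()`, as a state vertex. -/
def auxSystem {X : Type} [DecidableEq X] (A : StructMatrix X X) (x : X) :
    StructMatrix (X ⊕ Unit) (X ⊕ Unit) :=
  fun w v => match w, v with
    | Sum.inl i, Sum.inl j => A i j && !decide (i = x)
    | Sum.inl i, Sum.inr _ => decide (i = x)
    | Sum.inr _, _ => false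

/-- The test in the loop of the algorithm: in the digraph of the auxiliary system with the sensors
`S`, some state vertex `x_j` is not essential for `({u}, Y)` although
`ρ({u, x_j}, Y) = ρ({u}, Y)`, where `Y` is the set of the sensors in `S`. -/
def HasViolation {X : Type} [Fintype X] [DecidableEq X]
    (A : StructMatrix X X) (x : X) (S : Finset (X ⊕ Unit)) : Prop :=
  let G : Digraph ((X ⊕ Unit) ⊕ (X ⊕ Unit)) := outputDigraph (auxSystem A x) (sensorMatrix S)
  let u : (X ⊕ Unit) ⊕ (X ⊕ Unit) := Sum.inl (Sum.inr ())
  let Y : Set ((X ⊕ Unit) ⊕ (X ⊕ Unit)) := {v | ∃ s ∈ S, v = Sum.inr s}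
  ∃ j : X, (Sum.inl (Sum.inl j)) ∉ essentialVertices G {u} Y ∧
    rho G {u, Sum.inl (Sum.inl j)} Y = rho G {u} Y

/-- `R` is a possible result of the algorithm on `(A, e)`, `e` driving `x`: choose any minimum
sensor placement `S` for structural observability of the auxiliary system; return `S` together
with a sensor on `x` if some state vertex violates the condition, and `S` otherwise. -/
def AlgorithmReturns {X : Type} [Fintype X] [DecidableEq X]
    (A : StructMatrix X X) (x : X) (R : Finset (X ⊕ Unit)) : Prop :=
  ∃ S : Finset (X ⊕ Unit), IsMinPlacement (auxSystem A x) S ∧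
    ((HasViolation A x S ∧ R = insert (Sum.inl x) S) ∨ (¬ HasViolation A x S ∧ R = S))

/-! ## A word RAM with step count -/

namespace RAM

/-- Contents of the registers and of the arrays (random access memory) of the machine. -/
structure State where
  reg : ℕ → ℕ
  arr : ℕ → ℕ → ℕ

/-- Programs. All register names and array names are fixed numbers in the program text. -/
inductive Prog where
  | const (r c : ℕ)
  | add (r a b : ℕ)
  | sub (r a b : ℕ)
  | mul (r a b : ℕ)
  | load (r k a : ℕ)
  | store (k a b : ℕ)
  | seq (p q : Prog)
  | ifLt (a b : ℕ) (p q : Prog)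
  | whileLt (a b : ℕ) (p : Prog)

/-- Write `v` into register `r`. -/
def State.setReg (s : State) (r v : ℕ) : State :=
  { s with reg := Function.update s.reg r v }

/-- Write `v` into cell `i` of array `k`. -/
def State.setArr (s : State) (k i v : ℕ) : State :=
  { s with arr := Function.update s.arr k (Function.update (s.arr k) i v) }

/-- `Exec W p s t s'`: started in `s`, the program `p` halts in `s'` after exactly `t` steps, and
each number that it writes is at most `W` (the largest machine word). Each elementary operation
and each evaluation of a test takes one step. -/
inductive Exec (W : ℕ) : Prog → State → ℕ → State → Prop
  | const (s : State) (r c : ℕ) : c ≤ W → Exec W (.const r c) s 1 (s.setReg r c)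
  | add (s : State) (r a b : ℕ) : s.reg a + s.reg b ≤ W →
      Exec W (.add r a b) s 1 (s.setReg r (s.reg a + s.reg b))
  | sub (s : State) (r a b : ℕ) : s.reg a - s.reg b ≤ W →
      Exec W (.sub r a b) s 1 (s.setReg r (s.reg a - s.reg b))
  | mul (s : State) (r a b : ℕ) : s.reg a * s.reg b ≤ W →
      Exec W (.mul r a b) s 1 (s.setReg r (s.reg a * s.reg b))
  | load (s : State) (r k a : ℕ) : s.arr k (s.reg a) ≤ W →
      Exec W (.load r k a) s 1 (s.setReg r (s.arr k (s.reg a)))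
  | store (s : State) (k a b : ℕ) : s.reg b ≤ W →
      Exec W (.store k a b) s 1 (s.setArr k (s.reg a) (s.reg b))
  | seq (p q : Prog) (s s' s'' : State) (t t' : ℕ) :
      Exec W p s t s' → Exec W q s' t' s'' → Exec W (.seq p q) s (t + t') s''
  | ifTrue (a b : ℕ) (p q : Prog) (s s' : State) (t : ℕ) : s.reg a < s.reg b →
      Exec W p s t s' → Exec W (.ifLt a b p q) s (t + 1) s'
  | ifFalse (a b : ℕ) (p q : Prog) (s s' : State) (t : ℕ) : ¬ s.reg a < s.reg b →
      Exec W q s t s' → Exec W (.ifLt a b p q) s (t + 1) s'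
  | whileTrue (a b : ℕ) (p : Prog) (s s' s'' : State) (t t' : ℕ) : s.reg a < s.reg b →
      Exec W p s t s' → Exec W (.whileLt a b p) s' t' s'' →
      Exec W (.whileLt a b p) s (t + t' + 1) s''
  | whileFalse (a b : ℕ) (p : Prog) (s : State) : ¬ s.reg a < s.reg b →
      Exec W (.whileLt a b p) s 1 s

/-- The input of the algorithm: `n` in register `0`, the index of the driven state in register `1`,
the pattern of `A` row by row in array `0`, and zeros everywhere else. -/
def inputState {n : ℕ} (A : StructMatrix (Fin n) (Fin n)) (x : Fin n) : State where
  reg r := if r = 0 then n else if r = 1 then (x : ℕ) else 0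
  arr k m :=
    open Classical in
    if k = 0 ∧ ∃ i j : Fin n, m = (i : ℕ) * n + (j : ℕ) ∧ A i j = true then 1 else 0

/-- The final contents of array `1` list the measured states: cell `j` holds `1` if the state `j`
is measured, and `0` otherwise. -/
def outputIs {n : ℕ} (s : State) (T : Finset (Fin n)) : Prop :=
  ∀ j : Fin n, s.arr 1 (j : ℕ) = if j ∈ T then 1 else 0

end RAM

end

noncomputable section

/-! ## Controlled invariant subspaces and observability -/

/-! A realization is state and input observable if its complex pencil `[A - sI, B; C, 0]` is
injective for every `s` (`isSIO_of_pencil`), and it is not if a nonzero controlled invariant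
subspace lies in the kernel of `C` (`not_isSIO_of_invariant`).

Generic injectivity comes from `generic_pencil_injective`. View maximal minors of the pencil as
polynomials in `s` over the ring of parameters. If they have no common factor of positive degree in
`s`, their ideal contains a nonzero polynomial in the parameters alone, and off its zero set the
minors have no common root. A common factor cannot involve the self-loop parameter of a row that
some nonzero minor omits. If each self-loop row can be omitted, the factor is unchanged when all
self-loop parameters are translated by `s`; but this translation removes `s` from the minors. The
required minors come from matchings, supplied by Menger's theorem in the form
`exists_matching_of_not_separated`.

In the auxiliary digraph a minimum placement is a set `T` of states that every state reaches and
whose members do not reach each other (`isMinPlacement_iff`). A violation means that a vertex `v`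
lies on all walks to `T` from the driven state `x` and from some `j`, although `x` reaches `T`
avoiding `j` (`hasViolation_iff`).

Without a violation, let `w` be the last vertex common to all walks from `x` to `T`. No single
vertex separates `w` and a further state beyond it from `T`, so generically the components of a
kernel vector vanish at `w` and beyond. The earlier common vertices are then eliminated by
`chain_elimination`.

Every feasible output matrix has at least `|T|` parameters, since each `t ∈ T` needs a measured
state downstream. With a violation, and two sensors reachable from `x`, exactly `|T|` is impossible:
the states that reach `T` only through `v` would be unmeasured, and this region has nontrivial zero
dynamics with respect to its exit `v` (`not_isGSIO_of_exit`). One more sensor, on `x`, suffices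
(`isGSIO_insert`).

For the running time, `n` backward searches of cost `O(n²)` give reachability, and `n` more give
reachability avoiding each vertex; altogether `O(n³)` steps. -/

theorem exists_linear_flow {E : Type*} [NormedAddCommGroup E] [NormedSpace ℝ E] [CompleteSpace E]
    (g : E →L[ℝ] E) (z : E) : ∃ w : ℝ → E, w 0 = z ∧ ∀ t, HasDerivAt w (g (w t)) t := by
  refine ⟨fun t => NormedSpace.exp (t • g) z, by simp, fun t => ?_⟩
  exact ((hasDerivAt_exp_smul_const' g t).clm_apply (hasDerivAt_const t z)).congr_deriv (by simp)

/-- The closed loop `A + B K` restricts to `V`. Its flow from a nonzero vector of `V`, with input `K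
x`, is a nonzero trajectory without output. -/
theorem not_isSIO_of_invariant {X U Y : Type} [Fintype X] [DecidableEq X] [Fintype U]
    (A : Matrix X X ℝ) (B : Matrix X U ℝ) (C : Matrix Y X ℝ) (K : (X → ℝ) →ₗ[ℝ] (U → ℝ))
    (V : Submodule ℝ (X → ℝ)) (hV : ∀ z ∈ V, A.mulVec z + B.mulVec (K z) ∈ V)
    (hC : ∀ z ∈ V, C.mulVec z = 0) (hne : V ≠ ⊥) : ¬ IsSIO A B C := by
  intro h
  obtain ⟨z, hz, hz0⟩ := V.ne_bot_iff.1 hne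
  let f : (X → ℝ) →ₗ[ℝ] (X → ℝ) := A.mulVecLin + B.mulVecLin ∘ₗ K
  have hf : ∀ z ∈ V, f z ∈ V := hV
  let g : V →L[ℝ] V := LinearMap.toContinuousLinearMap (f.restrict hf)
  obtain ⟨w, hw0, hw⟩ := exists_linear_flow g ⟨z, hz⟩
  have hx : ∀ t, HasDerivAt (fun t => (w t : X → ℝ)) (f (w t)) t := fun t =>
    (V.subtypeL.hasFDerivAt.comp_hasDerivAt t (hw t)).congr_deriv (by simp [g])
  have := h (fun t => (w t : X → ℝ)) (fun t => K (w t))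
    (fun t _ => (hx t).hasDerivWithinAt) (fun t _ => hC _ (w t).2) 0 le_rfl
  exact hz0 (by simpa [hw0] using this.1)

/-- The derivative is a limit of right difference quotients, which lie in `W`. No regularity of the
unknown input is needed to apply this to `A x + B u`. -/
theorem HasDerivWithinAt.mem_submodule {E : Type*} [NormedAddCommGroup E] [NormedSpace ℝ E]
    {W : Submodule ℝ E} (hW : IsClosed (W : Set E)) {x : ℝ → E} {x' : E} {t : ℝ} (ht : 0 ≤ t)
    (hx : HasDerivWithinAt x x' (Set.Ici 0) t) (h : ∀ t, 0 ≤ t → x t ∈ W) : x' ∈ W := by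
  have h1 := (hasDerivWithinAt_iff_tendsto_slope.1 (hx.mono (Set.Ici_subset_Ici.2 ht)))
  have : Set.Ici t \ {t} = Set.Ioi t := by ext; simp [lt_iff_le_and_ne]
  rw [this] at h1
  refine hW.mem_of_tendsto h1 ?_
  filter_upwards [self_mem_nhdsWithin] with r hr
  rw [slope_def_module]
  exact W.smul_mem _ (W.sub_mem (h _ (ht.trans (le_of_lt hr))) (h _ ht))

/-- The states from which the output of the discrete-time system can be kept at zero for `k`
further steps. -/
def outputNulling {X U Y : Type} [Fintype X] [Fintype U] (A : Matrix X X ℂ) (B : Matrix X U ℂ)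
    (C : Matrix Y X ℂ) : ℕ → Submodule ℂ (X → ℂ)
  | 0 => C.mulVecLin.ker
  | k + 1 => C.mulVecLin.ker ⊓
      Submodule.map (LinearMap.fst ℂ (X → ℂ) (U → ℂ))
        (Submodule.comap (A.mulVecLin.coprod B.mulVecLin) (outputNulling A B C k))

theorem mem_outputNulling_succ {X U Y : Type} [Fintype X] [Fintype U] {A : Matrix X X ℂ}
    {B : Matrix X U ℂ} {C : Matrix Y X ℂ} {k : ℕ} {z : X → ℂ} :
    z ∈ outputNulling A B C (k + 1) ↔
      C.mulVec z = 0 ∧ ∃ v, A.mulVec z + B.mulVec v ∈ outputNulling A B C k := by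
  simp [outputNulling]

theorem outputNulling_antitone {X U Y : Type} [Fintype X] [Fintype U] (A : Matrix X X ℂ)
    (B : Matrix X U ℂ) (C : Matrix Y X ℂ) : Antitone (outputNulling A B C) := by
  refine antitone_nat_of_succ_le fun k => ?_
  induction k with
  | zero => exact inf_le_left
  | succ k ih =>
    intro z hz
    rw [mem_outputNulling_succ] at hz ⊢
    exact ⟨hz.1, hz.2.imp fun v hv => ih hv⟩

/-- A right inverse of a surjective projection selects the inputs linearly, so `W` is invariant
under a closed-loop map. If `W ≠ ⊥`, this map has an eigenvector over `ℂ`, and that is a kernel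
vector of the pencil. -/
theorem eq_bot_of_pencil {X U Y : Type} [Fintype X] [Fintype U] (A : Matrix X X ℂ)
    (B : Matrix X U ℂ) (C : Matrix Y X ℂ)
    (h : ∀ (s : ℂ) (z : X → ℂ) (v : U → ℂ), A.mulVec z + B.mulVec v = s • z → C.mulVec z = 0 →
      z = 0 ∧ v = 0) (W : Submodule ℂ (X → ℂ)) (hC : ∀ z ∈ W, C.mulVec z = 0)
    (hW : ∀ z ∈ W, ∃ v, A.mulVec z + B.mulVec v ∈ W) : W = ⊥ := by
  by_contra hne
  let S : Submodule ℂ (W × (U → ℂ)) :=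
    W.comap (A.mulVecLin.coprod B.mulVecLin ∘ₗ W.subtype.prodMap LinearMap.id)
  let π : S →ₗ[ℂ] W := LinearMap.fst ℂ W (U → ℂ) ∘ₗ S.subtype
  have hπ : LinearMap.range π = ⊤ := by
    rw [LinearMap.range_eq_top]
    intro z
    obtain ⟨v, hv⟩ := hW z z.2
    exact ⟨⟨(z, v), by simpa [S] using hv⟩, rfl⟩
  obtain ⟨r, hr⟩ := π.exists_rightInverse_of_surjective hπ
  have hr1 : ∀ z, ((r z : W × (U → ℂ)).1) = z := fun z => LinearMap.congr_fun hr z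
  let K : W →ₗ[ℂ] (U → ℂ) := LinearMap.snd ℂ W (U → ℂ) ∘ₗ S.subtype ∘ₗ r
  have hK : ∀ z : W, A.mulVec (z : X → ℂ) + B.mulVec (K z) ∈ W := by
    intro z
    have h2 : (r z : W × (U → ℂ)) ∈ S := (r z).2
    simp only [S, Submodule.mem_comap, LinearMap.comp_apply, LinearMap.prodMap_apply,
      LinearMap.coprod_apply, hr1] at h2
    simpa [K] using h2
  let F : W →ₗ[ℂ] W := (A.mulVecLin ∘ₗ W.subtype + B.mulVecLin ∘ₗ K).codRestrict W hK
  have : Nontrivial W := Submodule.nontrivial_iff_ne_bot.2 hne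
  obtain ⟨s, hs⟩ := Module.End.exists_eigenvalue F
  obtain ⟨z, hz⟩ := hs.exists_hasEigenvector
  have h3 : (F z : X → ℂ) = s • (z : X → ℂ) := by
    rw [hz.apply_eq_smul]; rfl
  exact hz.2 (Subtype.ext (h s z (K z) h3 (hC z z.2)).1)

theorem ofReal_comp_mulVec {X Y : Type} [Fintype X] (A : Matrix Y X ℝ) (z : X → ℝ) :
    (A.map Complex.ofReal).mulVec (fun i => (z i : ℂ)) = fun i => ((A.mulVec z i : ℝ) : ℂ) := by
  ext i
  simp [Matrix.mulVec, dotProduct]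

/-- By induction the trajectory lies in each space `outputNulling k`, because its derivative lies in
the preceding one. The decreasing sequence stabilizes at a controlled invariant subspace of the
kernel of `C`, which is zero by `eq_bot_of_pencil`. Once the state is zero, the pencil condition at
`s = 0` kills the input. -/
theorem isSIO_of_pencil {X U Y : Type} [Fintype X] [Fintype U] (A : Matrix X X ℝ)
    (B : Matrix X U ℝ) (C : Matrix Y X ℝ)
    (h : ∀ (s : ℂ) (z : X → ℂ) (v : U → ℂ),
      (A.map Complex.ofReal).mulVec z + (B.map Complex.ofReal).mulVec v = s • z →
      (C.map Complex.ofReal).mulVec z = 0 → z = 0 ∧ v = 0) : IsSIO A B C := by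
  set A' := A.map Complex.ofReal with hA'
  set B' := B.map Complex.ofReal with hB'
  set C' := C.map Complex.ofReal with hC'
  intro x u hx hy
  let c : (X → ℝ) →L[ℝ] (X → ℂ) :=
    ContinuousLinearMap.pi fun i => Complex.ofRealCLM ∘L ContinuousLinearMap.proj i
  have hc : ∀ z, c z = fun i => (z i : ℂ) := fun z => rfl
  have hx' : ∀ t, 0 ≤ t → HasDerivWithinAt (fun t => c (x t))
      (A'.mulVec (c (x t)) + B'.mulVec (fun k => (u t k : ℂ))) (Set.Ici 0) t := by
    intro t ht
    refine (c.hasFDerivAt.comp_hasDerivWithinAt t (hx t ht)).congr_deriv ?_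
    simp only [hc, hA', hB', ofReal_comp_mulVec]
    ext i
    simp
  have hy' : ∀ t, 0 ≤ t → C'.mulVec (c (x t)) = 0 := by
    intro t ht
    simp only [hc, hC', ofReal_comp_mulVec, hy t ht]
    ext; simp
  have hmem : ∀ k t, 0 ≤ t → c (x t) ∈ outputNulling A' B' C' k := by
    intro k
    induction k with
    | zero => exact fun t ht => hy' t ht
    | succ k ih =>
      refine fun t ht => mem_outputNulling_succ.2 ⟨hy' t ht, fun k => (u t k : ℂ), ?_⟩
      exact (hx' t ht).mem_submodule
        (W := (outputNulling A' B' C' k).restrictScalars ℝ)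
        ((outputNulling A' B' C' k).restrictScalars ℝ).closed_of_finiteDimensional ht ih
  obtain ⟨N, hN⟩ := monotone_stabilizes_iff_artinian.2
    (inferInstance : IsArtinian ℂ (X → ℂ))
    ⟨fun k => OrderDual.toDual (outputNulling A' B' C' k), (outputNulling_antitone A' B' C').dual_right⟩
  have hbot : outputNulling A' B' C' N = ⊥ := by
    have hN1 : outputNulling A' B' C' N = outputNulling A' B' C' (N + 1) :=
      hN (N + 1) (Nat.le_succ N)
    refine eq_bot_of_pencil A' B' C' h _ ?_ ?_
    · intro z hz
      rw [hN1, mem_outputNulling_succ] at hz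
      exact hz.1
    · intro z hz
      rw [hN1, mem_outputNulling_succ] at hz
      exact hz.2
  have hx0 : ∀ t, 0 ≤ t → c (x t) = 0 := by
    intro t ht
    simpa [hbot] using hmem N t ht
  intro t ht
  have h0 := (hx' t ht).mem_submodule (W := ⊥) isClosed_singleton ht
    (fun t ht => by simpa using hx0 t ht)
  rw [hx0 t ht, Submodule.mem_bot] at h0
  have h1 := (h 0 0 _ (by simpa using h0) (by simp)).2
  refine ⟨funext fun i => ?_, funext fun k => ?_⟩
  · simpa [hc] using congrFun (hx0 t ht) i
  · simpa using congrFun h1 k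

end

noncomputable section

/-! ## Generic injectivity of structured pencils -/

open Polynomial in
/-- Polynomials in one variable without common factors of positive degree have a nonzero constant
in their ideal. -/
theorem exists_C_mem_span_of_natDegree_eq_zero {R : Type*} [CommRing R] [IsDomain R]
    [IsGCDMonoid R] (S : Set R[X]) (hS : ∃ f ∈ S, f ≠ 0)
    (h : ∀ φ : R[X], (∀ f ∈ S, φ ∣ f) → φ.natDegree = 0) :
    ∃ P : R, P ≠ 0 ∧ C P ∈ Ideal.span S := by
  let : NormalizedGCDMonoid R := Nonempty.some inferInstance
  let K := FractionRing R
  let := Polynomial.algebra R K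
  have := Polynomial.isLocalization (nonZeroDivisors R) K
  obtain ⟨f₀, hf₀, hf₀0⟩ := hS
  have hinj : Function.Injective (algebraMap R K) := IsFractionRing.injective R K
  let I : Ideal K[X] := (Ideal.span S).map (algebraMap R[X] K[X])
  have halg : ∀ p : R[X], algebraMap R[X] K[X] p = p.map (algebraMap R K) := fun p => rfl
  -- Over the fraction field one `q` generates the ideal. By Gauss's lemma the primitive part of a
  -- denominator-free multiple of `q` divides every `f ∈ S`, so `q` is a nonzero constant. Clearing
  -- denominators in `1 ∈ I` gives `P`.
  obtain ⟨q, hq⟩ := (IsPrincipalIdealRing.principal I).principal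
  have hq' : I = Ideal.span {q} := hq
  have hqd : ∀ f ∈ S, q ∣ f.map (algebraMap R K) := by
    intro f hf
    rw [← Ideal.mem_span_singleton, ← hq', ← halg]
    exact Ideal.mem_map_of_mem _ (Ideal.subset_span hf)
  have hq0 : q ≠ 0 := by
    rintro rfl
    have := zero_dvd_iff.1 (hqd f₀ hf₀)
    exact hf₀0 ((Polynomial.map_eq_zero_iff hinj).1 this)
  obtain ⟨b, hb, hbq⟩ := IsLocalization.integerNormalization_spec (nonZeroDivisors R) q
  set r := IsLocalization.integerNormalization (nonZeroDivisors R) q with hr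
  have hb0 : algebraMap R K b ≠ 0 := by
    rw [Ne, map_eq_zero_iff _ hinj]; exact nonZeroDivisors.ne_zero hb
  have hr0 : r ≠ 0 := by
    intro h0
    rw [h0, Polynomial.map_zero, Algebra.smul_def, Polynomial.algebraMap_apply] at hbq
    exact mul_ne_zero (C_ne_zero.2 hb0) hq0 hbq.symm
  have hdeg : r.primPart.natDegree = 0 := by
    refine h _ fun f hf => ?_
    refine r.isPrimitive_primPart.dvd_of_fraction_map_dvd_fraction_map (K := K) ?_
    refine dvd_trans ?_ (hqd f hf)
    have h1 : r.primPart.map (algebraMap R K) ∣ C (algebraMap R K b) * q := by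
      rw [← Polynomial.algebraMap_apply, ← Algebra.smul_def, ← hbq]
      exact Polynomial.map_dvd _ r.primPart_dvd
    exact ((isUnit_C.2 hb0.isUnit).dvd_mul_left).1 h1
  have hqdeg : q.natDegree = 0 := by
    rw [natDegree_primPart] at hdeg
    have := congrArg natDegree hbq
    rw [natDegree_map_eq_of_injective hinj, hdeg, Algebra.smul_def, Polynomial.algebraMap_apply,
      natDegree_C_mul hb0] at this
    exact this.symm
  have hqu : IsUnit q := by
    rw [eq_C_of_natDegree_eq_zero hqdeg] at hq0 ⊢
    exact isUnit_C.2 (C_ne_zero.1 hq0).isUnit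
  have htop : I = ⊤ := by rw [hq', Ideal.span_singleton_eq_top]; exact hqu
  have h1 : algebraMap R[X] K[X] 1 ∈ I := by rw [htop]; trivial
  obtain ⟨m, ⟨P, hP, rfl⟩, hm⟩ := (IsLocalization.algebraMap_mem_map_algebraMap_iff
    ((nonZeroDivisors R).map C) K[X] (Ideal.span S) 1).1 h1
  exact ⟨P, nonZeroDivisors.ne_zero hP, by simpa using hm⟩

open Polynomial in
-- Degrees add over a domain, so a factor of a polynomial that is constant in the new variable is
-- constant too; setting that variable to `0` identifies the constant.
theorem hom_eq_C_of_dvd {B : Type*} [CommRing B] [IsDomain B] (τ : B →+* B[X])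
    (hτ : ∀ b, (τ b).eval 0 = b) {φ g : B} (hg : g ≠ 0) (hτg : τ g = C g) (h : φ ∣ g) :
    τ φ = C φ := by
  obtain ⟨ψ, rfl⟩ := h
  have h0 : ∀ b, b ≠ 0 → τ b ≠ 0 := fun b hb h0 => hb (by rw [← hτ b, h0, eval_zero])
  have h1 := congrArg natDegree hτg
  rw [map_mul, natDegree_mul (h0 _ (left_ne_zero_of_mul hg)) (h0 _ (right_ne_zero_of_mul hg)),
    natDegree_C, Nat.add_eq_zero_iff] at h1
  rw [eq_C_of_natDegree_eq_zero h1.1, coeff_zero_eq_eval_zero, hτ]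

open Polynomial in
theorem map_det_eq_C {γ R : Type*} [Fintype γ] [DecidableEq γ] [CommRing R] (τ : R →+* R[X])
    (A : Matrix γ γ R) (h : ∀ c c', τ (A c c') = C (A c c')) : τ A.det = C A.det := by
  rw [RingHom.map_det, RingHom.map_det]
  congr 1
  ext1 c c'
  exact h c c'

open Polynomial in
/-- The substitution `X_e ↦ X_e + T` for the variables `e ∈ J`, in the polynomials with
coefficients `MvPolynomial σ ℝ`; here `T` is the variable of these polynomials. -/
def shiftHom {σ : Type} [DecidableEq σ] (J : Finset σ) :
    (MvPolynomial σ ℝ)[X] →+* (MvPolynomial σ ℝ)[X] :=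
  eval₂RingHom (MvPolynomial.eval₂Hom (C.comp MvPolynomial.C)
    fun e => C (MvPolynomial.X e) + if e ∈ J then X else 0) X

open Polynomial in
theorem shiftHom_C_X {σ : Type} [DecidableEq σ] (J : Finset σ) (e : σ) :
    shiftHom J (C (MvPolynomial.X e)) = C (MvPolynomial.X e) + if e ∈ J then X else 0 := by
  simp [shiftHom]

open Polynomial in
theorem shiftHom_X {σ : Type} [DecidableEq σ] (J : Finset σ) :
    shiftHom J X = X := by
  simp [shiftHom]

open Polynomial in
theorem polynomial_mvPolynomial_hom_ext {σ : Type} {B : Type*} [CommRing B]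
    {f g : (MvPolynomial σ ℝ)[X] →+* B}
    (hC : ∀ r : ℝ, f (C (MvPolynomial.C r)) = g (C (MvPolynomial.C r)))
    (hV : ∀ e, f (C (MvPolynomial.X e)) = g (C (MvPolynomial.X e))) (hX : f X = g X) : f = g := by
  refine Polynomial.ringHom_ext' ?_ hX
  exact MvPolynomial.ringHom_ext hC hV

open Polynomial in
-- The hypothesis `hτ` expresses that `g` does not involve `X_e`. Translating `X_e` by a fresh
-- variable, `hom_eq_C_of_dvd` shows that the divisor `φ` does not involve it either; the fresh
-- variable is then specialized to the pencil variable.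
theorem shiftHom_singleton_eq_of_dvd {σ : Type} [DecidableEq σ] (e : σ)
    {φ g : (MvPolynomial σ ℝ)[X]} (hg : g ≠ 0) (h : φ ∣ g)
    (hτ : ∀ τ : (MvPolynomial σ ℝ)[X] →+* (MvPolynomial σ ℝ)[X][X],
      (∀ e', e' ≠ e → τ (C (MvPolynomial.X e')) = C (C (MvPolynomial.X e'))) →
      τ X = C X → τ g = C g) : shiftHom {e} φ = φ := by
  let τ : (MvPolynomial σ ℝ)[X] →+* (MvPolynomial σ ℝ)[X][X] :=
    eval₂RingHom (MvPolynomial.eval₂Hom (S₁ := (MvPolynomial σ ℝ)[X][X])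
      ((C.comp C).comp MvPolynomial.C) fun e' => C (C (MvPolynomial.X e')) + if e' = e then X else 0) (C X)
  have h0 : (evalRingHom 0).comp τ = RingHom.id _ := by
    refine polynomial_mvPolynomial_hom_ext (fun r => by simp [τ]) (fun e' => ?_) (by simp [τ])
    by_cases he : e' = e <;> simp [τ, he]
  have h1 : (evalRingHom X).comp τ = shiftHom {e} := by
    refine polynomial_mvPolynomial_hom_ext (fun r => by simp [τ, shiftHom]) (fun e' => ?_)
      (by simp [τ, shiftHom])
    by_cases he : e' = e <;> simp [τ, shiftHom, he]
  have h2 := hom_eq_C_of_dvd τ (fun b => RingHom.congr_fun h0 b) hg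
    (hτ τ (fun e' he => by simp [τ, he]) (by simp [τ])) h
  rw [← h1, RingHom.comp_apply, h2]
  simp

open Polynomial in
theorem shiftHom_eq_of_forall_singleton {σ : Type} [DecidableEq σ] (J : Finset σ)
    {φ : (MvPolynomial σ ℝ)[X]} (h : ∀ e ∈ J, shiftHom {e} φ = φ) : shiftHom J φ = φ := by
  induction J using Finset.induction_on with
  | empty =>
    have : shiftHom (∅ : Finset σ) = RingHom.id _ :=
      polynomial_mvPolynomial_hom_ext (fun r => by simp [shiftHom]) (fun e => by simp [shiftHom])
        (by simp [shiftHom])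
    rw [this, RingHom.id_apply]
  | insert a J ha ih =>
    have : shiftHom (insert a J) = (shiftHom {a}).comp (shiftHom J) := by
      refine polynomial_mvPolynomial_hom_ext (fun r => by simp [shiftHom]) (fun e => ?_)
        (by simp [shiftHom])
      rw [RingHom.comp_apply, shiftHom_C_X, shiftHom_C_X, map_add, shiftHom_C_X]
      by_cases h1 : e = a
      · subst h1; simp [ha]
      · by_cases h2 : e ∈ J <;> simp [h1, h2, shiftHom_X]
    rw [this, RingHom.comp_apply, ih fun e he => h e (Finset.mem_insert_of_mem he),
      h a (Finset.mem_insert_self _ _)]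

open Polynomial in
/-- A generic entry: the variable of a free position, with the pencil variable subtracted at the
positions `loop`. -/
def pencilEntry {ρ γ σ : Type} (M : ρ → γ → Option σ) (loop : ρ → γ → Prop) (i : ρ) (c : γ) :
    (MvPolynomial σ ℝ)[X] :=
  open Classical in
  (M i c).elim 0 (fun e => C (MvPolynomial.X e)) - if loop i c then X else 0

set_option maxHeartbeats 800000 in
open Polynomial in
-- The decisive hypothesis is `havoid`: a minor that omits the row of a self-loop is free of its
-- parameter, and so is every common divisor `φ` of the minors. Thus `φ` is fixed by `shiftHom J`,
-- which turns each `X_e - s` into `X_e` and each minor into its value at `s = 0`. So `φ` divides a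
-- nonzero polynomial without `s`.
theorem generic_pencil_injective {ρ γ σ : Type} [Fintype γ] [Finite σ]
    (M : ρ → γ → Option σ) (loop : ρ → γ → Prop) [∀ i c, Decidable (loop i c)]
    (hinj : ∀ i c i' c' e, M i c = some e → M i' c' = some e → i = i' ∧ c = c')
    (hloop : ∀ i c, loop i c → M i c ≠ none) (𝓜 : Set (γ → ρ)) (hne : 𝓜.Nonempty)
    (hM : ∀ f ∈ 𝓜, Function.Injective f ∧ ∀ c, M (f c) c ≠ none)
    (havoid : ∀ i c, loop i c → ∃ f ∈ 𝓜, ∀ c', f c' ≠ i) :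
    ∃ P : MvPolynomial σ ℝ, P ≠ 0 ∧ ∀ θ : σ → ℝ, MvPolynomial.eval θ P ≠ 0 →
      ∀ (s : ℂ) (z : γ → ℂ), (∀ f ∈ 𝓜, ∀ c, ∑ c', ((M (f c) c').elim 0 (fun e => (θ e : ℂ)) -
        if loop (f c) c' then s else 0) * z c' = 0) → z = 0 := by
  classical
  have := Fintype.ofFinite σ
  let D₀ : (γ → ρ) → MvPolynomial σ ℝ := fun f =>
    (Matrix.of fun c c' => (M (f c) c').elim 0 MvPolynomial.X).det
  let D : (γ → ρ) → (MvPolynomial σ ℝ)[X] := fun f =>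
    (Matrix.of fun c c' => pencilEntry M loop (f c) c').det
  have hD₀ : ∀ f ∈ 𝓜, D₀ f ≠ 0 := by
    intro f hf h0
    -- Parameters at matched positions are `1` and all others `0`, which makes the selected square
    -- matrix the identity.
    let θ : σ → ℝ := fun e => if ∃ c, M (f c) c = some e then 1 else 0
    have h1 : MvPolynomial.eval θ (D₀ f) = 1 := by
      simp only [D₀, RingHom.map_det]
      rw [← Matrix.det_one (n := γ)]
      congr 1
      ext c c'
      simp only [RingHom.mapMatrix_apply, Matrix.map_apply, Matrix.of_apply]
      cases he : M (f c) c' with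
      | none =>
        have : c ≠ c' := by rintro rfl; exact (hM f hf).2 c he
        simp [Matrix.one_apply_ne this]
      | some e =>
        simp only [Option.elim_some, MvPolynomial.eval_X, θ]
        by_cases hc : c = c'
        · subst hc
          rw [if_pos ⟨c, he⟩, Matrix.one_apply_eq]
        · rw [if_neg, Matrix.one_apply_ne hc]
          rintro ⟨c₁, h₁⟩
          obtain ⟨h₂, h₃⟩ := hinj _ _ _ _ _ he h₁
          exact hc (((hM f hf).1 h₂).trans h₃.symm)
    rw [h0, map_zero] at h1
    exact zero_ne_one h1
  have heval : ∀ f, (D f).eval 0 = D₀ f := by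
    intro f
    rw [← coe_evalRingHom, RingHom.map_det]
    congr 1
    ext1 c c'
    cases he : M (f c) c' <;> by_cases hl : loop (f c) c' <;> simp [pencilEntry, he, hl]
  have hD : ∀ f ∈ 𝓜, D f ≠ 0 := fun f hf h0 => hD₀ f hf (by rw [← heval, h0, eval_zero])
  let J : Finset σ := {e | ∃ i c, loop i c ∧ M i c = some e}
  have hshift : ∀ f, shiftHom J (D f) = C (D₀ f) := by
    intro f
    simp only [D, D₀, RingHom.map_det]
    congr 1
    ext1 c c'
    simp only [RingHom.mapMatrix_apply, Matrix.map_apply, Matrix.of_apply, pencilEntry, map_sub]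
    cases he : M (f c) c' with
    | none =>
      have : ¬ loop (f c) c' := fun hl => hloop _ _ hl he
      simp [this]
    | some e =>
      rw [Option.elim_some, shiftHom_C_X]
      by_cases hl : loop (f c) c'
      · have : e ∈ J := by simpa [J] using ⟨_, _, hl, he⟩
        simp [hl, this, shiftHom_X]
      · have : e ∉ J := by
          simp only [J, Finset.mem_filter, Finset.mem_univ, true_and]
          rintro ⟨i, c₁, h₁, h₂⟩
          obtain ⟨rfl, rfl⟩ := hinj _ _ _ _ _ he h₂
          exact hl h₁
        simp [hl, this]
  have hdiv : ∀ φ : (MvPolynomial σ ℝ)[X], (∀ g ∈ D '' 𝓜, φ ∣ g) → φ.natDegree = 0 := by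
    intro φ hφ
    have hfix : shiftHom J φ = φ := by
      refine shiftHom_eq_of_forall_singleton J fun e he => ?_
      simp only [J, Finset.mem_filter, Finset.mem_univ, true_and] at he
      obtain ⟨i, c, hl, hi⟩ := he
      obtain ⟨f, hf, hfi⟩ := havoid i c hl
      refine shiftHom_singleton_eq_of_dvd e (hD f hf) (hφ _ ⟨f, hf, rfl⟩) fun τ hτ hτX => ?_
      refine map_det_eq_C τ _ fun c₁ c₂ => ?_
      simp only [Matrix.of_apply, pencilEntry, map_sub]
      congr 1
      · cases he' : M (f c₁) c₂ with
        | none => simp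
        | some e' =>
          refine hτ e' ?_
          rintro rfl
          exact hfi c₁ (hinj _ _ _ _ _ he' hi).1
      · split_ifs <;> simp [hτX]
    obtain ⟨f, hf⟩ := hne
    have h1 := map_dvd (shiftHom J) (hφ _ ⟨f, hf, rfl⟩)
    rw [hfix, hshift] at h1
    have h2 := natDegree_le_of_dvd h1 (C_ne_zero.2 (hD₀ f hf))
    rwa [natDegree_C, Nat.le_zero] at h2
  obtain ⟨f₀, hf₀⟩ := hne
  obtain ⟨P, hP0, hP⟩ := exists_C_mem_span_of_natDegree_eq_zero (D '' 𝓜)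
    ⟨_, ⟨f₀, hf₀, rfl⟩, hD f₀ hf₀⟩ hdiv
  refine ⟨P, hP0, fun θ hθ s z hz => ?_⟩
  let ev : (MvPolynomial σ ℝ)[X] →+* ℂ :=
    eval₂RingHom (MvPolynomial.eval₂Hom Complex.ofRealHom fun e => (θ e : ℂ)) s
  have hevC : ev (C P) = ((MvPolynomial.eval θ P : ℝ) : ℂ) := by
    simp only [ev, coe_eval₂RingHom, eval₂_C]
    have : MvPolynomial.eval₂Hom Complex.ofRealHom (fun e => (θ e : ℂ)) =
        Complex.ofRealHom.comp (MvPolynomial.eval θ) :=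
      MvPolynomial.ringHom_ext (fun r => by simp) (fun e => by simp)
    rw [this]; rfl
  -- If all minors vanished at `(θ, s)`, so would `P`, which lies in their ideal and does not
  -- involve `s`.
  have hexists : ∃ f ∈ 𝓜, ev (D f) ≠ 0 := by
    by_contra! hall
    have h1 : Ideal.span (D '' 𝓜) ≤ RingHom.ker ev := by
      rw [Ideal.span_le]
      rintro _ ⟨f, hf, rfl⟩
      exact hall f hf
    have h2 : ev (C P) = 0 := h1 hP
    rw [hevC] at h2
    exact hθ (by exact_mod_cast h2)
  obtain ⟨f, hf, hne⟩ := hexists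
  simp only [D, RingHom.map_det] at hne
  refine Matrix.eq_zero_of_mulVec_eq_zero hne ?_
  ext c
  rw [Pi.zero_apply, ← hz f hf c]
  refine Finset.sum_congr rfl fun c' _ => ?_
  congr 1
  simp only [RingHom.mapMatrix_apply, Matrix.map_apply, Matrix.of_apply, pencilEntry, map_sub]
  congr 1
  · cases M (f c) c' <;> simp [ev]
  · split_ifs <;> simp [ev]

end

noncomputable section

/-! ## Walks, paths and a matching version of Menger's theorem -/

open Relation

/-- There is a walk from `a` to `b` that avoids the vertices in `Q`. -/
def AvoidReach {V : Type} (E : V → V → Prop) (Q : Set V) (a b : V) : Prop :=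
  a ∉ Q ∧ ReflTransGen (fun c d => E c d ∧ d ∉ Q) a b

/-- There is a walk from `a` into `T` that avoids the vertex `v`. -/
def Escapes {V : Type} (E : V → V → Prop) (T : Finset V) (v a : V) : Prop :=
  ∃ s ∈ T, AvoidReach E {v} a s

theorem reach_mono {V : Type*} {r p : V → V → Prop} {a b : V} (h : ReflTransGen r a b)
    (hrp : ∀ c d, r c d → p c d) : ReflTransGen p a b :=
  ReflTransGen.mono hrp _ _ h

section Walks

variable {V : Type} {E : V → V → Prop} {Q : Set V} {T : Finset V} {a b c v w e : V}

theorem AvoidReach.refl (h : a ∉ Q) : AvoidReach E Q a a := ⟨h, .refl⟩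

theorem AvoidReach.head (ha : a ∉ Q) (h : E a b) (hb : AvoidReach E Q b c) :
    AvoidReach E Q a c := ⟨ha, hb.2.head ⟨h, hb.1⟩⟩

theorem AvoidReach.trans (h : AvoidReach E Q a b) (h' : AvoidReach E Q b c) :
    AvoidReach E Q a c := ⟨h.1, h.2.trans h'.2⟩

theorem AvoidReach.notMem_right (h : AvoidReach E Q a b) : b ∉ Q := by
  rcases h.2.cases_tail with rfl | ⟨c, -, -, hb⟩
  exacts [h.1, hb]

theorem AvoidReach.reach (h : AvoidReach E Q a b) : ReflTransGen E a b :=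
  reach_mono h.2 fun _ _ h => h.1

theorem AvoidReach.anti {Q' : Set V} (hQ : Q' ⊆ Q) (h : AvoidReach E Q a b) :
    AvoidReach E Q' a b :=
  ⟨fun ha => h.1 (hQ ha), reach_mono h.2 fun _ _ h => ⟨h.1, fun hd => h.2 (hQ hd)⟩⟩

theorem Escapes.head (ha : a ≠ v) (h : E a b) (hb : Escapes E T v b) : Escapes E T v a := by
  obtain ⟨s, hs, hr⟩ := hb
  exact ⟨s, hs, hr.head (by simpa using ha) h⟩

theorem Escapes.ne (h : Escapes E T v a) : a ≠ v := by
  obtain ⟨s, hs, hr⟩ := h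
  simpa using hr.1

theorem exists_last_not {r : V → V → Prop} {p : V → Prop} (h : ReflTransGen r a b) (ha : ¬ p a) :
    ∃ w, ¬ p w ∧ ReflTransGen (fun c d => r c d ∧ p d) w b := by
  have key : (p a ∧ ReflTransGen (fun c d => r c d ∧ p d) a b) ∨
      ∃ w, ¬ p w ∧ ReflTransGen (fun c d => r c d ∧ p d) w b := by
    clear ha
    induction h using ReflTransGen.head_induction_on with
    | refl =>
      by_cases hb : p b
      · exact .inl ⟨hb, .refl⟩
      · exact .inr ⟨b, hb, .refl⟩
    | head h _ ih =>
      rename_i a c _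
      rcases ih with ⟨hc, ih⟩ | ih
      · by_cases hpa : p a
        · exact .inl ⟨hpa, ih.head ⟨h, hc⟩⟩
        · exact .inr ⟨a, hpa, ih.head ⟨h, hc⟩⟩
      · exact .inr ih
  exact key.resolve_left fun h => ha h.1

theorem reflTransGen_subtype {r : V → V → Prop} {p : V → Prop} (ha : p a)
    (h : ReflTransGen (fun c d => r c d ∧ p d) a b) :
    ∃ hb : p b, ReflTransGen (fun c d : Subtype p => r c d) ⟨a, ha⟩ ⟨b, hb⟩ := by
  induction h with
  | refl => exact ⟨ha, .refl⟩
  | tail _ h ih =>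
    obtain ⟨hb, ih⟩ := ih
    exact ⟨h.2, ih.tail h.1⟩

/-- Whichever of `w` and `e` a walk to `w` meets first is reached while avoiding the other. -/
theorem avoidReach_or_avoidReach (hne : w ≠ e) (h : ReflTransGen E a w) :
    AvoidReach E {e} a w ∨ AvoidReach E {w} a e := by
  induction h using ReflTransGen.head_induction_on with
  | refl => exact .inl (.refl (by simpa using hne))
  | head h _ ih =>
    rename_i a c _
    by_cases hae : a = e
    · subst hae
      exact .inr (.refl (by simpa using hne.symm))
    by_cases haw : a = w
    · subst haw
      exact .inl (.refl (by simpa using hne))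
    exact ih.imp (.head (by simpa using hae) h) (.head (by simpa using haw) h)

theorem reach_through_of_not_escapes (hb : b ∈ T) (h : ReflTransGen E a b)
    (hv : ¬ Escapes E T v a) : ReflTransGen E a v ∧ ReflTransGen E v b := by
  induction h using ReflTransGen.head_induction_on with
  | refl =>
    by_cases hbv : b = v
    · subst hbv; exact ⟨.refl, .refl⟩
    · exact absurd ⟨b, hb, .refl (by simpa using hbv)⟩ hv
  | head h h' ih =>
    rename_i a c
    by_cases hav : a = v
    · subst hav; exact ⟨.refl, h'.head h⟩
    · obtain ⟨h1, h2⟩ := ih fun hc => hv (hc.head hav h)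
      exact ⟨h1.head h, h2⟩

theorem reach_of_not_escapes (hb : b ∈ T) (h : ReflTransGen E a b) (hv : ¬ Escapes E T v a) :
    ReflTransGen E a v :=
  (reach_through_of_not_escapes hb h hv).1

theorem exists_nodup_chain {r : V → V → Prop} (h : ReflTransGen r a b) :
    ∃ l : List V, l.IsChain r ∧ l.Nodup ∧ l.head? = some a ∧ l.getLast? = some b := by
  induction h using ReflTransGen.head_induction_on with
  | refl => exact ⟨[b], by simp⟩
  | head h _ ih =>
    rename_i a c _
    obtain ⟨l, hl, hn, hh, hlast⟩ := ih
    by_cases ha : a ∈ l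
    · obtain ⟨l₁, l₂, rfl⟩ := List.append_of_mem ha
      refine ⟨a :: l₂, hl.right_of_append, (List.nodup_append.1 hn).2.1, rfl, ?_⟩
      rwa [List.getLast?_append_of_ne_nil _ (by simp)] at hlast
    · cases l with
      | nil => simp at hh
      | cons d l =>
        simp only [List.head?_cons, Option.some.injEq] at hh
        subst hh
        exact ⟨a :: d :: l, List.isChain_cons_cons.2 ⟨h, hl⟩, List.nodup_cons.2 ⟨ha, hn⟩, rfl,
          by simpa using hlast⟩

theorem reach_of_mem_chain {r : V → V → Prop} {l : List V} (hl : l.IsChain r)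
    (hh : l.head? = some a) (hc : c ∈ l) : ReflTransGen r a c := by
  induction l generalizing a with
  | nil => simp at hh
  | cons d l ih =>
    simp only [List.head?_cons, Option.some.injEq] at hh
    subst hh
    rcases List.mem_cons.1 hc with rfl | hc
    · exact .refl
    · cases l with
      | nil => simp at hc
      | cons d' l =>
        rw [List.isChain_cons_cons] at hl
        exact (ih hl.2 rfl hc).head hl.1

/-- Going backwards from `c` is deterministic and can stop only at a vertex without predecessor. -/
theorem eq_of_reach_of_leftUnique {r : V → V → Prop} (hr : ∀ a b c, r a c → r b c → a = b)
    (ha : ∀ d, ¬ r d a) (hb : ∀ d, ¬ r d b) (hac : ReflTransGen r a c) (hbc : ReflTransGen r b c) :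
    a = b := by
  induction hac with
  | refl =>
    rcases hbc.cases_tail with h | ⟨d, -, h⟩
    · exact h
    · exact absurd h (ha d)
  | tail _ h ih =>
    rcases hbc.cases_tail with rfl | ⟨d, hd, h'⟩
    · exact absurd h (hb _)
    · exact ih (hr _ _ _ h' h ▸ hd)

end Walks

/-- Menger's theorem as a statement about matchings: if fewer than `#B` vertices never separate `B`
from `S`, the vertices can be matched injectively to successors outside `B`, to themselves (if
outside `B`) or to terminals of `S`. -/
theorem exists_matching_of_not_separated {V : Type} [Fintype V] [DecidableEq V] (E : V → V → Prop)
    (S B : Finset V) (h : ∀ Q : Finset V, Q.card < B.card →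
      ∃ b ∈ B, ∃ s ∈ S, AvoidReach E (Q : Set V) b s) :
    ∃ f : V → V ⊕ V, Function.Injective f ∧
      (∀ c d, f c = Sum.inl d → d ∉ B ∧ (E c d ∨ c = d)) ∧
      ∀ c s, f c = Sum.inr s → s = c ∧ c ∈ S := by
  classical
  let t : V → Finset (V ⊕ V) := fun c => Finset.univ.filter
    (Sum.elim (fun d => d ∉ B ∧ (E c d ∨ c = d)) (fun s => s = c ∧ c ∈ S))
  have hl : ∀ c d, Sum.inl d ∈ t c ↔ d ∉ B ∧ (E c d ∨ c = d) := fun c d => by simp [t]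
  have hr : ∀ c s, Sum.inr s ∈ t c ↔ s = c ∧ c ∈ S := fun c s => by simp [t]
  suffices hall : ∀ Z : Finset V, Z.card ≤ (Z.biUnion t).card by
    obtain ⟨f, hf, hft⟩ := (Finset.all_card_le_biUnion_card_iff_exists_injective t).1 hall
    exact ⟨f, hf, fun c d hd => (hl c d).1 (hd ▸ hft c), fun c s hs => (hr c s).1 (hs ▸ hft c)⟩
  by_contra! hZ
  obtain ⟨Z, hZ⟩ := hZ
  let U := Z.biUnion t
  let N : Finset (V ⊕ V) := (Z \ B).image Sum.inl
  have hNU : N ⊆ U := by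
    intro g hg
    obtain ⟨d, hd, rfl⟩ := Finset.mem_image.1 hg
    rw [Finset.mem_sdiff] at hd
    exact Finset.mem_biUnion.2 ⟨d, hd.1, (hl d d).2 ⟨hd.2, .inr rfl⟩⟩
  have hN : N.card = (Z \ B).card := Finset.card_image_of_injective _ Sum.inl_injective
  -- A set `Z` violating Hall's condition yields a separator: the values available to `Z` other than
  -- vertices of `Z`, together with the sources outside `Z`. Its size is at most `|U| - |Z \ B| + |B
  -- \ Z|`, which is less than `|B|` because `|U| < |Z|`.
  let Q : Finset V := (U \ N).image (Sum.elim id id) ∪ (B \ Z)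
  have hQ : Q.card < B.card := by
    have h1 : Q.card ≤ (U \ N).card + (B \ Z).card :=
      (Finset.card_union_le _ _).trans (Nat.add_le_add_right Finset.card_image_le _)
    have h2 := Finset.card_sdiff_add_card_eq_card hNU
    have h3 := Finset.card_sdiff_add_card_inter Z B
    have h4 := Finset.card_sdiff_add_card_inter B Z
    rw [Finset.inter_comm] at h4
    have h5 : U.card < Z.card := hZ
    omega
  obtain ⟨b, hb, s, hs, hbs⟩ := h Q hQ
  have hbZ : b ∈ Z := by
    by_contra hbZ
    exact hbs.1 (by simp [Q, hb, hbZ])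
  -- A walk avoiding `Q` that starts in `Z` stays in `Z`; but the terminals in `Z` belong to `Q`.
  have hQZ : ∀ c d, c ∈ Z → E c d → d ∉ Q → d ∈ Z := by
    intro c d hc hcd hd
    by_contra hdZ
    by_cases hdB : d ∈ B
    · exact hd (by simp [Q, hdB, hdZ])
    · refine hd (Finset.mem_union_left _ (Finset.mem_image.2 ⟨Sum.inl d, ?_, rfl⟩))
      refine Finset.mem_sdiff.2 ⟨Finset.mem_biUnion.2 ⟨c, hc, (hl c d).2 ⟨hdB, .inl hcd⟩⟩, ?_⟩
      simp [N, hdZ]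
  have hsZ : s ∈ Z := by
    have := hbs.2
    clear hbs hs
    induction this with
    | refl => exact hbZ
    | tail _ h ih => exact hQZ _ _ ih h.1 (by simpa using h.2)
  refine hbs.notMem_right (Finset.mem_union_left _ (Finset.mem_image.2 ⟨Sum.inr s, ?_, rfl⟩))
  exact Finset.mem_sdiff.2 ⟨Finset.mem_biUnion.2 ⟨s, hsZ, (hr s s).2 ⟨rfl, hs⟩⟩, by simp [N]⟩

theorem exists_matching_of_two_sources {V : Type} [Fintype V] [DecidableEq V] (E : V → V → Prop)
    (S : Finset V) {a b : V} (hab : a ≠ b) (h : ∀ v, Escapes E S v a ∨ Escapes E S v b) :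
    ∃ f : V → V ⊕ V, Function.Injective f ∧
      (∀ c d, f c = Sum.inl d → d ≠ a ∧ d ≠ b ∧ (E c d ∨ c = d)) ∧
      ∀ c s, f c = Sum.inr s → s = c ∧ c ∈ S := by
  obtain ⟨f, hf, hf1, hf2⟩ := exists_matching_of_not_separated E S {a, b} fun Q hQ => by
    rw [Finset.card_pair hab] at hQ
    have : Nonempty V := ⟨a⟩
    obtain ⟨v, hv⟩ := Finset.card_le_one_iff_subset_singleton.1 (Nat.lt_succ_iff.1 hQ)
    have hv' : (Q : Set V) ⊆ {v} := by exact_mod_cast hv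
    rcases h v with ⟨s, hs, hr⟩ | ⟨s, hs, hr⟩
    · exact ⟨a, by simp, s, hs, hr.anti hv'⟩
    · exact ⟨b, by simp, s, hs, hr.anti hv'⟩
  refine ⟨f, hf, fun c d hcd => ?_, hf2⟩
  have := hf1 c d hcd
  simp only [Finset.mem_insert, Finset.mem_singleton, not_or] at this
  exact ⟨this.1.1, this.1.2, this.2⟩

/-! ## The chain of essential vertices -/

section Chain

variable {V : Type} {E : V → V → Prop} {T : Finset V} {x w e d : V}

/-- A vertex `e` is essential if `¬ Escapes E T e x`. The hypothesis `hw` makes `w` the last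
essential vertex: after `w`, some walk to `T` meets only inessential vertices, hence avoids every
other essential one. -/
theorem escapes_of_last (hw : ∃ s ∈ T, ReflTransGen (fun c d => E c d ∧ Escapes E T d x) w s)
    (hwe : w ≠ e) (he : ¬ Escapes E T e x) : Escapes E T e w := by
  obtain ⟨s, hs, hr⟩ := hw
  refine ⟨s, hs, by simpa using hwe, reach_mono hr fun c d h => ⟨h.1, ?_⟩⟩
  rintro rfl
  exact he h.2

/-- Either `x` reaches `w` avoiding `e`, and continuing along the final walk of `w` contradicts that
`e` is essential; or `x` reaches `e` avoiding `w`, and an escape from `e` would bypass the essential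
vertex `w`. -/
theorem not_escapes_last (hx : ∃ s ∈ T, ReflTransGen E x s) (hwx : ¬ Escapes E T w x)
    (hw : ∃ s ∈ T, ReflTransGen (fun c d => E c d ∧ Escapes E T d x) w s)
    (he : ¬ Escapes E T e x) (hne : e ≠ w) : ¬ Escapes E T w e := by
  rintro ⟨s', hs', hr'⟩
  obtain ⟨s, hs, hr⟩ := hx
  rcases avoidReach_or_avoidReach hne.symm (reach_of_not_escapes hs hr hwx) with h | h
  · obtain ⟨s₁, hs₁, hr₁⟩ := escapes_of_last hw hne.symm he
    exact he ⟨s₁, hs₁, h.trans hr₁⟩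
  · exact hwx ⟨s', hs', h.trans hr'⟩

/-- The hypothesis `hnv` is the absence of a violation. An inessential successor `d` of `e` would
escape `w`, and `e` with it, against `not_escapes_last`. Thus the earlier essential vertices have no
edge into the region beyond `w`. -/
theorem not_escapes_of_edge (hx : ∃ s ∈ T, ReflTransGen E x s) (hwx : ¬ Escapes E T w x)
    (hw : ∃ s ∈ T, ReflTransGen (fun c d => E c d ∧ Escapes E T d x) w s)
    (hnv : ∀ j v, Escapes E T j x → Escapes E T v x ∨ Escapes E T v j)
    (he : ¬ Escapes E T e x) (hne : e ≠ w) (hed : E e d) : ¬ Escapes E T d x := by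
  intro hd
  exact not_escapes_last hx hwx hw he hne (.head hne hed ((hnv d w hd).resolve_left hwx))

theorem notMem_of_not_last (hx : ∃ s ∈ T, ReflTransGen E x s) (hwx : ¬ Escapes E T w x)
    (hw : ∃ s ∈ T, ReflTransGen (fun c d => E c d ∧ Escapes E T d x) w s)
    (he : ¬ Escapes E T e x) (hne : e ≠ w) : e ∉ T := fun heT =>
  not_escapes_last hx hwx hw he hne ⟨e, heT, .refl (by simpa using hne)⟩

/-- In the application `Z` is the part of the support of a kernel vector left after the region
beyond `w`, and `hstep` says that no row with zero right-hand side has exactly one nonzero term.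
Take `e ∈ Z` nearest to `w` and the next vertex `f` of a shortest walk. Then `f ∉ Z`, so another `c
∈ Z` has an edge to `f`. Both `e` and `c` continue through `f` to `w` avoiding each other. Whichever
of them `x` can reach first gives a walk to `T` that avoids the other, which is essential. -/
theorem chain_elimination (hx : ∃ s ∈ T, ReflTransGen E x s) (hwx : ¬ Escapes E T w x)
    (hw : ∃ s ∈ T, ReflTransGen (fun c d => E c d ∧ Escapes E T d x) w s)
    (hit : ∀ j, ∃ s ∈ T, ReflTransGen E j s) (Z : V → Prop)
    (hZ : ∀ e, Z e → ¬ Escapes E T e x ∧ e ≠ w)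
    (hstep : ∀ e f, Z e → E e f → ¬ Z f → ∃ c, c ≠ e ∧ Z c ∧ E c f) (e : V) : ¬ Z e := by
  -- `W n` consists of the vertices with a walk of exactly `n` edges to `w`.
  obtain ⟨W, hW0, hWs⟩ : ∃ W : ℕ → V → Prop, (∀ e, W 0 e ↔ e = w) ∧
      ∀ n e, W (n + 1) e ↔ ∃ f, E e f ∧ W n f :=
    ⟨fun n => Nat.rec (fun e => e = w) (fun _ P e => ∃ f, E e f ∧ P f) n,
      fun _ => Iff.rfl, fun _ _ => Iff.rfl⟩
  have hW : ∀ e, ReflTransGen E e w → ∃ n, W n e := by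
    intro e he
    induction he using ReflTransGen.head_induction_on with
    | refl => exact ⟨0, (hW0 _).2 rfl⟩
    | head h _ ih => obtain ⟨n, hn⟩ := ih; exact ⟨n + 1, (hWs _ _).2 ⟨_, h, hn⟩⟩
  have hWa : ∀ n f, W n f → ∀ c, (∀ m ≤ n, ¬ W m c) → AvoidReach E {c} f w := by
    intro n
    induction n with
    | zero =>
      intro f hf c hc
      rw [hW0] at hf
      subst hf
      exact .refl fun h => hc 0 le_rfl ((hW0 _).2 h.symm)
    | succ n ih =>
      intro f hf c hc
      obtain ⟨g, hfg, hg⟩ := (hWs _ _).1 hf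
      refine .head ?_ hfg (ih g hg c fun m hm => hc m (hm.trans n.le_succ))
      rintro rfl
      exact hc (n + 1) le_rfl hf
  have main : ∀ n e, Z e → ¬ W n e := by
    intro n
    induction n using Nat.strong_induction_on with
    | _ n ih =>
      intro e he hn
      obtain ⟨hex, hew⟩ := hZ e he
      cases n with
      | zero => exact hew ((hW0 _).1 hn)
      | succ n =>
        obtain ⟨f, hef, hf⟩ := (hWs _ _).1 hn
        have hfZ : ¬ Z f := fun h => ih n n.lt_succ_self f h hf
        obtain ⟨c, hce, hc, hcf⟩ := hstep e f he hef hfZ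
        obtain ⟨hcx, hcw⟩ := hZ c hc
        have av : ∀ g, Z g → AvoidReach E {g} f w := fun g hg =>
          hWa n f hf g fun m hm => ih m (Nat.lt_succ_of_le hm) g hg
        have contra : ∀ g g', Z g → Z g' → E g f → g ≠ g' → ¬ AvoidReach E {g'} x g := by
          intro g g' hg hg' hgf hgg h
          obtain ⟨s, hs, hr⟩ := escapes_of_last hw (hZ g' hg').2.symm (hZ g' hg').1
          exact (hZ g' hg').1 ⟨s, hs, h.trans ((av g' hg').head (by simpa using hgg) hgf |>.trans hr)⟩
        obtain ⟨s, hs, hr⟩ := hx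
        rcases avoidReach_or_avoidReach hce (reach_of_not_escapes hs hr hcx) with h | h
        · exact contra c e hc he hcf hce h
        · exact contra e c he hc hef hce.symm h
  intro he
  obtain ⟨s, hs, hr⟩ := hit e
  obtain ⟨hex, hew⟩ := hZ e he
  obtain ⟨n, hn⟩ := hW e (reach_of_not_escapes hs hr (not_escapes_last hx hwx hw hex hew))
  exact main n e he hn

/-- Between the last essential vertex and the terminals, no vertex separates. -/
theorem escapes_subtype (hx : ∃ s ∈ T, ReflTransGen E x s) (hxx : ¬ Escapes E T w x)
    (hw : ∃ s ∈ T, ReflTransGen (fun c d => E c d ∧ Escapes E T d x) w s)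
    (hnv : ∀ j v, Escapes E T j x → Escapes E T v x ∨ Escapes E T v j)
    {j v : V} (hj : Escapes E T j x) (hv : Escapes E T v x ∨ v = w) :
    (∃ s ∈ T, w ≠ v ∧
      ReflTransGen (fun c d => (E c d ∧ d ≠ v) ∧ (Escapes E T d x ∨ d = w)) w s) ∨
    (∃ s ∈ T, j ≠ v ∧
      ReflTransGen (fun c d => (E c d ∧ d ≠ v) ∧ (Escapes E T d x ∨ d = w)) j s) := by
  rcases hv with hv | rfl
  · left
    obtain ⟨s, hs, hr⟩ := hv
    have hxx' : ¬ Escapes E T x x := fun h => h.ne rfl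
    -- The last essential vertex on a walk avoiding `v` must be `w`, since any other one would
    -- escape `w`.
    obtain ⟨w', hw', hr'⟩ := exists_last_not (p := fun d => Escapes E T d x) hr.2 hxx'
    have hww : w' = w := by
      by_contra hne
      refine not_escapes_last hx hxx hw hw' hne
        ⟨s, hs, by simpa using hne, reach_mono hr' fun c d h => ⟨h.1.1, ?_⟩⟩
      rintro rfl
      exact hxx h.2
    subst hww
    refine ⟨s, hs, ?_, reach_mono hr' fun c d h => ⟨⟨h.1.1, by simpa using h.1.2⟩, .inl h.2⟩⟩
    rintro rfl
    exact hw' ⟨s, hs, hr⟩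
  · right
    obtain ⟨s, hs, hjv, hr⟩ := (hnv j v hj).resolve_left hxx
    refine ⟨s, hs, by simpa using hjv, ?_⟩
    clear hj hjv
    induction hr using ReflTransGen.head_induction_on with
    | refl => exact .refl
    | head h h' ih =>
      rename_i a c
      have hc : Escapes E T c x := by
        by_contra hc
        exact not_escapes_last hx hxx hw hc (by simpa using h.2) ⟨s, hs, h.2, h'⟩
      exact ih.head ⟨⟨h.1, by simpa using h.2⟩, .inl hc⟩

end Chain
end

noncomputable section

/-! ## The violation test in terms of walks on the states -/

open Relation

/-- The edges of the auxiliary system between the original states. -/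
def auxEdge {X : Type} (A : StructMatrix X X) (x : X) (a b : X) : Prop := A b a = true ∧ b ≠ x

/-- Every state reaches a state in `T`. -/
def Hits {X : Type} (A : StructMatrix X X) (x : X) (T : Finset X) : Prop :=
  ∀ j, ∃ s ∈ T, ReflTransGen (auxEdge A x) j s

/-! ### Bounds for the size of linkings -/

section Linkings

variable {V : Type} {G : Digraph V} {V₁ V₂ : Set V}

/-- Disjoint paths have different first vertices. -/
theorem IsLinking.card_le {L : Finset (List V)} (hL : IsLinking G V₁ V₂ L) {F : Finset V}
    (hF : V₁ ⊆ F) : L.card ≤ F.card := by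
  classical
  rw [← Finset.card_image_of_injective F (Option.some_injective V)]
  refine Finset.card_le_card_of_injOn List.head? ?_ ?_
  · intro p hp
    obtain ⟨v, hv, hpv⟩ := (hL.1 p hp).2.2.1
    exact Finset.mem_coe.2 (Finset.mem_image.2 ⟨v, hF hv, hpv.symm⟩)
  · intro p hp q hq hpq
    by_contra hne
    obtain ⟨v, hv, hpv⟩ := (hL.1 p hp).2.2.1
    exact hL.2 p hp q hq hne (List.mem_of_mem_head? hpv) (List.mem_of_mem_head? (hpq ▸ hpv))

theorem rho_le [Finite V] {k : ℕ} (h : ∀ L, IsLinking G V₁ V₂ L → L.card ≤ k) :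
    rho G V₁ V₂ ≤ k := by
  refine csSup_le' ?_
  rintro _ ⟨L, hL, rfl⟩
  exact h L hL

theorem IsLinking.le_rho [Finite V] {L : Finset (List V)} (hL : IsLinking G V₁ V₂ L) :
    L.card ≤ rho G V₁ V₂ := by
  have := Fintype.ofFinite V
  refine le_csSup ⟨(Finset.univ : Finset V).card, ?_⟩ ⟨L, hL, rfl⟩
  rintro _ ⟨L', hL', rfl⟩
  exact hL'.card_le (by simp)

theorem IsPath.isLinking {p : List V} (hp : IsPath G V₁ V₂ p) : IsLinking G V₁ V₂ {p} :=
  ⟨by simpa using hp, by simp⟩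

end Linkings

/-! ### Sensor paths in the auxiliary digraph and walks between states -/

section Violation

variable {X : Type} [DecidableEq X] {A : StructMatrix X X} {x : X} {T : Finset X}

/-- The digraph of the auxiliary system with sensors on the states in `T`. -/
abbrev sensorDigraph (A : StructMatrix X X) (x : X) (T : Finset X) :
    Digraph ((X ⊕ Unit) ⊕ (X ⊕ Unit)) :=
  outputDigraph (auxSystem A x) (sensorMatrix (T.image Sum.inl))

/-- The sensor vertices of `sensorDigraph`. -/
abbrev sensorVertices (T : Finset X) : Set ((X ⊕ Unit) ⊕ (X ⊕ Unit)) :=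
  {v | ∃ s ∈ T.image (Sum.inl : X → X ⊕ Unit), v = Sum.inr s}

theorem sensorDigraph_adj_state {a b : X} :
    (sensorDigraph A x T).Adj (Sum.inl (Sum.inl a)) (Sum.inl (Sum.inl b)) ↔ auxEdge A x a b := by
  simp [outputDigraph, auxSystem, auxEdge]

theorem sensorDigraph_adj_sensor {a : X} {y : X ⊕ Unit} :
    (sensorDigraph A x T).Adj (Sum.inl (Sum.inl a)) (Sum.inr y) ↔ y = Sum.inl a ∧ a ∈ T := by
  simp [outputDigraph, sensorMatrix]

theorem sensorDigraph_adj_state_input {a : X} {k : Unit} :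
    ¬ (sensorDigraph A x T).Adj (Sum.inl (Sum.inl a)) (Sum.inl (Sum.inr k)) := by
  simp [outputDigraph, auxSystem]

theorem sensorDigraph_adj_input_state {b : X} {k : Unit} :
    (sensorDigraph A x T).Adj (Sum.inl (Sum.inr k)) (Sum.inl (Sum.inl b)) ↔ b = x := by
  simp [outputDigraph, auxSystem]

theorem sensorDigraph_adj_input {k : Unit} {g : (X ⊕ Unit) ⊕ (X ⊕ Unit)}
    (h : (sensorDigraph A x T).Adj (Sum.inl (Sum.inr k)) g) : g = Sum.inl (Sum.inl x) := by
  rcases g with (b | k') | y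
  · rw [sensorDigraph_adj_input_state] at h
    rw [h]
  · simp [outputDigraph, auxSystem] at h
  · simp [outputDigraph, sensorMatrix] at h

theorem escapes_of_chain {v a : X} {p : List ((X ⊕ Unit) ⊕ (X ⊕ Unit))}
    (hp : p.IsChain (sensorDigraph A x T).Adj) (hh : p.head? = some (Sum.inl (Sum.inl a)))
    (hl : ∃ w ∈ sensorVertices T, p.getLast? = some w) (hv : Sum.inl (Sum.inl v) ∉ p) :
    Escapes (auxEdge A x) T v a := by
  induction p generalizing a with
  | nil => simp at hh
  | cons g p ih =>
    simp only [List.head?_cons, Option.some.injEq] at hh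
    subst hh
    have hav : a ≠ v := by rintro rfl; simp at hv
    cases p with
    | nil =>
      obtain ⟨w, ⟨s, -, rfl⟩, hw⟩ := hl
      simp at hw
    | cons g' p =>
      rw [List.isChain_cons_cons] at hp
      rcases g' with (b | k) | y
      · refine (ih hp.2 rfl (by simpa using hl) fun h => hv (List.mem_cons_of_mem _ h)).head hav
          (sensorDigraph_adj_state.1 hp.1)
      · exact absurd hp.1 sensorDigraph_adj_state_input
      · exact ⟨a, (sensorDigraph_adj_sensor.1 hp.1).2, .refl (by simpa using hav)⟩

theorem escapes_of_path {v : X} {p : List ((X ⊕ Unit) ⊕ (X ⊕ Unit))}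
    (hp : IsPath (sensorDigraph A x T) {Sum.inl (Sum.inr ())} (sensorVertices T) p)
    (hv : Sum.inl (Sum.inl v) ∉ p) : Escapes (auxEdge A x) T v x := by
  obtain ⟨hc, -, ⟨_, rfl, hh⟩, hl⟩ := hp
  cases p with
  | nil => simp at hh
  | cons g p =>
    simp only [List.head?_cons, Option.some.injEq] at hh
    subst hh
    cases p with
    | nil =>
      obtain ⟨w, ⟨s, -, rfl⟩, hw⟩ := hl
      simp at hw
    | cons g' p =>
      rw [List.isChain_cons_cons] at hc
      obtain rfl := sensorDigraph_adj_input hc.1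
      exact escapes_of_chain hc.2 rfl (by simpa using hl) fun h => hv (List.mem_cons_of_mem _ h)

theorem exists_path_of_avoidReach {Q : Set X} {s : X} (hs : s ∈ T)
    (h : AvoidReach (auxEdge A x) Q x s) :
    ∃ p, IsPath (sensorDigraph A x T) {Sum.inl (Sum.inr ())} (sensorVertices T) p ∧
      ∀ v ∈ Q, Sum.inl (Sum.inl v) ∉ p := by
  obtain ⟨hx, hr⟩ := h
  let r : (X ⊕ Unit) ⊕ (X ⊕ Unit) → (X ⊕ Unit) ⊕ (X ⊕ Unit) → Prop := fun g g' =>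
    (sensorDigraph A x T).Adj g g' ∧ ∀ v ∈ Q, g' ≠ Sum.inl (Sum.inl v)
  have h1 : ReflTransGen r (Sum.inl (Sum.inl x)) (Sum.inl (Sum.inl s)) :=
    hr.lift (fun a => Sum.inl (Sum.inl a)) fun a b hab =>
      ⟨sensorDigraph_adj_state.2 hab.1, fun v hv hbv => hab.2 (Sum.inl_injective (Sum.inl_injective hbv) ▸ hv)⟩
  have h2 : ReflTransGen r (Sum.inl (Sum.inr ())) (Sum.inr (Sum.inl s)) :=
    (h1.tail ⟨sensorDigraph_adj_sensor.2 ⟨rfl, hs⟩, by simp⟩).head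
      ⟨sensorDigraph_adj_input_state.2 rfl, fun v hv hxv => hx (Sum.inl_injective (Sum.inl_injective hxv) ▸ hv)⟩
  obtain ⟨p, hp, hn, hh, hl⟩ := exists_nodup_chain h2
  refine ⟨p, ⟨hp.imp fun _ _ h => h.1, hn, ⟨_, rfl, hh⟩, ⟨_, ⟨_, ?_, rfl⟩, hl⟩⟩, fun v hv hvp => ?_⟩
  · exact Finset.mem_image_of_mem _ hs
  · rcases (reach_of_mem_chain hp hh hvp).cases_tail with h | ⟨g, -, h⟩
    · simp at h
    · exact h.2 v hv rfl

/-- Following the matching `f` from `j`, and from `u` through `x`, traces two disjoint paths: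
predecessors along `f` are unique, and neither start has one. Fixed points of `f` are vertices on
neither path. -/
theorem exists_disjoint_paths [Fintype X] {j : X} (hj : x ≠ j)
    (h : ∀ v, Escapes (auxEdge A x) T v x ∨ Escapes (auxEdge A x) T v j) :
    ∃ L, IsLinking (sensorDigraph A x T) {Sum.inl (Sum.inr ()), Sum.inl (Sum.inl j)}
      (sensorVertices T) L ∧ L.card = 2 := by
  obtain ⟨f, hf, hf1, hf2⟩ := exists_matching_of_two_sources (auxEdge A x) T hj h
  let r : (X ⊕ Unit) ⊕ (X ⊕ Unit) → (X ⊕ Unit) ⊕ (X ⊕ Unit) → Prop := fun g g' =>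
    match g, g' with
    | Sum.inl (Sum.inr _), Sum.inl (Sum.inl b) => b = x
    | Sum.inl (Sum.inl a), Sum.inl (Sum.inl b) => f a = Sum.inl b ∧ a ≠ b
    | Sum.inl (Sum.inl a), Sum.inr (Sum.inl b) => f a = Sum.inr b
    | _, _ => False
  have hrG : ∀ g g', r g g' → (sensorDigraph A x T).Adj g g' := by
    rintro ((a | k) | y) ((b | k') | (b | k')) h <;> simp only [r] at h
    · exact sensorDigraph_adj_state.2 ((hf1 a b h.1).2.2.resolve_right h.2)
    · obtain ⟨rfl, hb⟩ := hf2 a b h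
      exact sensorDigraph_adj_sensor.2 ⟨rfl, hb⟩
    · exact sensorDigraph_adj_input_state.2 h
  have hru : ∀ g g' h, r g h → r g' h → g = g' := by
    rintro ((a | k) | y) ((a' | k') | y') ((b | l) | (b | l)) h h' <;> simp only [r] at h h' <;>
      try rfl
    · rw [hf (h.1.trans h'.1.symm)]
    · rw [hf (h.trans h'.symm)]
    · exact absurd h' (hf1 _ _ h.1).1
    · exact absurd h (hf1 _ _ h'.1).1
  have hsu : ∀ g, ¬ r g (Sum.inl (Sum.inr ())) := by
    rintro ((a | k) | y) h <;> simp [r] at h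
  have hsj : ∀ g, ¬ r g (Sum.inl (Sum.inl j)) := by
    rintro ((a | k) | y) h <;> simp only [r] at h
    · exact (hf1 _ _ h.1).2.1 rfl
    · exact hj h.symm
  -- If the orbit of `a` met no sensor, `f` would map this finite set injectively into itself
  -- without `a`.
  have hterm : ∀ a : X, (∀ d, f d ≠ Sum.inl a) →
      ∃ s ∈ T, ReflTransGen r (Sum.inl (Sum.inl a)) (Sum.inr (Sum.inl s)) := by
    classical
    intro a ha
    by_contra! hno
    let O : Finset X := Finset.univ.filter fun c =>
      ReflTransGen r (Sum.inl (Sum.inl a)) (Sum.inl (Sum.inl c))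
    have haO : a ∈ O := by simp [O, ReflTransGen.refl]
    have hmaps : Set.MapsTo f O ((O.erase a).image Sum.inl : Finset (X ⊕ X)) := by
      intro c hc
      have hc' : ReflTransGen r (Sum.inl (Sum.inl a)) (Sum.inl (Sum.inl c)) := by simpa [O] using hc
      cases hfc : f c with
      | inr s =>
        obtain ⟨rfl, hs⟩ := hf2 c s hfc
        exact absurd (hc'.tail hfc) (hno s hs)
      | inl d =>
        refine Finset.mem_coe.2 (Finset.mem_image_of_mem _ (Finset.mem_erase.2 ⟨?_, ?_⟩))
        · rintro rfl
          exact ha c hfc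
        · by_cases hcd : c = d
          · exact hcd ▸ hc
          · simpa [O] using hc'.tail (show r _ (Sum.inl (Sum.inl d)) from ⟨hfc, hcd⟩)
    have h1 := Finset.card_le_card_of_injOn f hmaps hf.injOn
    rw [Finset.card_image_of_injective _ Sum.inl_injective] at h1
    exact absurd h1 (not_le.2 (Finset.card_erase_lt_of_mem haO))
  obtain ⟨s₁, hs₁, hr₁⟩ := hterm x fun d hd => (hf1 d x hd).1 rfl
  obtain ⟨s₂, hs₂, hr₂⟩ := hterm j fun d hd => (hf1 d j hd).2.1 rfl
  have hr₁' : ReflTransGen r (Sum.inl (Sum.inr ())) (Sum.inr (Sum.inl s₁)) := hr₁.head rfl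
  obtain ⟨p, hp, hpn, hph, hpl⟩ := exists_nodup_chain hr₁'
  obtain ⟨q, hq, hqn, hqh, hql⟩ := exists_nodup_chain hr₂
  have hdisj : List.Disjoint p q := fun g hgp hgq => by
    have := eq_of_reach_of_leftUnique hru hsu hsj (reach_of_mem_chain hp hph hgp)
      (reach_of_mem_chain hq hqh hgq)
    simp at this
  have hpq : p ≠ q := by
    rintro rfl
    exact hdisj (List.mem_of_mem_head? hph) (List.mem_of_mem_head? hph)
  refine ⟨{p, q}, ⟨?_, ?_⟩, Finset.card_pair hpq⟩
  · intro l hl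
    rw [Finset.mem_insert, Finset.mem_singleton] at hl
    rcases hl with rfl | rfl
    · exact ⟨hp.imp hrG, hpn, ⟨_, .inl rfl, hph⟩, _, ⟨_, Finset.mem_image_of_mem _ hs₁, rfl⟩, hpl⟩
    · exact ⟨hq.imp hrG, hqn, ⟨_, .inr rfl, hqh⟩, _, ⟨_, Finset.mem_image_of_mem _ hs₂, rfl⟩, hql⟩
  · intro l hl l' hl' hne
    rw [Finset.mem_insert, Finset.mem_singleton] at hl hl'
    rcases hl with rfl | rfl <;> rcases hl' with rfl | rfl
    · exact absurd rfl hne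
    · exact hdisj
    · exact hdisj.symm
    · exact absurd rfl hne

theorem rho_input_eq_one [Fintype X] (hT : ∃ s ∈ T, ReflTransGen (auxEdge A x) x s) :
    rho (sensorDigraph A x T) {Sum.inl (Sum.inr ())} (sensorVertices T) = 1 := by
  obtain ⟨s, hs, hr⟩ := hT
  obtain ⟨p, hp, -⟩ := exists_path_of_avoidReach (Q := ∅) hs ⟨by simp, by simpa using hr⟩
  refine le_antisymm (rho_le fun L hL => ?_) hp.isLinking.le_rho
  exact hL.card_le (F := {Sum.inl (Sum.inr ())}) (by simp)

/-- Since `ρ({u}, Y) = 1`, a state is inessential exactly if some walk from `x` to `T` avoids it. By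
Menger's theorem `ρ({u, x_j}, Y) = 1` then means that a single vertex `v` separates both `x` and `j`
from `T`. -/
theorem hasViolation_iff [Fintype X] (hT : ∃ s ∈ T, ReflTransGen (auxEdge A x) x s) :
    HasViolation A x (T.image Sum.inl) ↔
    ∃ j v, Escapes (auxEdge A x) T j x ∧ ¬ Escapes (auxEdge A x) T v x ∧
      ¬ Escapes (auxEdge A x) T v j := by
  have hrho := rho_input_eq_one hT
  change (∃ j : X, Sum.inl (Sum.inl j) ∉ essentialVertices (sensorDigraph A x T)
      {Sum.inl (Sum.inr ())} (sensorVertices T) ∧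
      rho (sensorDigraph A x T) {Sum.inl (Sum.inr ()), Sum.inl (Sum.inl j)} (sensorVertices T) =
      rho (sensorDigraph A x T) {Sum.inl (Sum.inr ())} (sensorVertices T)) ↔ _
  rw [hrho]
  constructor
  · rintro ⟨j, hj, hj1⟩
    simp only [essentialVertices, Set.mem_ofPred_eq, not_forall, not_exists, not_and, hrho] at hj
    obtain ⟨L, hL, hL1, hLj⟩ := hj
    obtain ⟨p, rfl⟩ := Finset.card_eq_one.1 hL1
    have hjx : Escapes (auxEdge A x) T j x :=
      escapes_of_path (hL.1 p (by simp)) (hLj p (by simp))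
    by_contra! hno
    obtain ⟨L, hL, hL2⟩ := exists_disjoint_paths hjx.ne fun v => by
      by_cases hv : Escapes (auxEdge A x) T v x
      · exact .inl hv
      · exact .inr (hno j v hjx hv)
    have := hL.le_rho
    omega
  · rintro ⟨j, v, hj, hv, hvj⟩
    refine ⟨j, fun hess => ?_, le_antisymm (rho_le fun L hL => ?_) ?_⟩
    · obtain ⟨s, hs, hr⟩ := hj
      obtain ⟨p, hp, hpj⟩ := exists_path_of_avoidReach hs hr
      obtain ⟨q, hq, hqj⟩ := hess {p} hp.isLinking (by rw [hrho]; simp)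
      rw [Finset.mem_singleton] at hq
      subst hq
      exact hpj j rfl hqj
    · have hvL : ∀ p ∈ L, Sum.inl (Sum.inl v) ∈ p := by
        intro p hp
        by_contra hvp
        obtain ⟨hc, hn, ⟨g, hg, hh⟩, hl⟩ := hL.1 p hp
        rcases hg with rfl | rfl
        · exact hv (escapes_of_path ⟨hc, hn, ⟨_, rfl, hh⟩, hl⟩ hvp)
        · exact hvj (escapes_of_chain hc hh hl hvp)
      rw [Finset.card_le_one]
      intro p hp q hq
      by_contra hne
      exact hL.2 p hp q hq hne (hvL p hp) (hvL q hq)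
    · obtain ⟨s, hs, hr⟩ := hj
      obtain ⟨p, ⟨hc, hn, ⟨g, hg, hh⟩, hl⟩, -⟩ := exists_path_of_avoidReach hs hr
      have hp' : IsPath (sensorDigraph A x T) {Sum.inl (Sum.inr ()), Sum.inl (Sum.inl j)}
        (sensorVertices T) p := ⟨hc, hn, ⟨g, .inl hg, hh⟩, hl⟩
      exact hp'.isLinking.le_rho

end Violation

/-! ## Structural observability and minimum placements of the auxiliary system -/

section Placement

variable {X : Type} [Fintype X] [DecidableEq X] {A : StructMatrix X X} {x : X}

/-- If no sensor lies downstream of `j`, the vectors supported downstream of `j` form a nonzero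
invariant subspace without output. -/
theorem hits_of_isStructObservable {S : Finset (X ⊕ Unit)}
    (h : IsStructObservable (auxSystem A x) (sensorMatrix S)) (j : X) :
    ∃ s, Sum.inl s ∈ S ∧ ReflTransGen (auxEdge A x) j s := by
  by_contra! hno
  obtain ⟨a, c, hac⟩ := h
  let V : Submodule ℝ (X ⊕ Unit → ℝ) :=
    { carrier := {z | ∀ g, z g ≠ 0 → ∃ k, g = Sum.inl k ∧ ReflTransGen (auxEdge A x) j k}
      zero_mem' := by simp
      add_mem' := by
        intro y z hy hz g hg
        by_cases h0 : y g = 0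
        · exact hz g (by simpa [h0] using hg)
        · exact hy g h0
      smul_mem' := by
        intro r z hz g hg
        exact hz g (right_ne_zero_of_mul (by simpa using hg)) }
  refine not_isSIO_of_invariant _ _ _ 0 V ?_ ?_ ?_ hac
  · intro z hz
    rw [Matrix.zero_mulVec, add_zero]
    intro g hg
    obtain ⟨g', -, hg'⟩ := Finset.exists_ne_zero_of_sum_ne_zero hg
    obtain ⟨k, rfl, hk⟩ := hz g' (right_ne_zero_of_mul hg')
    have h1 := left_ne_zero_of_mul hg'
    simp only [StructMatrix.realize] at h1
    split_ifs at h1 with h2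
    · cases g with
      | inl i => exact ⟨i, rfl, hk.tail (by simpa [auxSystem, auxEdge] using h2)⟩
      | inr k => simp [auxSystem] at h2
    · exact absurd rfl h1
  · intro z hz
    ext y
    refine Finset.sum_eq_zero fun g _ => ?_
    by_contra h0
    obtain ⟨k, rfl, hk⟩ := hz g (right_ne_zero_of_mul h0)
    have h1 := left_ne_zero_of_mul h0
    simp only [StructMatrix.realize] at h1
    split_ifs at h1 with h2
    · simp only [sensorMatrix, decide_eq_true_eq] at h2
      exact hno k h2.2 hk
    · exact absurd rfl h1
  · rw [Submodule.ne_bot_iff]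
    refine ⟨Pi.single (Sum.inl j) 1, fun g hg => ?_, by simp⟩
    by_cases h0 : g = Sum.inl j
    · exact ⟨j, h0, .refl⟩
    · simp [h0] at hg

/-- Menger's theorem with the single source `j` gives a matching that omits row `j`, as
`generic_pencil_injective` requires. It is applied to the states other than `u`, with a fictitious
self-loop at `x` that is removed by a shift of the spectrum. -/
theorem isStructObservable_of_hits (hA : ∀ j, A j j = true) {S : Finset (X ⊕ Unit)}
    (h : ∀ j, ∃ s, Sum.inl s ∈ S ∧ ReflTransGen (auxEdge A x) j s) :
    IsStructObservable (auxSystem A x) (sensorMatrix S) := by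
  classical
  let ok : X ⊕ X → X → Prop := fun r c =>
    Sum.elim (fun i => auxEdge A x c i ∨ c = i) (fun y => y = c ∧ Sum.inl c ∈ S) r
  let M : X ⊕ X → X → Option ((X ⊕ X) × X) := fun r c => if ok r c then some (r, c) else none
  have hM : ∀ r c e, M r c = some e → (r, c) = e := by
    intro r c e he
    simp only [M] at he
    split_ifs at he
    exact Option.some_injective _ he
  let loop : X ⊕ X → X → Prop := fun r c => r = Sum.inl c
  let 𝓜 : Set (X → X ⊕ X) := {f | Function.Injective f ∧ ∀ c, ok (f c) c}
  have havoid : ∀ j, ∃ f ∈ 𝓜, ∀ c, f c ≠ Sum.inl j := by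
    intro j
    obtain ⟨f, hf, hf1, hf2⟩ := exists_matching_of_not_separated (auxEdge A x)
      (Finset.univ.filter fun s => Sum.inl s ∈ S) {j} fun Q hQ => by
        obtain rfl : Q = ∅ := by simpa using hQ
        obtain ⟨s, hs, hr⟩ := h j
        exact ⟨j, by simp, s, by simpa using hs, by simp, by simpa using hr⟩
    refine ⟨f, ⟨hf, fun c => ?_⟩, fun c hc => (hf1 c j hc).1 (by simp)⟩
    cases hfc : f c with
    | inl d => exact (hf1 c d hfc).2
    | inr s => simpa [ok] using hf2 c s hfc
  obtain ⟨P, hP, hPθ⟩ := generic_pencil_injective M loop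
    (fun i c i' c' e h1 h2 => Prod.mk.inj ((hM _ _ _ h1).trans (hM _ _ _ h2).symm))
    (fun i c hl => by
      have hl : i = Sum.inl c := hl
      simp [M, ok, hl]) 𝓜
    ((havoid x).imp fun f hf => hf.1)
    (fun f hf => ⟨hf.1, fun c => by simp [M, hf.2 c]⟩)
    (fun i c hl => by
      obtain ⟨f, hf, hfc⟩ := havoid c
      exact ⟨f, hf, fun c' h => hfc c' (h.trans hl)⟩)
  obtain ⟨θ, hθ⟩ : ∃ θ, MvPolynomial.eval θ P ≠ 0 := by
    by_contra! h0
    exact hP (MvPolynomial.funext fun θ => by simpa using h0 θ)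
  -- Subtracting `τ` from all diagonal entries cancels the fictitious self-loop at `x`; the generic
  -- pencil is then used at `s + τ`.
  let τ : ℝ := θ (Sum.inl x, x)
  let a : (auxSystem A x).Free → ℝ := fun p => match p.1 with
    | (Sum.inl i, Sum.inl j) => θ (Sum.inl i, j) - if i = j then τ else 0
    | _ => 1
  let c : (sensorMatrix S).Free → ℝ := fun p => match p.1 with
    | (Sum.inl y, Sum.inl j) => θ (Sum.inr y, j)
    | _ => 1
  refine ⟨a, c, isSIO_of_pencil _ _ _ fun s z v hz hc => ⟨?_, Subsingleton.elim _ _⟩⟩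
  have hv : ((0 : Matrix (X ⊕ Unit) Empty ℝ).map Complex.ofReal).mulVec v = 0 := by
    ext i; simp [Matrix.mulVec, dotProduct]
  rw [hv, add_zero] at hz
  have hAE : ∀ i j, ((StructMatrix.realize (auxSystem A x) a).map Complex.ofReal)
      (Sum.inl i) (Sum.inl j) = (M (Sum.inl i) j).elim 0 (fun e => (θ e : ℂ)) -
        if (Sum.inl i : X ⊕ X) = Sum.inl j then (τ : ℂ) else 0 := by
    intro i j
    by_cases hij : i = j
    · subst hij
      by_cases hix : i = x
      · subst hix
        simp [StructMatrix.realize, auxSystem, M, ok, τ]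
      · simp [StructMatrix.realize, auxSystem, M, ok, a, hix, hA]
    · have hji : j ≠ i := fun h => hij h.symm
      by_cases hA' : A i j = true ∧ i ≠ x
      · simp [StructMatrix.realize, auxSystem, M, ok, a, hij, hji, hA', auxEdge]
      · rw [not_and_not_right] at hA'
        by_cases hix : i = x
        · subst hix
          simp [StructMatrix.realize, auxSystem, M, ok, hij, hji, auxEdge]
        · simp [StructMatrix.realize, auxSystem, M, ok, hij, hji, hix, auxEdge, mt hA' hix]
  have hAu : ∀ i, ((StructMatrix.realize (auxSystem A x) a).map Complex.ofReal)
      (Sum.inl i) (Sum.inr ()) = if i = x then 1 else 0 := by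
    intro i
    by_cases hix : i = x <;> simp [StructMatrix.realize, auxSystem, a, hix]
  have hu0 : ∀ g, ((StructMatrix.realize (auxSystem A x) a).map Complex.ofReal)
      (Sum.inr ()) g = 0 := by
    intro g
    simp [StructMatrix.realize, auxSystem]
  have hx0 : ∀ j, ((StructMatrix.realize (auxSystem A x) a).map Complex.ofReal)
      (Sum.inl x) (Sum.inl j) = 0 := by
    intro j
    simp [StructMatrix.realize, auxSystem]
  have hrow : ∀ i, ∑ j, ((StructMatrix.realize (auxSystem A x) a).map Complex.ofReal)
      (Sum.inl i) (Sum.inl j) * z (Sum.inl j) + (if i = x then 1 else 0) * z (Sum.inr ()) =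
      s * z (Sum.inl i) := by
    intro i
    have := congrFun hz (Sum.inl i)
    simp only [Matrix.mulVec, dotProduct, Fintype.sum_sum_type, Fintype.sum_unique, Pi.smul_apply,
      smul_eq_mul] at this
    rw [← hAu]
    exact this
  -- Row `u` reads `s z_u = 0` and row `x` reads `z_u = s z_x`, so `z_u = 0` also when `s = 0`.
  have hu : z (Sum.inr ()) = 0 := by
    have h1 := congrFun hz (Sum.inr ())
    have h2 := hrow x
    simp only [Matrix.mulVec, dotProduct, hu0, zero_mul, Finset.sum_const_zero,
      Pi.smul_apply, smul_eq_mul] at h1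
    simp only [hx0, zero_mul, Finset.sum_const_zero, zero_add, if_true, one_mul] at h2
    rcases mul_eq_zero.1 h1.symm with h | h
    · rw [h2, h, zero_mul]
    · exact h
  have hz0 : (fun j => z (Sum.inl j)) = 0 := by
    refine hPθ θ hθ (s + τ) _ fun f _ c' => ?_
    cases hfc : f c' with
    | inl i =>
      have h1 := hrow i
      rw [hu, mul_zero, add_zero] at h1
      simp only [hAE, sub_mul, Finset.sum_sub_distrib] at h1
      simp only [sub_mul, Finset.sum_sub_distrib, loop]
      simp only [Sum.inl.injEq, ite_mul, zero_mul, Finset.sum_ite_eq, Finset.mem_univ,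
        if_true] at h1 ⊢
      linear_combination h1
    | inr y =>
      have h1 := congrFun hc (Sum.inl y)
      simp only [Matrix.mulVec, dotProduct, Fintype.sum_sum_type] at h1
      have h2 : ∀ k, (StructMatrix.realize (sensorMatrix S) c).map Complex.ofReal
          (Sum.inl y) (Sum.inr k) = 0 := by
        intro k; simp [StructMatrix.realize, sensorMatrix]
      simp only [h2, zero_mul, Finset.sum_const_zero, add_zero] at h1
      refine Eq.trans ?_ h1
      refine Finset.sum_congr rfl fun j _ => ?_
      congr 1
      by_cases hy : y = j ∧ Sum.inl j ∈ S
      · simp [StructMatrix.realize, sensorMatrix, M, ok, loop, hy, c]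
      · have h3 : ¬ ((Sum.inl y : X ⊕ Unit) = Sum.inl j ∧ (Sum.inl j : X ⊕ Unit) ∈ S) := by
          simpa using hy
        simp [StructMatrix.realize, sensorMatrix, M, ok, loop, hy]
  ext g
  rcases g with j | k
  · exact congrFun hz0 j
  · exact hu

/-- The minimum sensor placements are the sets that every state reaches and whose elements do not
reach each other. -/
theorem isMinPlacement_iff (hA : ∀ j, A j j = true) {S : Finset (X ⊕ Unit)} :
    IsMinPlacement (auxSystem A x) S ↔ ∃ T : Finset X, S = T.image Sum.inl ∧ Hits A x T ∧
      ∀ s ∈ T, ∀ t ∈ T, ReflTransGen (auxEdge A x) s t → s = t := by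
  classical
  have hobs : ∀ T : Finset X, Hits A x T →
      IsStructObservable (auxSystem A x) (sensorMatrix (T.image Sum.inl)) := fun T hT =>
    isStructObservable_of_hits hA fun j => by
      obtain ⟨s, hs, hr⟩ := hT j
      exact ⟨s, Finset.mem_image_of_mem _ hs, hr⟩
  constructor
  · rintro ⟨h1, h2⟩
    let T : Finset X := Finset.univ.filter fun s => Sum.inl s ∈ S
    have hT : Hits A x T := fun j => by
      obtain ⟨s, hs, hr⟩ := hits_of_isStructObservable h1 j
      exact ⟨s, by simpa [T] using hs, hr⟩
    have hTS : T.image Sum.inl ⊆ S := by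
      intro g hg
      obtain ⟨s, hs, rfl⟩ := Finset.mem_image.1 hg
      simpa [T] using hs
    refine ⟨T, (Finset.eq_of_subset_of_card_le hTS (h2 _ (hobs T hT))).symm, hT, ?_⟩
    intro s hs t ht hst
    by_contra hne
    have hT' : Hits A x (T.erase s) := fun j => by
      obtain ⟨r, hr, hjr⟩ := hT j
      by_cases hrs : r = s
      · subst hrs
        exact ⟨t, Finset.mem_erase.2 ⟨Ne.symm hne, ht⟩, hjr.trans hst⟩
      · exact ⟨r, Finset.mem_erase.2 ⟨hrs, hr⟩, hjr⟩
    have h3 := h2 _ (hobs _ hT')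
    have h4 := Finset.card_le_card hTS
    rw [Finset.card_image_of_injective _ Sum.inl_injective] at h3 h4
    have := Finset.card_erase_lt_of_mem hs
    omega
  · rintro ⟨T, rfl, hT, hanti⟩
    refine ⟨hobs T hT, fun S' hS' => ?_⟩
    -- Each `s ∈ T` has a sensor `g s` of `S'` downstream. Elements of `T` sharing it would reach a
    -- common element of `T`, hence coincide.
    choose g hgS hg using hits_of_isStructObservable hS'
    rw [Finset.card_image_of_injective _ Sum.inl_injective]
    refine Finset.card_le_card_of_injOn (fun s => Sum.inl (g s)) (fun s _ => hgS s) ?_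
    intro s hs t ht hst
    obtain ⟨r, hr, hgr⟩ := hT (g s)
    have h1 := hanti s hs r hr ((hg s).trans hgr)
    have h2 : g s = g t := Sum.inl_injective hst
    rw [h2] at hgr
    exact h1.trans (hanti t ht r hr ((hg t).trans hgr)).symm

end Placement
end

noncomputable section

/-! ## Generic state and input observability of sensor placements -/

open Relation

theorem sum_subtype_of_eq_zero {X : Type} [Fintype X] {p : X → Prop} [DecidablePred p] {g : X → ℂ}
    (h : ∀ j, ¬ p j → g j = 0) : ∑ c : Subtype p, g c = ∑ j, g j := by
  rw [← Finset.sum_subtype (Finset.univ.filter p) (by simp) g]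
  refine Finset.sum_subset (Finset.subset_univ _) fun j _ hj => h j (by simpa using hj)

section

variable {X : Type} [Fintype X] [DecidableEq X] {A : StructMatrix X X} {x : X} {T : Finset X}

/-- By `hout` the region `p` is unmeasured from outside and entered only at `w`, so its rows `i ≠ w`
and the sensor rows involve states of `p` alone. Row `x` carries the unknown input; by `hpx` it is
absent or equal to the unused row `w`. By `hsep` no vertex separates both `w` and `j` from the
sensors, so Menger's theorem gives matchings that omit the rows `w` and `j`. -/
theorem generic_state_injective (hA : ∀ j, A j j = true) (p : X → Prop) {w : X} (hpw : p w)
    (hout : ∀ e, ¬ p e → e ∉ T ∧ ∀ d, p d → d ≠ w → ¬ auxEdge A x e d) (hpx : p x → x = w)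
    (hex : ∃ j, p j ∧ j ≠ w)
    (hsep : ∀ j, p j → j ≠ w → ∀ v, p v →
      (∃ s ∈ T, w ≠ v ∧ ReflTransGen (fun c d => (auxEdge A x c d ∧ d ≠ v) ∧ p d) w s) ∨
      (∃ s ∈ T, j ≠ v ∧ ReflTransGen (fun c d => (auxEdge A x c d ∧ d ≠ v) ∧ p d) j s)) :
    ∃ P : MvPolynomial (A.Free ⊕ (dedicatedInput x).Free ⊕ (sensorMatrix T).Free) ℝ, P ≠ 0 ∧
      ∀ θ, MvPolynomial.eval θ P ≠ 0 → ∀ (s : ℂ) (z : X → ℂ),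
        (∀ i, i ≠ x → ∑ j, (A.realize (fun q => θ (Sum.inl q)) i j : ℂ) * z j = s * z i) →
        (∀ y, ∑ j, ((sensorMatrix T).realize (fun q => θ (Sum.inr (Sum.inr q))) y j : ℂ) * z j = 0) →
        ∀ c, p c → z c = 0 := by
  classical
  let M : X ⊕ X → Subtype p → Option (A.Free ⊕ (dedicatedInput x).Free ⊕ (sensorMatrix T).Free) :=
    fun r c => match r with
    | Sum.inl i => if h : A i c = true ∧ i ≠ x then some (Sum.inl ⟨(i, c), h.1⟩) else none
    | Sum.inr y => if h : sensorMatrix T y c = true then some (Sum.inr (Sum.inr ⟨(y, c), h⟩)) else none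
  have hMl : ∀ i c, M (Sum.inl i) c ≠ none ↔ A i c = true ∧ i ≠ x := fun i c => by simp [M]
  have hMr : ∀ y c, M (Sum.inr y) c ≠ none ↔ y = c ∧ (c : X) ∈ T := fun y c => by
    by_cases h : sensorMatrix T y c = true
    · simpa [M, h] using (of_decide_eq_true h)
    · have h' := of_decide_eq_false (Bool.eq_false_iff.2 h)
      simpa [M, h] using h'
  have hMinj : ∀ r c r' c' e, M r c = some e → M r' c' = some e → r = r' ∧ c = c' := by
    rintro (i | y) c (i' | y') c' e h h' <;> simp only [M] at h h' <;> split_ifs at h h' <;>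
      simp only [Option.some.injEq] at h h' <;> subst h <;>
      simp only [Sum.inl.injEq, Sum.inr.injEq, Subtype.mk.injEq, Prod.mk.injEq, reduceCtorEq] at h'
    · exact ⟨congrArg _ h'.1.symm, Subtype.ext h'.2.symm⟩
    · exact ⟨congrArg _ h'.1.symm, Subtype.ext h'.2.symm⟩
  let loop : X ⊕ X → Subtype p → Prop := fun r c => r = Sum.inl c.1 ∧ c.1 ≠ x
  let 𝓜 : Set (Subtype p → X ⊕ X) := {f | Function.Injective f ∧ (∀ c, M (f c) c ≠ none) ∧
    ∀ c i, f c = Sum.inl i → p i ∧ i ≠ w}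
  have havoid : ∀ j, p j → j ≠ w → ∃ f ∈ 𝓜, ∀ c, f c ≠ Sum.inl j := by
    intro j hj hjw
    obtain ⟨f, hf, hf1, hf2⟩ := exists_matching_of_two_sources
      (fun c d : Subtype p => auxEdge A x c d) (Finset.univ.filter fun s : Subtype p => s.1 ∈ T)
      (a := ⟨w, hpw⟩) (b := ⟨j, hj⟩) (fun h => hjw (congrArg Subtype.val h).symm) fun v => by
        have conv : ∀ k (hk : p k), (∃ s ∈ T, k ≠ v ∧
            ReflTransGen (fun c d => (auxEdge A x c d ∧ d ≠ v) ∧ p d) k s) →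
            Escapes (fun c d : Subtype p => auxEdge A x c d)
              (Finset.univ.filter fun s : Subtype p => s.1 ∈ T) v ⟨k, hk⟩ := by
          rintro k hk ⟨s, hs, hkv, hr⟩
          obtain ⟨hps, hr'⟩ := reflTransGen_subtype hk hr
          refine ⟨⟨s, hps⟩, by simpa using hs, ?_, reach_mono hr' fun c d h => ⟨h.1, ?_⟩⟩
          · simpa [Subtype.ext_iff] using hkv
          · simpa [Subtype.ext_iff] using h.2
        exact (hsep j hj hjw v v.2).imp (conv w hpw) (conv j hj)
    refine ⟨fun c => Sum.map Subtype.val Subtype.val (f c), ⟨?_, fun c => ?_, fun c i hi => ?_⟩,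
      fun c hc => ?_⟩
    · exact (Sum.map_injective.2 ⟨Subtype.val_injective, Subtype.val_injective⟩).comp hf
    · cases hfc : f c with
      | inl d =>
        obtain ⟨hdw, -, hcd⟩ := hf1 c d hfc
        simp only [hfc]
        rw [Sum.map_inl, hMl]
        rcases hcd with hcd | rfl
        · exact hcd
        · refine ⟨hA _, fun hcx => hdw (Subtype.ext ?_)⟩
          exact hcx.trans (hpx (hcx ▸ c.2))
      | inr s =>
        obtain ⟨rfl, hs⟩ := hf2 c s hfc
        simp only [hfc]
        rw [Sum.map_inr, hMr]
        exact ⟨rfl, by simpa using hs⟩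
    · cases hfc : f c with
      | inl d =>
        simp only [hfc, Sum.map_inl, Sum.inl.injEq] at hi
        subst hi
        exact ⟨d.2, fun h => (hf1 c d hfc).1 (Subtype.ext h)⟩
      | inr s => simp [hfc] at hi
    · cases hfc : f c with
      | inl d =>
        simp only [hfc, Sum.map_inl, Sum.inl.injEq] at hc
        exact (hf1 c d hfc).2.1 (Subtype.ext hc)
      | inr s => simp [hfc] at hc
  obtain ⟨j₀, hj₀, hj₀w⟩ := hex
  obtain ⟨f₀, hf₀, -⟩ := havoid j₀ hj₀ hj₀w
  obtain ⟨P, hP, hPθ⟩ := generic_pencil_injective M loop hMinj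
    (fun r c hl => by rw [hl.1, hMl]; exact ⟨hA _, hl.2⟩) 𝓜 ⟨f₀, hf₀⟩ (fun f hf => ⟨hf.1, hf.2.1⟩)
    (fun r c hl => by
      -- Row `w` is omitted by every member of `𝓜`; any other row is omitted by a suitable one.
      by_cases hcw : c.1 = w
      · exact ⟨f₀, hf₀, fun c' h => (hf₀.2.2 c' c.1 (h.trans hl.1)).2 hcw⟩
      · obtain ⟨f, hf, hfc⟩ := havoid c.1 c.2 hcw
        exact ⟨f, hf, fun c' h => hfc c' (h.trans hl.1)⟩)
  refine ⟨P, hP, fun θ hθ s z hz hy c hc => ?_⟩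
  refine congrFun (hPθ θ hθ s (fun c => z c) fun f hf c => ?_) ⟨c, hc⟩
  cases hfc : f c with
  | inl i =>
    obtain ⟨hpi, hiw⟩ := hf.2.2 c i hfc
    have hix : i ≠ x := fun h => hiw (h.trans (hpx (h ▸ hpi)))
    have h1 : ∀ c : Subtype p, (M (Sum.inl i) c).elim 0 (fun e => (θ e : ℂ)) =
        A.realize (fun q => θ (Sum.inl q)) i c := by
      intro c
      by_cases h : A i c = true <;> simp [M, StructMatrix.realize, h, hix]
    have h2 : ∀ c : Subtype p, loop (Sum.inl i) c ↔ ⟨i, hpi⟩ = c := by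
      intro c
      simp only [loop, Sum.inl.injEq, Subtype.ext_iff]
      exact ⟨fun h => h.1, fun h => ⟨h, h ▸ hix⟩⟩
    simp only [h1, h2, sub_mul, Finset.sum_sub_distrib, ite_mul, zero_mul, Finset.sum_ite_eq,
      Finset.mem_univ, if_true]
    rw [sum_subtype_of_eq_zero (g := fun j => (A.realize (fun q => θ (Sum.inl q)) i j : ℂ) * z j),
      hz i hix, sub_self]
    intro j hj
    have : A i j ≠ true := fun h => (hout j hj).2 i hpi hiw ⟨h, hix⟩
    simp [StructMatrix.realize, this]
  | inr y =>
    have h1 : ∀ c : Subtype p, (M (Sum.inr y) c).elim 0 (fun e => (θ e : ℂ)) =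
        (sensorMatrix T).realize (fun q => θ (Sum.inr (Sum.inr q))) y c := by
      intro c
      by_cases h : sensorMatrix T y c = true <;> simp [M, StructMatrix.realize, h]
    simp only [h1, loop, reduceCtorEq, false_and, if_false, sub_zero]
    rw [sum_subtype_of_eq_zero (g := fun j =>
      ((sensorMatrix T).realize (fun q => θ (Sum.inr (Sum.inr q))) y j : ℂ) * z j), hy]
    intro j hj
    have : ¬ (y = j ∧ j ∈ T) := fun h => (hout j hj).1 h.2
    simp [StructMatrix.realize, sensorMatrix, this]

/-- Multiplying `P` by all parameters excludes realizations with a zero among them. The input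
coefficient is then nonzero, and row `x` forces the input to vanish once the state does. -/
theorem isGSIO_of_generic_state_injective
    (P : MvPolynomial (A.Free ⊕ (dedicatedInput x).Free ⊕ (sensorMatrix T).Free) ℝ) (hP : P ≠ 0)
    (h : ∀ θ, MvPolynomial.eval θ P ≠ 0 → (∀ e, θ e ≠ 0) → ∀ (s : ℂ) (z : X → ℂ),
      (∀ i, i ≠ x → ∑ j, (A.realize (fun q => θ (Sum.inl q)) i j : ℂ) * z j = s * z i) →
      (∀ y, ∑ j, ((sensorMatrix T).realize (fun q => θ (Sum.inr (Sum.inr q))) y j : ℂ) * z j = 0) →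
      z = 0) :
    IsGSIO A (dedicatedInput x) (sensorMatrix T) := by
  classical
  have hX : ∏ e : A.Free ⊕ (dedicatedInput x).Free ⊕ (sensorMatrix T).Free,
      (MvPolynomial.X e : MvPolynomial _ ℝ) ≠ 0 :=
    Finset.prod_ne_zero_iff.2 fun e _ => MvPolynomial.X_ne_zero e
  refine ⟨P * ∏ e, MvPolynomial.X e, mul_ne_zero hP hX, fun θ hθ => ?_⟩
  rw [map_mul, map_prod] at hθ
  have hθe : ∀ e, θ e ≠ 0 := fun e => by
    have := Finset.prod_ne_zero_iff.1 (right_ne_zero_of_mul hθ) e (Finset.mem_univ e)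
    simpa using this
  refine isSIO_of_pencil _ _ _ fun s z v hz hy => ?_
  have hz0 : z = 0 := by
    refine h θ (left_ne_zero_of_mul hθ) hθe s z (fun i hi => ?_) fun y => ?_
    · have := congrFun hz i
      simpa [Matrix.mulVec, dotProduct, StructMatrix.realize, dedicatedInput, hi] using this
    · have := congrFun hy y
      simpa [Matrix.mulVec, dotProduct] using this
  refine ⟨hz0, ?_⟩
  subst hz0
  have hv := congrFun hz x
  ext k
  simpa [Matrix.mulVec, dotProduct, StructMatrix.realize, dedicatedInput, hθe] using hv

/-- With `w = x` measured, a vertex `v ≠ x` does not separate `x` from its own sensor, and `v = x`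
does not separate `j ≠ x` from `T`, because no auxiliary edge enters `x`. -/
theorem isGSIO_insert (hA : ∀ j, A j j = true) (hT : Hits A x T) (hx : ∃ j, j ≠ x) :
    IsGSIO A (dedicatedInput x) (sensorMatrix (insert x T)) := by
  obtain ⟨P, hP, hPθ⟩ := generic_state_injective (T := insert x T) hA (fun _ => True) (w := x)
    trivial (by simp) (fun _ => rfl) (by simpa using hx) fun j _ hjx v _ => by
      by_cases hv : x = v
      · right
        obtain ⟨s, hs, hr⟩ := hT j
        exact ⟨s, Finset.mem_insert_of_mem hs, hv ▸ hjx,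
          reach_mono hr fun c d h => ⟨⟨h, hv ▸ h.2⟩, trivial⟩⟩
      · exact .inl ⟨x, Finset.mem_insert_self _ _, hv, .refl⟩
  exact isGSIO_of_generic_state_injective P hP fun θ hθ _ s z hz hy =>
    funext fun c => hPθ θ hθ s z hz hy c trivial

/-- The region consists of the inessential states and the last essential vertex `w`. Only earlier
essential states remain, and `chain_elimination` removes them. -/
theorem isGSIO_of_no_violation (hA : ∀ j, A j j = true) (hT : Hits A x T)
    (hex : ∃ j, Escapes (auxEdge A x) T j x)
    (hnv : ∀ j v, Escapes (auxEdge A x) T j x → Escapes (auxEdge A x) T v x ∨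
      Escapes (auxEdge A x) T v j) :
    IsGSIO A (dedicatedInput x) (sensorMatrix T) := by
  have hxx : ¬ Escapes (auxEdge A x) T x x := fun h => h.ne rfl
  obtain ⟨s₀, hs₀, hr₀⟩ := hT x
  obtain ⟨w, hwx, hw'⟩ := exists_last_not (p := fun d => Escapes (auxEdge A x) T d x) hr₀ hxx
  have hw : ∃ s ∈ T, ReflTransGen (fun c d => auxEdge A x c d ∧ Escapes (auxEdge A x) T d x) w s :=
    ⟨s₀, hs₀, hw'⟩
  have hout : ∀ e, ¬ (Escapes (auxEdge A x) T e x ∨ e = w) →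
      ¬ Escapes (auxEdge A x) T e x ∧ e ≠ w := fun e he => not_or.1 he
  obtain ⟨P, hP, hPθ⟩ := generic_state_injective (T := T) hA
    (fun c => Escapes (auxEdge A x) T c x ∨ c = w) (w := w) (.inr rfl)
    (fun e he => by
      obtain ⟨he1, he2⟩ := hout e he
      refine ⟨notMem_of_not_last (hT x) hwx hw he1 he2, fun d hd hdw hed => ?_⟩
      exact not_escapes_of_edge (hT x) hwx hw hnv he1 he2 hed (hd.resolve_right hdw))
    (fun h => h.resolve_left hxx)
    (by
      obtain ⟨j, hj⟩ := hex
      refine ⟨j, .inl hj, ?_⟩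
      rintro rfl
      exact hwx hj)
    (fun j hj hjw v hv => escapes_subtype (hT x) hwx hw hnv (hj.resolve_right hjw) hv)
  refine isGSIO_of_generic_state_injective P hP fun θ hθ hθe s z hz hy => ?_
  have hz0 := hPθ θ hθ s z hz hy
  ext c
  by_contra hc
  refine chain_elimination (hT x) hwx hw hT (fun c => z c ≠ 0)
    (fun e he => hout e fun h => he (hz0 e h)) (fun e f he hef hf => ?_) c hc
  by_contra! hno
  -- In row `f` the right-hand side is zero and only the term of `e` survives, although its
  -- parameter and `z e` are nonzero.
  have h1 := hz f hef.2
  rw [not_not.1 hf, mul_zero, Finset.sum_eq_single e] at h1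
  · have hAfe : A.realize (fun q => θ (Sum.inl q)) f e ≠ 0 := by
      simp [StructMatrix.realize, hef.1, hθe]
    exact mul_ne_zero (by exact_mod_cast hAfe) he h1
  · intro c _ hce
    by_cases hzc : z c = 0
    · rw [hzc, mul_zero]
    · have : A f c ≠ true := fun h => hno c hce hzc ⟨h, hef.2⟩
      simp [StructMatrix.realize, this]
  · simp

end
end

noncomputable section

/-! ## Lower bounds for generically observable output matrices -/

open Relation

/-- Positive parameters rule out cancellation between walks in powers of the realized matrix. -/
theorem exists_pos_eval_ne_zero {σ : Type} [Finite σ] {P : MvPolynomial σ ℝ} (hP : P ≠ 0) :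
    ∃ θ : σ → ℝ, (∀ e, 0 < θ e) ∧ MvPolynomial.eval θ P ≠ 0 := by
  by_contra! h
  refine hP (MvPolynomial.funext_set (fun _ => Set.Ioi (0 : ℝ)) (fun _ => Set.Ioi_infinite 0) ?_)
  intro θ hθ
  rw [h θ fun e => hθ e (Set.mem_univ e), map_zero]

/-- The vectors supported in `D`. -/
def supportedIn {X : Type} (D : Set X) : Submodule ℝ (X → ℝ) where
  carrier := {z | ∀ i, i ∉ D → z i = 0}
  zero_mem' := by simp
  add_mem' := fun hy hz i hi => by simp [hy i hi, hz i hi]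
  smul_mem' := fun r z hz i hi => by simp [hz i hi]

section

variable {X Y : Type} {A : StructMatrix X X} {x : X}

theorem dedicatedInput_mulVec [DecidableEq X] (b : (dedicatedInput x).Free → ℝ) (v : Unit → ℝ) (i : X) :
    ((dedicatedInput x).realize b).mulVec v i =
      if i = x then b ⟨(x, ()), by simp [dedicatedInput]⟩ * v () else 0 := by
  by_cases hi : i = x
  · subst hi
    simp [Matrix.mulVec, dotProduct, StructMatrix.realize, dedicatedInput]
  · simp [Matrix.mulVec, dotProduct, StructMatrix.realize, dedicatedInput, hi]

theorem realize_mulVec_eq_zero_of_supportedIn [Fintype X] {C : StructMatrix Y X} (c : C.Free → ℝ) {D : Set X}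
    {z : X → ℝ} (hz : z ∈ supportedIn D) {y : Y} (h : ∀ d ∈ D, C y d ≠ true) :
    (C.realize c).mulVec z y = 0 := by
  refine Finset.sum_eq_zero fun d _ => ?_
  by_cases hd : d ∈ D
  · simp [StructMatrix.realize, h d hd]
  · rw [hz d hd, mul_zero]

variable [Fintype X] [DecidableEq X]

/-- If nothing downstream of `t` is measured, the vectors supported there form a controlled
invariant subspace: all deleted edges enter `x`, and the feedback cancels row `x`. -/
theorem exists_measured_of_isGSIO {C : StructMatrix Y X} [Finite Y]
    (hC : IsGSIO A (dedicatedInput x) C) (t : X) :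
    ∃ m, ReflTransGen (auxEdge A x) t m ∧ ∃ y, C y m = true := by
  by_contra! hno
  obtain ⟨P, hP, hPθ⟩ := hC
  have : Finite C.Free := Subtype.finite
  obtain ⟨θ, hθ, hθP⟩ := exists_pos_eval_ne_zero hP
  have hsio := hPθ θ hθP
  have hb : θ (Sum.inr (Sum.inl ⟨(x, ()), by simp [dedicatedInput]⟩)) ≠ 0 := (hθ _).ne'
  set b := θ (Sum.inr (Sum.inl ⟨(x, ()), by simp [dedicatedInput]⟩)) with hbdef
  set A' := A.realize fun p => θ (Sum.inl p) with hA'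
  let D : Set X := {k | ReflTransGen (auxEdge A x) t k}
  refine not_isSIO_of_invariant _ _ _
    (LinearMap.pi fun _ => (-b⁻¹) • (LinearMap.proj x ∘ₗ A'.mulVecLin)) (supportedIn D)
    ?_ ?_ ?_ hsio
  · intro z hz i hi
    rw [Pi.add_apply, dedicatedInput_mulVec]
    by_cases hix : i = x
    · subst hix
      simp [← hbdef, hb]
    · rw [if_neg hix, add_zero]
      refine realize_mulVec_eq_zero_of_supportedIn _ hz fun d hd hid => hi ?_
      exact hd.tail ⟨hid, hix⟩
  · intro z hz
    ext y
    exact realize_mulVec_eq_zero_of_supportedIn _ hz fun d hd => hno d hd y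
  · rw [Submodule.ne_bot_iff]
    refine ⟨Pi.single t 1, fun i hi => ?_, by simp⟩
    have : i ≠ t := by rintro rfl; exact hi .refl
    simp [this]

theorem pow_pos_of_chain {A' : Matrix X X ℝ} (h0 : ∀ i j, 0 ≤ A' i j) {r : X → X → Prop}
    (hr : ∀ c d, r c d → 0 < A' d c) {a v : X} {l : List X} (hl : l.IsChain r)
    (hh : l.head? = some a) (hlast : l.getLast? = some v) : 0 < (A' ^ (l.length - 1)) v a := by
  induction l generalizing a with
  | nil => simp at hh
  | cons c l ih =>
    simp only [List.head?_cons, Option.some.injEq] at hh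
    subst hh
    cases l with
    | nil =>
      simp only [List.getLast?_singleton, Option.some.injEq] at hlast
      simp [hlast]
    | cons d l =>
      rw [List.isChain_cons_cons] at hl
      have h1 := ih hl.2 rfl (by simpa using hlast)
      have h2 : (c :: d :: l).length - 1 = ((d :: l).length - 1) + 1 := by simp
      rw [h2, pow_succ, Matrix.mul_apply]
      have hpow : ∀ n i j, 0 ≤ (A' ^ n) i j := by
        intro n
        induction n with
        | zero => intro i j; rw [pow_zero, Matrix.one_apply]; split_ifs <;> norm_num
        | succ n ih =>
          intro i j
          rw [pow_succ, Matrix.mul_apply]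
          exact Finset.sum_nonneg fun k _ => mul_nonneg (ih i k) (h0 k j)
      exact Finset.sum_pos' (fun k _ => mul_nonneg (hpow _ _ _) (h0 _ _))
        ⟨d, Finset.mem_univ d, mul_pos h1 (hr c d hl.1)⟩

/-- A region `D` that contains the driven state, has a single exit `v` and no sensors, destroys
generic observability as soon as `v` can be reached while avoiding some state of `D`: the zero
dynamics with respect to `v` are nontrivial. -/
theorem not_isGSIO_of_exit {C : StructMatrix Y X} [Finite Y] {D : Finset X} {v j : X}
    (hD : ∀ d ∈ D, ∀ e, auxEdge A x d e → e ∈ D ∨ e = v) (hx : x ∈ D) (hv : v ∉ D) (hj : j ∈ D)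
    (hxv : AvoidReach (auxEdge A x) {j} x v) (hC : ∀ d ∈ D, ∀ y, C y d ≠ true) :
    ¬ IsGSIO A (dedicatedInput x) C := by
  rintro ⟨P, hP, hPθ⟩
  have : Finite C.Free := Subtype.finite
  obtain ⟨θ, hθ, hθP⟩ := exists_pos_eval_ne_zero hP
  have hsio := hPθ θ hθP
  have hb : θ (Sum.inr (Sum.inl ⟨(x, ()), by simp [dedicatedInput]⟩)) ≠ 0 := (hθ _).ne'
  set b := θ (Sum.inr (Sum.inl ⟨(x, ()), by simp [dedicatedInput]⟩)) with hbdef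
  set A' := A.realize fun p => θ (Sum.inl p) with hA'
  have hA0 : ∀ i k, 0 ≤ A' i k := by
    intro i k
    simp only [hA', StructMatrix.realize]
    split_ifs
    exacts [(hθ _).le, le_rfl]
  have hA1 : ∀ i k, A i k = true → 0 < A' i k := by
    intro i k h
    simp [hA', StructMatrix.realize, h, hθ]
  have hxv' : x ≠ v := by rintro rfl; exact hv hx
  -- A path from `x` to `v` that stays in `D` up to its end and misses `j` has at most `|D|`
  -- vertices, hence fewer than `|D|` edges.
  have hpath : ∃ n < D.card, (A' ^ n) v x ≠ 0 := by
    let r : X → X → Prop := fun c d => c ∈ D ∧ auxEdge A x c d ∧ d ≠ j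
    have hr : ∀ a, a ∈ D ∨ a = v → ReflTransGen (fun c d => auxEdge A x c d ∧ d ∉ ({j} : Set X)) a v →
        ReflTransGen r a v := by
      intro a ha h
      induction h using ReflTransGen.head_induction_on with
      | refl => exact .refl
      | head h _ ih =>
        rename_i a c _
        rcases ha with ha | rfl
        · exact (ih (hD a ha c h.1)).head ⟨ha, h.1, by simpa using h.2⟩
        · exact .refl
    obtain ⟨l, hl, hn, hh, hlast⟩ := exists_nodup_chain (hr x (.inl hx) hxv.2)
    have hlD : ∀ c ∈ l, c ≠ v → c ∈ D := by
      clear hn hh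
      induction l with
      | nil => simp
      | cons c l ih =>
        cases l with
        | nil =>
          simp only [List.getLast?_singleton, Option.some.injEq] at hlast
          subst hlast
          simp
        | cons d l =>
          rw [List.isChain_cons_cons] at hl
          intro c' hc' hne
          rcases List.mem_cons.1 hc' with rfl | hc'
          · exact hl.1.1
          · exact ih hl.2 (by simpa using hlast) c' hc' hne
    have hlj : j ∉ l := by
      intro hjl
      rcases (reach_of_mem_chain hl hh hjl).cases_tail with h | ⟨g, -, h⟩
      · exact hxv.1 h.symm
      · exact h.2.2 rfl
    refine ⟨l.length - 1, ?_, (pow_pos_of_chain hA0 (fun c d h => hA1 d c h.2.1.1) hl hh hlast).ne'⟩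
    have h1 : l.toFinset ⊆ insert v (D.erase j) := by
      intro c hc
      rw [List.mem_toFinset] at hc
      by_cases hcv : c = v
      · simp [hcv]
      · refine Finset.mem_insert_of_mem (Finset.mem_erase.2 ⟨?_, hlD c hc hcv⟩)
        rintro rfl
        exact hlj hc
    have h2 := Finset.card_le_card h1
    rw [List.toFinset_card_of_nodup hn, Finset.card_insert_of_notMem (by simp [hv]),
      Finset.card_erase_of_mem hj] at h2
    have h3 : 0 < D.card := Finset.card_pos.2 ⟨j, hj⟩
    omega
  -- The input first enters the derivative of order `N + 1` of the output `z v`.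
  obtain ⟨N, hND, hN, hmin⟩ : ∃ N < D.card, (A' ^ N) v x ≠ 0 ∧ ∀ k < N, (A' ^ k) v x = 0 := by
    classical
    have hex : ∃ n, (A' ^ n) v x ≠ 0 := hpath.imp fun n hn => hn.2
    obtain ⟨n, hn, hn'⟩ := hpath
    exact ⟨Nat.find hex, (Nat.find_min' hex hn').trans_lt hn, Nat.find_spec hex,
      fun k hk => not_not.1 (Nat.find_min hex hk)⟩
  have hN1 : 1 ≤ N := by
    rw [Nat.one_le_iff_ne_zero]
    rintro rfl
    simp [Matrix.one_apply_ne hxv'.symm] at hN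
  let φ : ℕ → (X → ℝ) →ₗ[ℝ] ℝ := fun k => LinearMap.proj v ∘ₗ (A' ^ k).mulVecLin
  have hφ : ∀ k z, φ k z = (A' ^ k).mulVec z v := fun k z => rfl
  have hφA : ∀ k z, φ k (A'.mulVec z) = φ (k + 1) z := by
    intro k z
    rw [hφ, hφ, Matrix.mulVec_mulVec, pow_succ]
  have hφx : ∀ k r, φ k (Pi.single x r) = (A' ^ k) v x * r := by
    intro k r
    rw [hφ, Matrix.mulVec_single]
    simp
  -- The zero dynamics of `z v`. Here `φ 0 = 0` is automatic since `v ∉ D`, so only `N < |D|`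
  -- equations are imposed on vectors supported in `D`, and `V ≠ 0`.
  let V : Submodule ℝ (X → ℝ) := supportedIn (D : Set X) ⊓ ⨅ k : Fin N, (φ (k + 1)).ker
  have hVmem : ∀ z, z ∈ V ↔ z ∈ supportedIn (D : Set X) ∧ ∀ k, k < N → φ (k + 1) z = 0 := by
    intro z
    simp [V, Submodule.mem_iInf, Fin.forall_iff]
  -- The feedback that makes `φ N` vanish on the derivative of the state.
  let K : (X → ℝ) →ₗ[ℝ] (Unit → ℝ) :=
    LinearMap.pi fun _ => (-(b * (A' ^ N) v x)⁻¹) • φ (N + 1)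
  have hBK : ∀ z, ((dedicatedInput x).realize fun p => θ (Sum.inr (Sum.inl p))).mulVec (K z) =
      Pi.single x (-((A' ^ N) v x)⁻¹ * φ (N + 1) z) := by
    intro z
    ext i
    rw [dedicatedInput_mulVec, Pi.single_apply]
    split_ifs
    · simp only [K, LinearMap.pi_apply, LinearMap.smul_apply, smul_eq_mul, ← hbdef]
      field_simp
    · rfl
  refine not_isSIO_of_invariant _ _ _ K V ?_ ?_ ?_ hsio
  · intro z hz
    rw [hVmem] at hz ⊢
    rw [hBK]
    constructor
    · intro i hi
      have hix : i ≠ x := by rintro rfl; exact hi hx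
      rw [Pi.add_apply, Pi.single_eq_of_ne hix, add_zero]
      by_cases hiv : i = v
      · subst hiv
        have := hz.2 0 hN1
        rwa [hφ, zero_add, pow_one] at this
      · refine realize_mulVec_eq_zero_of_supportedIn _ hz.1 fun d hd hid => ?_
        exact (hD d hd i ⟨hid, hix⟩).elim hi hiv
    · intro k hk
      rw [map_add, hφA, hφx]
      rcases Nat.lt_or_eq_of_le (Nat.succ_le_of_lt hk) with hk' | hk'
      · rw [hz.2 (k + 1) hk', hmin (k + 1) hk', zero_mul, add_zero]
      · rw [Nat.succ_eq_add_one] at hk'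
        rw [hk']
        field_simp
        ring
  · intro z hz
    ext y
    exact realize_mulVec_eq_zero_of_supportedIn _ ((hVmem z).1 hz).1 fun d hd => hC d hd y
  · let ext' : (D → ℝ) →ₗ[ℝ] (X → ℝ) := LinearMap.pi fun i =>
      if h : i ∈ D then LinearMap.proj ⟨i, h⟩ else 0
    let L : (D → ℝ) →ₗ[ℝ] (Fin N → ℝ) := LinearMap.pi fun k => φ (k + 1) ∘ₗ ext'
    obtain ⟨z, hz, hz0⟩ := (Submodule.ne_bot_iff _).1
      (LinearMap.ker_ne_bot_of_finrank_lt (f := L) (by simpa using hND))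
    refine (Submodule.ne_bot_iff _).2 ⟨ext' z, (hVmem _).2 ⟨fun i hi => ?_, fun k hk => ?_⟩, ?_⟩
    · have hi' : i ∉ D := hi
      simp [ext', hi']
    · exact congrFun (LinearMap.mem_ker.1 hz) ⟨k, hk⟩
    · intro h0
      refine hz0 (funext fun i => ?_)
      have := congrFun h0 i
      simpa [ext'] using this

end
end

noncomputable section

/-! ## Correctness of the sensor placement algorithm -/

open Relation

section

variable {X : Type} [Fintype X] [DecidableEq X] {A : StructMatrix X X} {x : X} {T : Finset X}

theorem norm0_sensorMatrix {X : Type} [DecidableEq X] (T : Finset X) : (sensorMatrix T).norm0 = T.card := by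
  rw [StructMatrix.norm0, ← Nat.card_eq_finsetCard]
  refine Nat.card_congr ⟨fun p => ⟨p.1.1, ?_⟩, fun t => ⟨(t, t), by simp [sensorMatrix]⟩, ?_, ?_⟩
  · have := of_decide_eq_true p.2
    exact this.1 ▸ this.2
  · rintro ⟨⟨y, m⟩, h⟩
    have := of_decide_eq_true h
    simpa using this.1
  · intro t
    rfl

theorem card_measured_le (C : StructMatrix X X) :
    (Finset.univ.filter fun m => ∃ y, C y m = true).card ≤ C.norm0 := by
  classical
  rw [StructMatrix.norm0, Nat.card_eq_fintype_card, ← Finset.card_univ]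
  refine (Finset.card_le_card fun m hm => ?_).trans
    (Finset.card_image_le (s := Finset.univ) (f := fun p : C.Free => p.1.2))
  obtain ⟨y, hy⟩ := (Finset.mem_filter.1 hm).2
  exact Finset.mem_image.2 ⟨⟨(y, m), hy⟩, Finset.mem_univ _, rfl⟩

/-- Each `t ∈ T` has a measured state `g t` downstream, and `g` is injective on `T` because `T` hits
everything and is an antichain. If the counts agree, every measured state is some `g t`. -/
theorem card_le_of_isGSIO (hT : Hits A x T)
    (hanti : ∀ s ∈ T, ∀ t ∈ T, ReflTransGen (auxEdge A x) s t → s = t) {C : StructMatrix X X} (hC : IsGSIO A (dedicatedInput x) C) :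
    T.card ≤ C.norm0 ∧ (C.norm0 ≤ T.card → ∀ m y, C y m = true →
      ∃ t ∈ T, ReflTransGen (auxEdge A x) t m) := by
  choose g hg hgC using exists_measured_of_isGSIO hC
  have hmaps : Set.MapsTo g T
      (Finset.univ.filter fun m => ∃ y, C y m = true : Finset X) := fun t _ => by
    simpa using hgC t
  have hinj : Set.InjOn g T := by
    intro s hs t ht hst
    obtain ⟨r, hr, hgr⟩ := hT (g s)
    have h1 := hanti s hs r hr ((hg s).trans hgr)
    rw [hst] at hgr
    exact h1.trans (hanti t ht r hr ((hg t).trans hgr)).symm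
  have h1 := Finset.card_le_card_of_injOn g hmaps hinj
  refine ⟨h1.trans (card_measured_le C), fun h2 m y hm => ?_⟩
  obtain ⟨t, ht, rfl⟩ := Finset.surjOn_of_injOn_of_card_le g hmaps hinj
    ((card_measured_le C).trans h2) (show m ∈ _ by simpa using ⟨y, hm⟩)
  exact ⟨t, ht, hg t⟩

/-- With only `|T|` parameters all measured states lie downstream of `T`. A measured state that
reaches `T` only through `v` would give a `t ∈ T` that reaches `v`, and through `v` both `s₁` and
`s₂`. So this region is unmeasured and `not_isGSIO_of_exit` applies. -/
theorem card_lt_of_isGSIO (hT : Hits A x T)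
    (hanti : ∀ s ∈ T, ∀ t ∈ T, ReflTransGen (auxEdge A x) s t → s = t)
    {s₁ s₂ : X} (hs₁ : s₁ ∈ T) (hs₂ : s₂ ∈ T) (hne : s₁ ≠ s₂)
    (hx₁ : ReflTransGen (auxEdge A x) x s₁) (hx₂ : ReflTransGen (auxEdge A x) x s₂) {j v : X}
    (hj : Escapes (auxEdge A x) T j x) (hv : ¬ Escapes (auxEdge A x) T v x)
    (hvj : ¬ Escapes (auxEdge A x) T v j) {C : StructMatrix X X}
    (hC : IsGSIO A (dedicatedInput x) C) : T.card < C.norm0 := by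
  classical
  by_contra! hle
  have hmeas := (card_le_of_isGSIO hT hanti hC).2 hle
  -- No auxiliary edge enters `x`, so every `j ≠ x` escapes `x`.
  have hvx : v ≠ x := by
    rintro rfl
    obtain ⟨s, hs, hr⟩ := hT j
    exact hvj ⟨s, hs, by simpa using hj.ne.symm, reach_mono hr fun c d h => ⟨h, h.2⟩⟩
  refine not_isGSIO_of_exit (D := Finset.univ.filter fun d => ¬ Escapes (auxEdge A x) T v d ∧ d ≠ v)
    (v := v) (j := j) ?_ ?_ ?_ ?_ ?_ ?_ hC
  · intro d hd e hde
    simp only [Finset.mem_filter, Finset.mem_univ, true_and] at hd ⊢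
    by_cases hev : e = v
    · exact .inr hev
    · exact .inl ⟨fun he => hd.1 (he.head hd.2 hde), hev⟩
  · simpa using ⟨hv, hvx.symm⟩
  · simp
  · have hjv : j ≠ v := by
      rintro rfl
      exact hv hj
    simpa using ⟨hvj, hjv⟩
  · obtain ⟨s, hs, hxj, hr⟩ := hj
    -- The vertex `v` still separates `x` from `T` after `j` is removed.
    refine ⟨hxj, reach_of_not_escapes hs hr fun h => hv ?_⟩
    obtain ⟨s', hs', hxv, hr'⟩ := h
    exact ⟨s', hs', hxv, reach_mono hr' fun c d h => ⟨h.1.1, h.2⟩⟩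
  · intro d hd y hy
    simp only [Finset.mem_filter, Finset.mem_univ, true_and] at hd
    obtain ⟨t, ht, htd⟩ := hmeas d y hy
    obtain ⟨r, hr, hdr⟩ := hT d
    have htv := htd.trans (reach_of_not_escapes hr hdr hd.1)
    have h1 := hanti t ht s₁ hs₁ (htv.trans (reach_through_of_not_escapes hs₁ hx₁ hv).2)
    have h2 := hanti t ht s₂ hs₂ (htv.trans (reach_through_of_not_escapes hs₂ hx₂ hv).2)
    exact hne (h1.symm.trans h2)

/-- Two sink components reachable from the input contain two different sensors. -/
theorem exists_two_sensors {X : Type} [DecidableEq X] {A : StructMatrix X X} {x : X} {T : Finset X}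
    (hT : Hits A x T)
    (h : 1 < numReachableSinkSCC (stateDigraph (auxSystem A x)) (Sum.inr ())) :
    ∃ s₁ ∈ T, ∃ s₂ ∈ T, s₁ ≠ s₂ ∧ ReflTransGen (auxEdge A x) x s₁ ∧
      ReflTransGen (auxEdge A x) x s₂ := by
  set G := stateDigraph (auxSystem A x) with hG
  have hadj : ∀ a b, G.Adj (Sum.inl a) (Sum.inl b) ↔ auxEdge A x a b := fun a b => by
    simp [hG, stateDigraph, auxSystem, auxEdge]
  have hto : ∀ g k, ¬ G.Adj g (Sum.inr k) := fun g k => by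
    rcases g with a | l <;> simp [hG, stateDigraph, auxSystem]
  have hux : ∀ k b, G.Adj (Sum.inr k) (Sum.inl b) ↔ b = x := fun k b => by
    simp [hG, stateDigraph, auxSystem]
  have hlift : ∀ {a b}, ReflTransGen (auxEdge A x) a b → Reaches G (Sum.inl a) (Sum.inl b) :=
    fun h => h.lift Sum.inl fun a b hab => (hadj a b).2 hab
  have hdown : ∀ {a g}, Reaches G (Sum.inl a) g → ∃ b, g = Sum.inl b ∧ ReflTransGen (auxEdge A x) a b := by
    intro a g h
    induction h with
    | refl => exact ⟨a, rfl, .refl⟩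
    | tail _ h ih =>
      obtain ⟨b, rfl, hb⟩ := ih
      rename_i g _
      rcases g with c | k
      · exact ⟨c, rfl, hb.tail ((hadj b c).1 h)⟩
      · exact absurd h (hto _ _)
  have hu : ∀ {b}, Reaches G (Sum.inr ()) (Sum.inl b) → ReflTransGen (auxEdge A x) x b := by
    intro b h
    rcases h.cases_head with h | ⟨g, hg, hr⟩
    · simp at h
    · rcases g with c | k
      · rw [hux] at hg
        subst hg
        obtain ⟨b', hb', hr'⟩ := hdown hr
        rwa [Sum.inl_injective hb']
      · exact absurd hg (hto _ _)
  have key : ∀ S : Set (X ⊕ Unit), IsSinkSCC G S → (∃ v ∈ S, Reaches G (Sum.inr ()) v) →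
      ∃ s ∈ T, Sum.inl s ∈ S ∧ ReflTransGen (auxEdge A x) x s := by
    rintro S ⟨-, hsink⟩ ⟨v, hv, huv⟩
    have hclosed : ∀ {g g'}, g ∈ S → Reaches G g g' → g' ∈ S := by
      intro g g' hg h
      induction h with
      | refl => exact hg
      | tail _ h ih => exact hsink _ ih _ h
    obtain ⟨a, ha, hxa⟩ : ∃ a, Sum.inl a ∈ S ∧ ReflTransGen (auxEdge A x) x a := by
      rcases v with a | k
      · exact ⟨a, hv, hu huv⟩
      · exact ⟨x, hsink _ hv _ ((hux _ _).2 rfl), .refl⟩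
    obtain ⟨s, hs, has⟩ := hT a
    exact ⟨s, hs, hclosed ha (hlift has), hxa.trans has⟩
  obtain ⟨S₁, ⟨hS₁, hr₁⟩, S₂, ⟨hS₂, hr₂⟩, hne⟩ := (Set.one_lt_ncard_iff_nontrivial_and_finite.1 h).1
  obtain ⟨s₁, hs₁, hsS₁, hx₁⟩ := key S₁ hS₁ hr₁
  obtain ⟨s₂, hs₂, hsS₂, hx₂⟩ := key S₂ hS₂ hr₂
  refine ⟨s₁, hs₁, s₂, hs₂, ?_, hx₁, hx₂⟩
  rintro rfl
  have hscc : ∀ S, IsSCC G S → Sum.inl s₁ ∈ S →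
      S = {w | Reaches G (Sum.inl s₁) w ∧ Reaches G w (Sum.inl s₁)} := by
    rintro _ ⟨v, rfl⟩ ⟨h1, h2⟩
    ext w
    exact ⟨fun h => ⟨h2.trans h.1, h.2.trans h1⟩, fun h => ⟨h1.trans h.1, h.2.trans h2⟩⟩
  exact hne ((hscc S₁ hS₁.1 hsS₁).trans (hscc S₂ hS₂.1 hsS₂).symm)

end

/-! ### Existence and optimality of the algorithm's results -/

section

variable {X : Type} [Fintype X] [DecidableEq X] {A : StructMatrix X X} {x : X}

theorem exists_algorithmReturns (hA : ∀ j, A j j = true) : ∃ R, AlgorithmReturns A x R := by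
  classical
  have hne : ∃ k, ∃ S : Finset (X ⊕ Unit), IsStructObservable (auxSystem A x) (sensorMatrix S) ∧
      S.card = k :=
    ⟨_, Finset.univ, isStructObservable_of_hits hA fun j => ⟨j, by simp, .refl⟩, rfl⟩
  obtain ⟨S, hS, hcard⟩ := Nat.find_spec hne
  have hmin : IsMinPlacement (auxSystem A x) S :=
    ⟨hS, fun S' hS' => hcard.trans_le (Nat.find_min' hne ⟨S', hS', rfl⟩)⟩
  by_cases hv : HasViolation A x S
  · exact ⟨_, S, hmin, .inl ⟨hv, rfl⟩⟩
  · exact ⟨_, S, hmin, .inr ⟨hv, rfl⟩⟩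

theorem isOptimal_of_algorithmReturns (hA : ∀ j, A j j = true)
    (hL : 1 < numReachableSinkSCC (stateDigraph (auxSystem A x)) (Sum.inr ()))
    {R : Finset (X ⊕ Unit)} (hR : AlgorithmReturns A x R) :
    ∃ T : Finset X, R = T.image Sum.inl ∧ IsOptimal A (dedicatedInput x) (sensorMatrix T) := by
  obtain ⟨S, hS, hR⟩ := hR
  obtain ⟨T, rfl, hT, hanti⟩ := (isMinPlacement_iff hA).1 hS
  obtain ⟨s₁, hs₁, s₂, hs₂, hne, hx₁, hx₂⟩ := exists_two_sensors hT hL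
  have hrow : ∀ T : Finset X, ∀ y m m', sensorMatrix T y m = true → sensorMatrix T y m' = true →
      m = m' := by
    intro T y m m' h h'
    simp only [sensorMatrix, decide_eq_true_eq] at h h'
    exact h.1.symm.trans h'.1
  -- Since `x` reaches two different sensors it is not in the antichain `T`, so inserting it raises
  -- the count to `|T| + 1`.
  have hxT : x ∉ T := fun hx => hne ((hanti x hx s₁ hs₁ hx₁).symm.trans (hanti x hx s₂ hs₂ hx₂))
  rw [hasViolation_iff (hT x)] at hR
  rcases hR with ⟨⟨j, v, hj, hv, hvj⟩, rfl⟩ | ⟨hnv, rfl⟩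
  · refine ⟨insert x T, by simp, ⟨isGSIO_insert hA hT ⟨j, ?_⟩, hrow _⟩, fun C hC => ?_⟩
    · exact hj.ne.symm
    · rw [norm0_sensorMatrix, Finset.card_insert_of_notMem hxT]
      exact card_lt_of_isGSIO hT hanti hs₁ hs₂ hne hx₁ hx₂ hj hv hvj hC.1
  · push Not at hnv
    refine ⟨T, rfl, ⟨isGSIO_of_no_violation hA hT ?_ fun j v hj => ?_, hrow _⟩, fun C hC => ?_⟩
    -- If `s₁` were essential, the walks from `x` to `s₂` would pass through it.
    · refine ⟨s₁, ?_⟩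
      by_contra h
      exact hne (hanti s₁ hs₁ s₂ hs₂ (reach_through_of_not_escapes hs₂ hx₂ h).2)
    · by_cases h : Escapes (auxEdge A x) T v x
      · exact .inl h
      · exact .inr (hnv j v hj h)
    · rw [norm0_sensorMatrix]
      exact (card_le_of_isGSIO hT hanti hC.1).1

end
end

noncomputable section

/-! ## Reasoning about loop programs of the word RAM -/

namespace RAM

theorem State.setReg_reg (s : State) (r v r' : ℕ) :
    (s.setReg r v).reg r' = if r' = r then v else s.reg r' := by
  simp [State.setReg, Function.update_apply]

theorem State.setReg_arr (s : State) (r v : ℕ) : (s.setReg r v).arr = s.arr := rfl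

theorem State.setArr_arr (s : State) (k i v k' j : ℕ) :
    (s.setArr k i v).arr k' j = if k' = k ∧ j = i then v else s.arr k' j := by
  by_cases hk : k' = k
  · subst hk
    simp [State.setArr, Function.update_apply]
  · simp [State.setArr, hk]

theorem State.setReg_setReg (s : State) (r v v' : ℕ) :
    (s.setReg r v).setReg r v' = s.setReg r v' := by
  simp [State.setReg]

/-- Does the program write register `r`? -/
def Prog.writesReg : Prog → ℕ → Bool
  | .const r _, i => i == r
  | .add r _ _, i => i == r
  | .sub r _ _, i => i == r
  | .mul r _ _, i => i == r
  | .load r _ _, i => i == r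
  | .store _ _ _, _ => false
  | .seq p q, i => p.writesReg i || q.writesReg i
  | .ifLt _ _ p q, i => p.writesReg i || q.writesReg i
  | .whileLt _ _ p, i => p.writesReg i

/-- Does the program write into array `k`? -/
def Prog.writesArr : Prog → ℕ → Bool
  | .const _ _, _ => false
  | .add _ _ _, _ => false
  | .sub _ _ _, _ => false
  | .mul _ _ _, _ => false
  | .load _ _ _, _ => false
  | .store k _ _, i => i == k
  | .seq p q, i => p.writesArr i || q.writesArr i
  | .ifLt _ _ p q, i => p.writesArr i || q.writesArr i
  | .whileLt _ _ p, i => p.writesArr i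

/-- The states `s` and `s'` differ at most in the registers and arrays written by `p`. -/
structure Frame (p : Prog) (s s' : State) : Prop where
  reg : ∀ r, p.writesReg r = false → s'.reg r = s.reg r
  arr : ∀ k, p.writesArr k = false → s'.arr k = s.arr k

theorem Frame.refl (p : Prog) (s : State) : Frame p s s := ⟨fun _ _ => rfl, fun _ _ => rfl⟩

theorem Frame.trans {p : Prog} {s s' s'' : State} (h : Frame p s s') (h' : Frame p s' s'') :
    Frame p s s'' :=
  ⟨fun r hr => (h'.reg r hr).trans (h.reg r hr), fun k hk => (h'.arr k hk).trans (h.arr k hk)⟩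

theorem Frame.of_le {p q : Prog} {s s' : State} (h : Frame p s s')
    (hr : ∀ r, q.writesReg r = false → p.writesReg r = false)
    (hk : ∀ k, q.writesArr k = false → p.writesArr k = false) : Frame q s s' :=
  ⟨fun r h' => h.reg r (hr r h'), fun k h' => h.arr k (hk k h')⟩

theorem Frame.setReg {p : Prog} {r : ℕ} (hr : p.writesReg r = true) (s : State) (v : ℕ) :
    Frame p s (s.setReg r v) :=
  ⟨fun r' hr' => by
    rw [State.setReg_reg, if_neg]
    rintro rfl
    simp [hr] at hr', fun _ _ => rfl⟩

theorem Frame.setArr {p : Prog} {k : ℕ} (hk : p.writesArr k = true) (s : State) (i v : ℕ) :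
    Frame p s (s.setArr k i v) :=
  ⟨fun _ _ => rfl, fun k' hk' => by
    funext j
    rw [State.setArr_arr, if_neg]
    rintro ⟨rfl, -⟩
    simp [hk] at hk'⟩

theorem Exec.frame {W : ℕ} {p : Prog} {s s' : State} {t : ℕ} (h : Exec W p s t s') :
    Frame p s s' := by
  induction h with
  | const s r c _ => exact .setReg (by simp [Prog.writesReg]) _ _
  | add s r a b _ => exact .setReg (by simp [Prog.writesReg]) _ _
  | sub s r a b _ => exact .setReg (by simp [Prog.writesReg]) _ _
  | mul s r a b _ => exact .setReg (by simp [Prog.writesReg]) _ _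
  | load s r k a _ => exact .setReg (by simp [Prog.writesReg]) _ _
  | store s k a b _ => exact .setArr (by simp [Prog.writesArr]) _ _ _
  | seq p q s s' s'' t t' _ _ ih ih' =>
    exact (ih.of_le (by simp +contextual [Prog.writesReg]) (by simp +contextual [Prog.writesArr])).trans
      (ih'.of_le (by simp +contextual [Prog.writesReg]) (by simp +contextual [Prog.writesArr]))
  | ifTrue a b p q s s' t _ _ ih =>
    exact ih.of_le (by simp +contextual [Prog.writesReg]) (by simp +contextual [Prog.writesArr])
  | ifFalse a b p q s s' t _ _ ih =>
    exact ih.of_le (by simp +contextual [Prog.writesReg]) (by simp +contextual [Prog.writesArr])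
  | whileTrue a b p s s' s'' t t' _ _ _ ih ih' =>
    have h : Frame (.whileLt a b p) s s' := ih.of_le (fun _ h => h) (fun _ h => h)
    exact h.trans ih'
  | whileFalse a b p s _ => exact .refl _ _

/-- An upper bound for the running time if no loop is iterated more than `n` times. -/
def Prog.time (n : ℕ) : Prog → ℕ
  | .const _ _ => 1
  | .add _ _ _ => 1
  | .sub _ _ _ => 1
  | .mul _ _ _ => 1
  | .load _ _ _ => 1
  | .store _ _ _ => 1
  | .seq p q => p.time n + q.time n
  | .ifLt _ _ p q => p.time n + q.time n + 1
  | .whileLt _ _ p => (p.time n + 1) * n + 1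

/-- Total correctness with the time bound `Prog.time n` and words up to `W`. -/
def WP (W n : ℕ) (p : Prog) (Q : State → Prop) (s : State) : Prop :=
  ∃ t s', Exec W p s t s' ∧ t ≤ p.time n ∧ Q s'

section Rules

variable {W n : ℕ} {Q Q' : State → Prop} {s : State}

theorem WP.mono {p : Prog} (h : WP W n p Q s) (hQ : ∀ s', Q s' → Frame p s s' → Q' s') :
    WP W n p Q' s := by
  obtain ⟨t, s', he, ht, hq⟩ := h
  exact ⟨t, s', he, ht, hQ s' hq he.frame⟩

theorem WP.const {r c : ℕ} (hc : c ≤ W) (h : Q (s.setReg r c)) : WP W n (.const r c) Q s :=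
  ⟨1, _, .const s r c hc, le_rfl, h⟩

theorem WP.add {r a b : ℕ} (hc : s.reg a + s.reg b ≤ W) (h : Q (s.setReg r (s.reg a + s.reg b))) :
    WP W n (.add r a b) Q s :=
  ⟨1, _, .add s r a b hc, le_rfl, h⟩

theorem WP.sub {r a b : ℕ} (hc : s.reg a - s.reg b ≤ W) (h : Q (s.setReg r (s.reg a - s.reg b))) :
    WP W n (.sub r a b) Q s :=
  ⟨1, _, .sub s r a b hc, le_rfl, h⟩

theorem WP.mul {r a b : ℕ} (hc : s.reg a * s.reg b ≤ W) (h : Q (s.setReg r (s.reg a * s.reg b))) :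
    WP W n (.mul r a b) Q s :=
  ⟨1, _, .mul s r a b hc, le_rfl, h⟩

theorem WP.load {r k a : ℕ} (hc : s.arr k (s.reg a) ≤ W) (h : Q (s.setReg r (s.arr k (s.reg a)))) :
    WP W n (.load r k a) Q s :=
  ⟨1, _, .load s r k a hc, le_rfl, h⟩

theorem WP.store {k a b : ℕ} (hc : s.reg b ≤ W) (h : Q (s.setArr k (s.reg a) (s.reg b))) :
    WP W n (.store k a b) Q s :=
  ⟨1, _, .store s k a b hc, le_rfl, h⟩

theorem WP.seq {p q : Prog} (h : WP W n p (WP W n q Q) s) : WP W n (.seq p q) Q s := by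
  obtain ⟨t, s', he, ht, t', s'', he', ht', hq⟩ := h
  exact ⟨t + t', s'', .seq p q _ _ _ _ _ he he', Nat.add_le_add ht ht', hq⟩

theorem WP.ifLt {a b : ℕ} {p q : Prog} (hp : s.reg a < s.reg b → WP W n p Q s)
    (hq : ¬ s.reg a < s.reg b → WP W n q Q s) : WP W n (.ifLt a b p q) Q s := by
  by_cases h : s.reg a < s.reg b
  · obtain ⟨t, s', he, ht, hs⟩ := hp h
    exact ⟨t + 1, s', .ifTrue _ _ _ _ _ _ _ h he, by simp only [Prog.time]; omega, hs⟩
  · obtain ⟨t, s', he, ht, hs⟩ := hq h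
    exact ⟨t + 1, s', .ifFalse _ _ _ _ _ _ _ h he, by simp only [Prog.time]; omega, hs⟩

/-- `for r = 0, …, reg 0 - 1`; register `2` has to hold the number `1`. -/
def forLoop (r : ℕ) (body : Prog) : Prog :=
  .seq (.const r 0) (.whileLt r 0 (.seq body (.add r r 2)))

/-- The frame is carried through the induction so that the loop bound and the constant `1` are known
in every iteration. -/
theorem WP.forLoop {r : ℕ} {body : Prog} (I : ℕ → State → Prop) (hr0 : r ≠ 0) (hr2 : r ≠ 2)
    (hb : body.writesReg r = false) (hb0 : body.writesReg 0 = false)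
    (hb2 : body.writesReg 2 = false) (hn : s.reg 0 = n) (h1 : s.reg 2 = 1) (hW : n ≤ W)
    (h0 : I 0 (s.setReg r 0))
    (hbody : ∀ (i : Fin n) s₁, I i s₁ → s₁.reg r = i → Frame (forLoop r body) s s₁ →
      WP W n body (fun s₂ => I (i + 1) (s₂.setReg r (i + 1))) s₁)
    (hQ : ∀ s₁, I n s₁ → Frame (RAM.forLoop r body) s s₁ → Q s₁) :
    WP W n (RAM.forLoop r body) Q s := by
  have hw0 : (RAM.forLoop r body).writesReg 0 = false := by
    simp [RAM.forLoop, Prog.writesReg, hb0, hr0.symm]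
  have hw2 : (RAM.forLoop r body).writesReg 2 = false := by
    simp [RAM.forLoop, Prog.writesReg, hb2, hr2.symm]
  have hwr : (RAM.forLoop r body).writesReg r = true := by simp [RAM.forLoop, Prog.writesReg]
  have key : ∀ k i s₁, i + k = n → I i s₁ → s₁.reg r = i → Frame (RAM.forLoop r body) s s₁ →
      ∃ t s', Exec W (.whileLt r 0 (.seq body (.add r r 2))) s₁ t s' ∧
        t ≤ (body.time n + 1 + 1) * k + 1 ∧ I n s' ∧ Frame (RAM.forLoop r body) s s' := by
    intro k
    induction k with
    | zero =>
      intro i s₁ hi hI hri hF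
      have hin : i = n := by simpa using hi
      subst hin
      refine ⟨1, s₁, .whileFalse _ _ _ _ ?_, by simp, hI, hF⟩
      rw [hri, hF.reg 0 hw0, hn]
      exact lt_irrefl _
    | succ k ih =>
      intro i s₁ hi hI hri hF
      have hin : i < n := by omega
      obtain ⟨t₁, s₂, he₁, ht₁, hI₂⟩ := hbody ⟨i, hin⟩ s₁ hI hri hF
      have hF₁ := he₁.frame
      have hr₂ : s₂.reg r = i := (hF₁.reg r hb).trans hri
      have h2₂ : s₂.reg 2 = 1 := by rw [hF₁.reg 2 hb2, hF.reg 2 hw2, h1]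
      have hadd : Exec W (.add r r 2) s₂ 1 (s₂.setReg r (i + 1)) := by
        have := Exec.add (W := W) s₂ r r 2 (by rw [hr₂, h2₂]; omega)
        rwa [hr₂, h2₂] at this
      have hF₂ : Frame (RAM.forLoop r body) s (s₂.setReg r (i + 1)) := by
        refine (hF.trans (hF₁.of_le ?_ ?_)).trans (.setReg hwr _ _)
        · intro r' hr'
          simp only [RAM.forLoop, Prog.writesReg, Bool.or_eq_false_iff] at hr'
          exact hr'.2.1
        · intro r' hr'
          simp only [RAM.forLoop, Prog.writesArr, Bool.or_eq_false_iff] at hr'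
          exact hr'.2.1
      obtain ⟨t₂, s₃, he₂, ht₂, hI₃, hF₃⟩ := ih (i + 1) (s₂.setReg r (i + 1)) (by omega) hI₂
        (by simp [State.setReg_reg]) hF₂
      refine ⟨t₁ + 1 + t₂ + 1, s₃, .whileTrue _ _ _ _ _ _ _ _ ?_ (.seq _ _ _ _ _ _ _ he₁ hadd) he₂,
        ?_, hI₃, hF₃⟩
      · rw [hri, hF.reg 0 hw0, hn]
        exact hin
      · rw [Nat.mul_succ]
        omega
  obtain ⟨t, s', he, ht, hI, hF⟩ := key n 0 (s.setReg r 0) (by simp) h0 (by simp [State.setReg_reg])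
    (.setReg hwr _ _)
  refine ⟨1 + t, s', .seq _ _ _ _ _ _ _ (.const _ _ _ (Nat.zero_le _)) he, ?_, hQ s' hI hF⟩
  simp only [RAM.forLoop, Prog.time]
  omega

end Rules

end RAM
end

noncomputable section

/-! ## A program for the placement algorithm -/

namespace RAM

/-- Does nothing (writes a scratch register). -/
def skip : Prog := .const 15 0

/-- Computes the array index of the matrix entry with row `reg a` and column `reg b`. -/
def index (r a b : ℕ) : Prog := .seq (.mul r a 0) (.add r r b)

/-- Looks for a vertex with mark `1` in array `2`; register `8` tells whether there is one, and
register `9` holds it. -/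
def scan : Prog :=
  forLoop 6 (.seq (.load 10 2 6)
    (.ifLt 10 3 (.ifLt 4 10 (.seq (.add 9 6 4) (.add 8 2 4)) skip) skip))

/-- Marks the unmarked vertices of the original system with an edge to the vertex `reg 9`. -/
def markPred : Prog :=
  forLoop 6 (.seq (.load 10 2 6)
    (.ifLt 10 2 (.seq (index 11 9 6) (.seq (.load 12 0 11) (.ifLt 4 12 (.store 2 6 2) skip))) skip))

/-- Changes the mark of the vertex `reg 9` to `2` and marks its predecessors. -/
def expand : Prog := .seq (.store 2 9 3) (.ifLt 9 1 markPred (.ifLt 1 9 markPred skip))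

/-- Backward search in array `2`: mark `2` means processed or blocked, mark `1` means pending. -/
def search : Prog := forLoop 7 (.seq (.const 8 0) (.seq scan (.ifLt 4 8 expand skip)))

/-- The registers and the array with the fixed data of the system. -/
structure Env {n : ℕ} (A : StructMatrix (Fin n) (Fin n)) (x : Fin n) (s : State) : Prop where
  size : s.reg 0 = n
  driven : s.reg 1 = x
  one : s.reg 2 = 1
  two : s.reg 3 = 2
  zero : s.reg 4 = 0
  pattern : ∀ i j : Fin n, s.arr 0 (i * n + j) = if A i j then 1 else 0

theorem Env.frame {n : ℕ} {A : StructMatrix (Fin n) (Fin n)} {x : Fin n} {p : Prog} {s s' : State}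
    (h : Env A x s) (hF : Frame p s s') (hr : ∀ r < 5, p.writesReg r = false)
    (hk : p.writesArr 0 = false) : Env A x s' where
  size := (hF.reg 0 (hr 0 (by norm_num))).trans h.size
  driven := (hF.reg 1 (hr 1 (by norm_num))).trans h.driven
  one := (hF.reg 2 (hr 2 (by norm_num))).trans h.one
  two := (hF.reg 3 (hr 3 (by norm_num))).trans h.two
  zero := (hF.reg 4 (hr 4 (by norm_num))).trans h.zero
  pattern := by rw [hF.arr 0 hk]; exact h.pattern

section

variable {n W : ℕ} {A : StructMatrix (Fin n) (Fin n)} {x : Fin n} {s : State} {Q : State → Prop}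

theorem WP.skip (h : Q (s.setReg 15 0)) : WP W n skip Q s := WP.const (Nat.zero_le _) h

theorem index_lt (i j : Fin n) : (i : ℕ) * n + j < n * n := by
  have h1 : (i : ℕ) * n + n ≤ n * n := by
    rw [← Nat.succ_mul]
    exact Nat.mul_le_mul_right n i.2
  have := j.2
  omega

theorem index_inj {i j i' j' : Fin n} : (i : ℕ) * n + j = i' * n + j' ↔ i = i' ∧ j = j' := by
  constructor
  · intro h
    have hn : 0 < n := i.pos
    have h1 := congrArg (· / n) h
    have h2 := congrArg (· % n) h
    simp only [Nat.mul_comm _ n, Nat.mul_add_div hn, Nat.div_eq_of_lt j.2, Nat.div_eq_of_lt j'.2,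
      Nat.mul_add_mod, Nat.mod_eq_of_lt j.2, Nat.mod_eq_of_lt j'.2, add_zero] at h1 h2
    exact ⟨Fin.ext h1, Fin.ext h2⟩
  · rintro ⟨rfl, rfl⟩
    rfl

theorem WP.index (hW : n * n + 2 ≤ W) {r a b : ℕ} (hrb : b ≠ r) {i j : Fin n} (hn : s.reg 0 = n)
    (ha : s.reg a = i) (hb : s.reg b = j) (h : Q (s.setReg r (i * n + j))) :
    WP W n (index r a b) Q s := by
  have := index_lt i j
  refine WP.seq (WP.mul ?_ (WP.add ?_ ?_))
  · rw [ha, hn]; omega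
  · simp only [State.setReg_reg, if_true, if_neg hrb, ha, hb, hn]; omega
  · simpa only [State.setReg_reg, if_true, if_neg hrb, ha, hb, hn, State.setReg_setReg] using h

theorem WP.scan (hW : n * n + 2 ≤ W) (hE : Env A x s) {μ : Fin n → ℕ} (hμ : ∀ i : Fin n, s.arr 2 i = μ i)
    (hμ2 : ∀ i, μ i ≤ 2) (h8 : s.reg 8 = 0) :
    WP W n scan (fun s' => (s'.reg 8 = 0 ∧ ∀ i, μ i ≠ 1) ∨
      (s'.reg 8 = 1 ∧ ∃ c : Fin n, s'.reg 9 = c ∧ μ c = 1)) s := by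
  have hn : n ≤ n * n := Nat.le_mul_self n
  refine WP.forLoop (fun i s => (s.reg 8 = 0 ∧ ∀ m : Fin n, (m : ℕ) < i → μ m ≠ 1) ∨
      (s.reg 8 = 1 ∧ ∃ c : Fin n, s.reg 9 = c ∧ μ c = 1)) (by decide) (by decide) (by decide)
      (by decide) (by decide) hE.size hE.one (by omega) ?_ ?_ ?_
  · left
    simp [State.setReg_reg, h8]
  · intro i s₁ hI hi hF
    have hE₁ := hE.frame hF (by decide) (by decide)
    have harr : s₁.arr 2 i = μ i := by rw [hF.arr 2 (by decide), hμ]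
    have hi2 := hμ2 i
    refine WP.seq (WP.load (by rw [hi, harr]; omega) (WP.ifLt (fun hlt => WP.ifLt (fun hlt' => ?_)
      (fun hlt' => ?_)) (fun hlt => ?_)))
    · simp only [State.setReg_reg, hi, harr, hE₁.two, if_true] at hlt
      simp only [State.setReg_reg, hi, harr, hE₁.zero, if_true] at hlt'
      norm_num at hlt hlt'
      have hi' : μ i = 1 := by omega
      have hin := i.2
      refine WP.seq (WP.add (by simp [State.setReg_reg, hi, hE₁.zero]; omega)
        (WP.add (by simp [State.setReg_reg, hE₁.one, hE₁.zero]; omega) (Or.inr ⟨?_, i, ?_, hi'⟩)))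
      · simp [State.setReg_reg, hE₁.one, hE₁.zero]
      · simp [State.setReg_reg, hi, hE₁.zero]
    all_goals
      simp only [State.setReg_reg, hi, harr, hE₁.two, if_true] at hlt
      try simp only [State.setReg_reg, hi, harr, hE₁.zero, if_true] at hlt'
      norm_num at hlt
      try norm_num at hlt'
      refine WP.skip ?_
      simp only [State.setReg_reg]
      norm_num
      refine hI.imp (fun h => ⟨h.1, fun m hm => ?_⟩) id
      rcases lt_or_eq_of_le hm with hm | rfl
      · exact h.2 m hm
      · omega
  · intro s₁ hI _
    exact hI.imp (fun h => ⟨h.1, fun i => h.2 i i.2⟩) id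

theorem WP.markPred (hW : n * n + 2 ≤ W) (hE : Env A x s) {μ : Fin n → ℕ}
    (hμ : ∀ i : Fin n, s.arr 2 i = μ i) (hμ2 : ∀ i, μ i ≤ 2) {c : Fin n} (h9 : s.reg 9 = c) :
    WP W n markPred (fun s' => ∀ i : Fin n, s'.arr 2 i =
      if μ i = 0 ∧ A c i = true then 1 else μ i) s := by
  have hn : n ≤ n * n := Nat.le_mul_self n
  refine WP.forLoop (fun k s => ∀ i : Fin n, s.arr 2 i =
      if (i : ℕ) < k ∧ μ i = 0 ∧ A c i = true then 1 else μ i) (by decide) (by decide) (by decide)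
      (by decide) (by decide) hE.size hE.one (by omega) ?_ ?_ ?_
  · simpa [State.setReg_arr] using hμ
  · intro i s₁ hI hi hF
    have hE₁ := hE.frame hF (by decide) (by decide)
    have harr : s₁.arr 2 i = μ i := by rw [hI, if_neg (by simp)]
    have hi2 := hμ2 i
    have h9₁ : s₁.reg 9 = c := (hF.reg 9 (by decide)).trans h9
    have hkeep : ∀ m : Fin n, (μ i = 0 ∧ A c i = true → m ≠ i) → s₁.arr 2 m =
        if (m : ℕ) < i + 1 ∧ μ m = 0 ∧ A c m = true then 1 else μ m := by
      intro m hm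
      rw [hI]
      by_cases hmi : m = i
      · subst hmi
        have : ¬ (μ m = 0 ∧ A c m = true) := fun h => hm h rfl
        simp [this]
      · have : (m : ℕ) ≠ i := fun h => hmi (Fin.ext h)
        have : (m : ℕ) < i + 1 ↔ (m : ℕ) < i := by omega
        simp [this]
    refine WP.seq (WP.load (by rw [hi, harr]; omega) (WP.ifLt (fun hlt => ?_) (fun hlt => ?_)))
    · simp only [State.setReg_reg, hi, harr, hE₁.one, if_true] at hlt
      norm_num at hlt
      refine WP.seq (WP.index hW (i := c) (j := i) (by decide) (by simp [State.setReg_reg, hE₁.size])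
        (by simp [State.setReg_reg, h9₁]) (by simp [State.setReg_reg, hi]) (WP.seq (WP.load ?_
          (WP.ifLt (fun hlt' => ?_) (fun hlt' => ?_)))))
      · simp only [State.setReg_reg, State.setReg_arr, if_true, hE₁.pattern]
        split_ifs <;> omega
      · have hA : A c i = true := by
          by_contra hA
          simp [State.setReg_reg, State.setReg_arr, hE₁.pattern, hE₁.zero, hA] at hlt'
        refine WP.store (by simp [State.setReg_reg, hE₁.one]; omega) ?_
        intro m
        simp only [State.setReg_arr, State.setArr_arr, State.setReg_reg, hi, hE₁.one]
        by_cases hmi : m = i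
        · subst hmi
          simp [hlt, hA]
        · have : (m : ℕ) ≠ i := fun h => hmi (Fin.ext h)
          simpa [this] using hkeep m fun _ => hmi
      · simp [State.setReg_reg, State.setReg_arr, hE₁.pattern, hE₁.zero] at hlt'
        exact WP.skip fun m => hkeep m fun h => by simp [hlt'] at h
    · simp only [State.setReg_reg, hi, harr, hE₁.one, if_true] at hlt
      norm_num at hlt
      exact WP.skip fun m => hkeep m fun h => absurd h.1 hlt
  · intro s₁ hI _ i
    rw [hI]
    simp [i.2]

open Classical in
-- The two comparisons test whether `c ≠ x`; no auxiliary edge enters `x`, so its predecessors in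
-- `A` must not be marked.
theorem WP.expand (hW : n * n + 2 ≤ W) (hE : Env A x s) {μ : Fin n → ℕ}
    (hμ : ∀ i : Fin n, s.arr 2 i = μ i) (hμ2 : ∀ i, μ i ≤ 2) {c : Fin n} (h9 : s.reg 9 = c) :
    WP W n expand (fun s' => ∀ i : Fin n, s'.arr 2 i =
      if i = c then 2 else if μ i = 0 ∧ auxEdge A x i c then 1 else μ i) s := by
  refine WP.seq (WP.store (by rw [hE.two]; omega) ?_)
  rw [h9, hE.two]
  set s₁ := s.setArr 2 c 2 with hs₁
  have hE₁ : Env A x s₁ :=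
    hE.frame (p := .store 2 9 3) (.setArr (by decide) _ _ _) (by decide) (by decide)
  have hμ₁ : ∀ i : Fin n, s₁.arr 2 i = Function.update μ c 2 i := by
    intro i
    by_cases hi : i = c
    · subst hi; simp [hs₁, State.setArr_arr]
    · have : (i : ℕ) ≠ c := fun h => hi (Fin.ext h)
      simp [hs₁, State.setArr_arr, hi, this, hμ]
  have hμ₁2 : ∀ i, Function.update μ c 2 i ≤ 2 := by
    intro i
    by_cases hi : i = c
    · subst hi; simp
    · simp [hi, hμ2]
  have h9₁ : s₁.reg 9 = c := h9
  have hmark : c ≠ x → WP W n RAM.markPred (fun s' => ∀ i : Fin n, s'.arr 2 i =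
      if i = c then 2 else if μ i = 0 ∧ auxEdge A x i c then 1 else μ i) s₁ := by
    intro hcx
    refine (WP.markPred hW hE₁ hμ₁ hμ₁2 h9₁).mono fun s' hs' _ i => ?_
    rw [hs']
    by_cases hi : i = c
    · subst hi; simp
    · simp [hi, auxEdge, hcx]
  refine WP.ifLt (fun h => hmark ?_) (fun h => WP.ifLt (fun h' => hmark ?_) (fun h' => WP.skip ?_))
  · rintro rfl
    rw [h9₁, hE₁.driven] at h
    exact lt_irrefl _ h
  · rintro rfl
    rw [h9₁, hE₁.driven] at h'
    exact lt_irrefl _ h'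
  · rw [h9₁, hE₁.driven] at h h'
    have hcx : c = x := Fin.ext (by omega)
    intro i
    rw [State.setReg_arr, hμ₁]
    by_cases hi : i = c
    · subst hi; simp
    · have hix : i ≠ x := hcx ▸ hi
      simp [auxEdge, hcx, hix]

end

end RAM
end

noncomputable section

open Relation

/-! ## Specification of the search program -/

/-- The marks `μ` arise from the initial marks `m₀` in a backward search along `E`: mark `2` means
processed or blocked, mark `1` means pending. -/
structure IsPartialSearch {V : Type} (E : V → V → Prop) (m₀ μ : V → ℕ) : Prop where
  le_two : ∀ i, μ i ≤ 2
  blocked : ∀ i, m₀ i = 2 → μ i = 2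
  start : ∀ i, m₀ i = 1 → 1 ≤ μ i
  sound : ∀ i, 1 ≤ μ i → m₀ i = 2 ∨ ∃ c, m₀ c = 1 ∧ AvoidReach E {k | m₀ k = 2} i c
  closed : ∀ i c, μ c = 2 → m₀ c ≠ 2 → E i c → 1 ≤ μ i

section

variable {V : Type} {E : V → V → Prop} {m₀ μ μ' : V → ℕ}

theorem IsPartialSearch.init (h : ∀ i, m₀ i ≤ 2) : IsPartialSearch E m₀ m₀ where
  le_two := h
  blocked _ h := h
  start _ h := h.ge
  sound i hi := by
    rcases (h i).lt_or_eq with h2 | h2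
    · have h1 : m₀ i = 1 := by omega
      exact .inr ⟨i, h1, .refl (by simp [h1])⟩
    · exact .inl h2
  closed _ _ h h' := absurd h h'

open Classical in
theorem IsPartialSearch.step [DecidableEq V] (h : IsPartialSearch E m₀ μ) {c : V} (hc : μ c = 1)
    (hμ' : ∀ i, μ' i = if i = c then 2 else if μ i = 0 ∧ E i c then 1 else μ i) :
    IsPartialSearch E m₀ μ' := by
  have hc2 : m₀ c ≠ 2 := fun h2 => by have := h.blocked c h2; omega
  have hle : ∀ i, μ i ≤ μ' i := by
    intro i
    rw [hμ']
    split_ifs with h1 h2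
    · exact h.le_two i
    · omega
    · exact le_rfl
  refine ⟨fun i => ?_, fun i hi => ?_, fun i hi => (h.start i hi).trans (hle i), fun i hi => ?_,
    fun i d hd hd2 hE => ?_⟩
  · rw [hμ']
    split_ifs
    exacts [le_rfl, one_le_two, h.le_two i]
  · rw [hμ', h.blocked i hi]
    simp
  · by_cases h1 : 1 ≤ μ i
    · exact h.sound i h1
    · rw [hμ'] at hi
      split_ifs at hi with h2 h3
      · exact absurd (h2 ▸ hc.ge) h1
      · by_cases hi2 : m₀ i = 2
        · exact .inl hi2
        · obtain ⟨d, hd, hr⟩ := (h.sound c hc.ge).resolve_left hc2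
          exact .inr ⟨d, hd, hr.head hi2 h3.2⟩
      · exact absurd hi h1
  · by_cases hdc : d = c
    · subst hdc
      rw [hμ']
      split_ifs with h2 h3
      · exact one_le_two
      · exact le_rfl
      · by_contra h4
        exact h3 ⟨by omega, hE⟩
    · rw [hμ', if_neg hdc] at hd
      split_ifs at hd with h1
      · norm_num at hd
      · exact (h.closed i d hd hd2 hE).trans (hle i)

/-- With nothing pending, the processed set contains every unblocked predecessor of its members, so
induction along a walk from its end applies. -/
theorem IsPartialSearch.final (h : IsPartialSearch E m₀ μ) (h1 : ∀ i, μ i ≠ 1) (i : V) :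
    μ i = 2 ↔ m₀ i = 2 ∨ ∃ c, m₀ c = 1 ∧ AvoidReach E {k | m₀ k = 2} i c := by
  have h2 : ∀ i, 1 ≤ μ i → μ i = 2 := fun i hi => by
    have := h.le_two i
    have := h1 i
    omega
  refine ⟨fun hi => h.sound i (by omega), ?_⟩
  rintro (hi | ⟨c, hc, hi, hr⟩)
  · exact h.blocked i hi
  · induction hr using ReflTransGen.head_induction_on with
    | refl => exact h2 _ (h.start _ hc)
    | head hE _ ih => exact h2 _ (h.closed _ _ (ih hE.2) hE.2 hE.1)

end

namespace RAM

variable {n W : ℕ} {A : StructMatrix (Fin n) (Fin n)} {x : Fin n} {s : State}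

/-- After `k` rounds either nothing is pending or at least `k` marks equal `2`, because a round with
a pending vertex processes one more. Hence `n` rounds suffice. -/
theorem WP.search (hW : n * n + 2 ≤ W) (hE : Env A x s) {m₀ : Fin n → ℕ}
    (hm₀ : ∀ i : Fin n, s.arr 2 i = m₀ i) (hm₀2 : ∀ i, m₀ i ≤ 2) :
    WP W n search (fun s' => ∀ i : Fin n, s'.arr 2 i ≤ 2 ∧ (s'.arr 2 i = 2 ↔
      m₀ i = 2 ∨ ∃ c, m₀ c = 1 ∧ AvoidReach (auxEdge A x) {k | m₀ k = 2} i c)) s := by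
  classical
  have hn : n ≤ n * n := Nat.le_mul_self n
  refine WP.forLoop (fun k s => IsPartialSearch (auxEdge A x) m₀ (fun i : Fin n => s.arr 2 i) ∧
      ((∀ i : Fin n, s.arr 2 i ≠ 1) ∨
        k ≤ (Finset.univ.filter fun i : Fin n => s.arr 2 i = 2).card)) (by decide) (by decide)
      (by decide) (by decide) (by decide) hE.size hE.one (by omega) ?_ ?_ ?_
  · refine ⟨?_, Or.inr (Nat.zero_le _)⟩
    simp only [State.setReg_arr, hm₀]
    exact .init hm₀2
  · rintro k s₁ ⟨hS, hk⟩ - hF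
    have hE₁ := hE.frame hF (by decide) (by decide)
    refine WP.seq (WP.const (Nat.zero_le _) (WP.seq ((WP.scan hW (hE₁.frame (p := .const 8 0)
      (.setReg (by decide) _ _) (by decide) (by decide)) (μ := fun i => s₁.arr 2 i)
      (fun i => rfl) hS.le_two (by simp [State.setReg_reg])).mono fun s₂ h₂ hF₂ => ?_)))
    have harr : s₂.arr 2 = s₁.arr 2 := hF₂.arr 2 (by decide)
    have hE₂ : Env A x s₂ := (hE₁.frame (p := .const 8 0)
      (.setReg (by decide) _ _) (by decide) (by decide)).frame hF₂ (by decide) (by decide)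
    refine WP.ifLt (fun hlt => ?_) (fun hlt => WP.skip ?_)
    · obtain ⟨h8, c, h9, hc⟩ := h₂.resolve_left fun h => by
        rw [h.1, hE₂.zero] at hlt
        exact lt_irrefl _ hlt
      refine (WP.expand hW hE₂ (μ := fun i => s₁.arr 2 i) (fun i => by rw [harr]) hS.le_two
        h9).mono fun s₃ h₃ _ => ⟨?_, Or.inr ?_⟩
      · exact hS.step hc h₃
      · have hk' := hk.resolve_left fun h => h c hc
        refine Nat.succ_le_of_lt (hk'.trans_lt (Finset.card_lt_card
          (Finset.ssubset_iff_of_subset ?_ |>.2 ⟨c, ?_, ?_⟩)))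
        · intro i hi
          rw [Finset.mem_filter] at hi ⊢
          refine ⟨Finset.mem_univ i, ?_⟩
          replace hi := hi.2
          rw [State.setReg_arr, h₃]
          split_ifs with h1 h2
          · rfl
          · rw [h2.1] at hi; norm_num at hi
          · exact hi
        · simp [State.setReg_arr, h₃]
        · simp [hc]
    · have h1 := (h₂.resolve_right fun h => hlt (by rw [h.1, hE₂.zero]; norm_num)).2
      simp only [State.setReg_arr, harr]
      exact ⟨hS, Or.inl h1⟩
  · rintro s₁ ⟨hS, hk⟩ -
    refine fun i => ⟨hS.le_two i, hS.final (hk.elim id fun hk j => ?_) i⟩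
    have : (Finset.univ.filter fun i : Fin n => s₁.arr 2 i = 2) = Finset.univ :=
      Finset.eq_univ_of_card _ (le_antisymm (Finset.card_le_univ _) (by simpa using hk))
    have hj := Finset.mem_univ j
    rw [← this, Finset.mem_filter] at hj
    simp [hj.2]

end RAM
end

noncomputable section

open Relation

/-! ## The placement program -/

namespace RAM

/-- Copies array `k` into array `2`. -/
def copyMarks (k : ℕ) : Prog := forLoop 6 (.seq (.load 10 k 6) (.store 2 6 10))

/-- Stores in row `reg 5` of the matrix in array `k` which vertices have mark `2`. -/
def record (k : ℕ) : Prog :=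
  forLoop 6 (.seq (index 11 5 6) (.seq (.load 12 2 6) (.ifLt 12 3 (.store k 11 4) (.store k 11 2))))

/-- For each vertex `v`, performs a search with the initial marks in array `a`, except that `v` has
the initial mark `reg m`; the result is row `v` of the matrix in array `k`. -/
def table (a m k : ℕ) : Prog :=
  forLoop 5 (.seq (copyMarks a) (.seq (.store 2 5 m) (.seq search (record k))))

/-- Loads the entry with row `reg a` and column `reg b` of the matrix in array `k` into
register `12`. -/
def fetch (k a b : ℕ) : Prog := .seq (index 11 a b) (.load 12 k 11)

/-- Sets register `8` to `1` if the vertex `reg 6` shows that `reg 5` is not the first vertex of a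
sink component. -/
def rejectTest : Prog :=
  .seq (fetch 3 6 5) (.ifLt 4 12
    (.seq (fetch 3 5 6) (.ifLt 12 2 (.add 8 2 4) (.ifLt 6 5 (.add 8 2 4) skip))) skip)

/-- Selects the first vertex of each sink component. -/
def select : Prog :=
  forLoop 5 (.seq (.const 8 0) (.seq (forLoop 6 rejectTest) (.seq (.sub 9 2 8) (.store 1 5 9))))

/-- Clears the diagonal of the matrix in array `4`. -/
def clearDiag : Prog := forLoop 5 (.seq (index 11 5 5) (.store 4 11 4))

/-- Sets register `13` to `1` if the vertices `reg 5` and `reg 6` witness a violation. -/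
def violationTest : Prog :=
  .seq (fetch 4 5 1) (.ifLt 12 2 (.seq (fetch 4 5 6) (.ifLt 12 2 (.seq (fetch 4 6 1)
    (.ifLt 4 12 (.add 13 2 4) skip)) skip)) skip)

/-- The placement program. -/
def placement : Prog :=
  .seq (.const 2 1) (.seq (.const 3 2) (.seq (table 5 2 3) (.seq select (.seq (table 1 3 4)
    (.seq clearDiag (.seq (forLoop 5 (forLoop 6 violationTest))
      (.ifLt 4 13 (.store 1 1 2) skip)))))))

section

variable {n W : ℕ} {A : StructMatrix (Fin n) (Fin n)} {x : Fin n} {s : State} {Q : State → Prop}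

theorem search_writesArr (k : ℕ) : search.writesArr k = (k == 2) := by
  simp [search, scan, expand, markPred, index, skip, RAM.forLoop, Prog.writesArr]

theorem WP.copyMarks (hW : n * n + 2 ≤ W) (hE : Env A x s) {k : ℕ} (hk : k ≠ 2) {w : Fin n → ℕ}
    (hw : ∀ i : Fin n, s.arr k i = w i) (hw2 : ∀ i, w i ≤ 2) :
    WP W n (copyMarks k) (fun s' => ∀ i : Fin n, s'.arr 2 i = w i) s := by
  have hn : n ≤ n * n := Nat.le_mul_self n
  refine WP.forLoop (fun m s => ∀ i : Fin n, (i : ℕ) < m → s.arr 2 i = w i) (by decide) (by decide)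
    rfl rfl rfl hE.size hE.one (by omega) ?_ ?_ ?_
  · intro i hi
    omega
  · intro i s₁ hI hi hF
    have harr : s₁.arr k i = w i := by
      rw [hF.arr k (by simp [RAM.forLoop, Prog.writesArr, hk]), hw]
    have := hw2 i
    refine WP.seq (WP.load (by rw [hi, harr]; omega) (WP.store ?_ ?_))
    · simp only [State.setReg_reg, hi, harr, if_true]
      omega
    · intro j hj
      simp only [State.setReg_arr, State.setArr_arr, State.setReg_reg, hi, harr]
      by_cases hji : j = i
      · subst hji
        simp
      · have : (j : ℕ) ≠ i := fun h => hji (Fin.ext h)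
        simpa [this] using hI j (by omega)
  · intro s₁ hI _ i
    exact hI i i.2

theorem WP.record (hW : n * n + 2 ≤ W) (hE : Env A x s) {k : ℕ} (hk0 : k ≠ 0) (hk2 : k ≠ 2)
    {v : Fin n} (hv : s.reg 5 = v) (h2 : ∀ i : Fin n, s.arr 2 i ≤ 2) :
    WP W n (record k) (fun s' => ∀ u i : Fin n, s'.arr k (u * n + i) =
      if u = v then if s.arr 2 i = 2 then 1 else 0 else s.arr k (u * n + i)) s := by
  have hn : n ≤ n * n := Nat.le_mul_self n
  refine WP.forLoop (fun m s' => ∀ u i : Fin n, s'.arr k (u * n + i) =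
      if u = v ∧ (i : ℕ) < m then if s.arr 2 i = 2 then 1 else 0 else s.arr k (u * n + i))
    (by decide) (by decide) rfl rfl rfl hE.size hE.one (by omega) ?_ ?_ ?_
  · simp [State.setReg_arr]
  · intro i s₁ hI hi hF
    have hE₁ := hE.frame hF (by intro r hr; interval_cases r <;> rfl)
      (by simp [RAM.forLoop, Prog.writesArr, RAM.index, hk0.symm])
    have harr : s₁.arr 2 = s.arr 2 := hF.arr 2 (by simp [RAM.forLoop, Prog.writesArr, RAM.index, hk2.symm])
    have hi2 := h2 i
    have hv₁ : s₁.reg 5 = v := (hF.reg 5 rfl).trans hv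
    have hupd : ∀ s₂ : State, s₂.arr k = Function.update (s₁.arr k) (v * n + i)
        (if s.arr 2 i = 2 then 1 else 0) → ∀ u j : Fin n, s₂.arr k (u * n + j) =
        if u = v ∧ (j : ℕ) < i + 1 then if s.arr 2 j = 2 then 1 else 0 else s.arr k (u * n + j) := by
      intro s₂ hs₂ u j
      rw [hs₂, Function.update_apply]
      by_cases h : u = v ∧ j = i
      · obtain ⟨rfl, rfl⟩ := h
        simp
      · rw [if_neg (fun h' => h (index_inj.1 h')), hI]
        have : (u = v ∧ (j : ℕ) < i) ↔ (u = v ∧ (j : ℕ) < i + 1) := by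
          refine and_congr_right fun hu => ?_
          have : (j : ℕ) ≠ i := fun h' => h ⟨hu, Fin.ext h'⟩
          omega
        simp only [this]
    refine WP.seq (WP.index hW (i := v) (j := i) (by decide) hE₁.size hv₁ hi (WP.seq (WP.load ?_
      (WP.ifLt (fun hlt => WP.store ?_ ?_) (fun hlt => WP.store ?_ ?_)))))
    · simp [State.setReg_reg, State.setReg_arr, hi, harr]
      omega
    · simp [State.setReg_reg, hE₁.zero]
    · simp [State.setReg_reg, State.setReg_arr, hi, harr, hE₁.two] at hlt
      have hne : s.arr 2 i ≠ 2 := by omega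
      refine hupd _ ?_
      simp [State.setArr, State.setReg, hE₁.zero, hne]
    · simp [State.setReg_reg, hE₁.one]
      omega
    · simp [State.setReg_reg, State.setReg_arr, hi, harr, hE₁.two] at hlt
      have hlt' : s.arr 2 i = 2 := by omega
      refine hupd _ ?_
      simp [State.setArr, State.setReg, hE₁.one, hlt']
  · intro s₁ hI _ u i
    rw [hI]
    simp [i.2]

open Classical in
-- Used twice: zero marks with a `1` at `v` yield the states that reach `v`; marks `1` on the
-- sensors with a `2` at `v` yield, off the diagonal, the states that escape `v`.
theorem WP.table (hW : n * n + 2 ≤ W) (hE : Env A x s) {a m k : ℕ} (hk0 : k ≠ 0) (hk2 : k ≠ 2)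
    (ha : a ≠ 2) (hak : a ≠ k) (hm : m < 5) (hm2 : s.reg m ≤ 2) {w : Fin n → ℕ}
    (hw : ∀ i : Fin n, s.arr a i = w i) (hw2 : ∀ i, w i ≤ 2) :
    WP W n (table a m k) (fun s' => ∀ v i : Fin n, s'.arr k (v * n + i) =
      if Function.update w v (s.reg m) i = 2 ∨ ∃ c, Function.update w v (s.reg m) c = 1 ∧
        AvoidReach (auxEdge A x) {j | Function.update w v (s.reg m) j = 2} i c then 1 else 0) s := by
  have hn : n ≤ n * n := Nat.le_mul_self n
  refine WP.forLoop (fun l s' => ∀ v i : Fin n, (v : ℕ) < l → s'.arr k (v * n + i) =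
      if Function.update w v (s.reg m) i = 2 ∨ ∃ c, Function.update w v (s.reg m) c = 1 ∧
        AvoidReach (auxEdge A x) {j | Function.update w v (s.reg m) j = 2} i c then 1 else 0)
    (by decide) (by decide) rfl rfl rfl hE.size hE.one (by omega) ?_ ?_ ?_
  · intro v i hv
    omega
  · intro v s₁ hI hv hF
    have hE₁ := hE.frame hF (by intro r hr; interval_cases r <;> rfl)
      (by simp [RAM.forLoop, Prog.writesArr, RAM.index, hk0.symm, search_writesArr, RAM.copyMarks,
        RAM.record])
    have hw₁ : ∀ i : Fin n, s₁.arr a i = w i := by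
      intro i
      rw [hF.arr a (by simp [RAM.forLoop, Prog.writesArr, RAM.index, search_writesArr, RAM.copyMarks,
        RAM.record, ha, hak]), hw]
    have hm₁ : s₁.reg m = s.reg m := hF.reg m (by interval_cases m <;> rfl)
    refine WP.seq ((WP.copyMarks hW hE₁ ha hw₁ hw2).mono fun s₂ h₂ hF₂ => ?_)
    have hE₂ := hE₁.frame hF₂ (by intro r hr; interval_cases r <;> rfl) rfl
    have hm₂ : s₂.reg m = s.reg m := (hF₂.reg m (by interval_cases m <;> rfl)).trans hm₁
    have hv₂ : s₂.reg 5 = v := (hF₂.reg 5 rfl).trans hv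
    refine WP.seq (WP.store (by rw [hm₂]; omega) (WP.seq ?_))
    rw [hv₂, hm₂]
    have hE₃ : Env A x (s₂.setArr 2 v (s.reg m)) :=
      hE₂.frame (p := .store 2 5 m) (.setArr (by simp [Prog.writesArr]) _ _ _) (fun _ _ => rfl) rfl
    refine (WP.search hW hE₃ (m₀ := Function.update w v (s.reg m)) (fun i => ?_)
      (fun i => ?_)).mono fun s₄ h₄ hF₄ => ?_
    · by_cases hi : i = v
      · subst hi
        simp [State.setArr_arr]
      · have : (i : ℕ) ≠ v := fun h => hi (Fin.ext h)
        simp [State.setArr_arr, hi, this, h₂]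
    · by_cases hi : i = v
      · subst hi
        simpa using hm2
      · simp [hi, hw2]
    · have hE₄ := hE₃.frame hF₄ (by decide) (by decide)
      refine (WP.record hW hE₄ hk0 hk2 (v := v) ?_ fun i => (h₄ i).1).mono fun s₅ h₅ hF₅ => ?_
      · exact (hF₄.reg 5 (by decide)).trans hv₂
      · intro u i hu
        rw [State.setReg_arr, h₅]
        by_cases huv : u = v
        · subst huv
          simp only [if_true, (h₄ i).2]
        · have : (u : ℕ) ≠ v := fun h => huv (Fin.ext h)
          rw [if_neg huv, hF₄.arr k (by simp [search_writesArr, hk2]), State.setArr_arr,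
            if_neg (fun h => hk2 h.1), hF₂.arr k (by simp [RAM.copyMarks, RAM.forLoop,
              Prog.writesArr, hk2]), hI u i (by omega)]
  · intro s₁ hI _ v i
    exact hI v i v.2

theorem WP.fetch (hW : n * n + 2 ≤ W) {k a b : ℕ} (hb : b ≠ 11) {i j : Fin n}
    (hn : s.reg 0 = n) (hi : s.reg a = i) (hj : s.reg b = j) (hle : s.arr k (i * n + j) ≤ 1)
    (h : Q ((s.setReg 11 (i * n + j)).setReg 12 (s.arr k (i * n + j)))) :
    WP W n (fetch k a b) Q s := by
  refine WP.seq (WP.index hW hb hn hi hj (WP.load ?_ ?_))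
  · simp only [State.setReg_reg, State.setReg_arr, if_true]
    omega
  · simpa only [State.setReg_reg, State.setReg_arr, if_true] using h

open Classical in
/-- A loop that sets a flag if one of its iterations does. -/
theorem WP.forLoop_exists {r d : ℕ} {body : Prog} (P : Fin n → Prop) (hrd : d ≠ r) (hr0 : r ≠ 0)
    (hr2 : r ≠ 2) (hb : body.writesReg r = false) (hb0 : body.writesReg 0 = false)
    (hb2 : body.writesReg 2 = false) (hn : s.reg 0 = n) (h1 : s.reg 2 = 1) (hW : n ≤ W)
    (hbody : ∀ (i : Fin n) (s₁ : State), s₁.reg r = (i : ℕ) → Frame (RAM.forLoop r body) s s₁ →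
      WP W n body (fun s₂ => s₂.reg d = if P i then 1 else s₁.reg d) s₁)
    (hQ : ∀ s₁, s₁.reg d = (if ∃ i, P i then 1 else s.reg d) →
      Frame (RAM.forLoop r body) s s₁ → Q s₁) :
    WP W n (RAM.forLoop r body) Q s := by
  refine WP.forLoop (fun m s' => s'.reg d = if ∃ i : Fin n, (i : ℕ) < m ∧ P i then 1 else s.reg d)
    hr0 hr2 hb hb0 hb2 hn h1 hW ?_ ?_ ?_
  · simp [State.setReg_reg, hrd]
  · intro i s₁ hI hi hF
    refine (hbody i s₁ hi hF).mono fun s₂ h₂ _ => ?_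
    rw [State.setReg_reg, if_neg hrd, h₂, hI]
    have : (∃ j : Fin n, (j : ℕ) < i + 1 ∧ P j) ↔ P i ∨ ∃ j : Fin n, (j : ℕ) < i ∧ P j := by
      constructor
      · rintro ⟨j, hj, hP⟩
        by_cases hji : j = i
        · exact .inl (hji ▸ hP)
        · have : (j : ℕ) ≠ i := fun h => hji (Fin.ext h)
          exact .inr ⟨j, by omega, hP⟩
      · rintro (hP | ⟨j, hj, hP⟩)
        · exact ⟨i, Nat.lt_succ_self _, hP⟩
        · exact ⟨j, by omega, hP⟩
    simp only [this]
    by_cases hP : P i <;> simp [hP]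
  · intro s₁ hI hF
    refine hQ s₁ ?_ hF
    rw [hI]
    simp

end

end RAM
end

noncomputable section

open Relation

/-! ## Correctness of the placement program -/

namespace RAM

variable {n W : ℕ} {A : StructMatrix (Fin n) (Fin n)} {x : Fin n} {s : State}

open Classical in
-- Either `k` is reached without return, so the component of `j` is not a sink, or `k` is an earlier
-- vertex of the same component.
theorem WP.rejectTest (hW : n * n + 2 ≤ W) (hE : Env A x s) {R : Fin n → Fin n → Prop}
    (hR : ∀ v i : Fin n, s.arr 3 (v * n + i) = if R i v then 1 else 0) {j k : Fin n}
    (hj : s.reg 5 = j) (hk : s.reg 6 = k) :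
    WP W n rejectTest (fun s' => s'.reg 8 = if R j k ∧ (¬ R k j ∨ k < j) then 1 else s.reg 8) s := by
  have hle : ∀ i j : Fin n, s.arr 3 (i * n + j) ≤ 1 := by
    intro i j
    rw [hR]
    split_ifs <;> omega
  refine WP.seq (WP.fetch hW (by decide) hE.size hk hj (hle k j) (WP.ifLt (fun h1 => ?_)
    (fun h1 => WP.skip ?_)))
  · have h1 : R j k := by
      by_contra h
      simp [State.setReg_reg, hR, h, hE.zero] at h1
    refine WP.seq (WP.fetch hW (i := j) (j := k) (by decide) (by simp [State.setReg_reg, hE.size])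
      (by simp [State.setReg_reg, hj]) (by simp [State.setReg_reg, hk])
      (by simpa [State.setReg_arr] using hle j k) ?_)
    have hadd : ∀ s₁ : State, s₁.reg 2 = 1 → s₁.reg 4 = 0 → ¬ R k j ∨ k < j →
        WP W n (.add 8 2 4)
          (fun s' => s'.reg 8 = if R j k ∧ (¬ R k j ∨ k < j) then 1 else s.reg 8) s₁ := by
      intro s₁ h2 h4 h
      refine WP.add (by rw [h2, h4]; omega) ?_
      simp [State.setReg_reg, h2, h4, h1, h]
    refine WP.ifLt (fun h2 => hadd _ ?_ ?_ (.inl fun h => ?_)) (fun h2 => WP.ifLt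
      (fun h3 => hadd _ ?_ ?_ (.inr ?_)) (fun h3 => WP.skip ?_))
    · simp [State.setReg_reg, hE.one]
    · simp [State.setReg_reg, hE.zero]
    · simp [State.setReg_reg, State.setReg_arr, hR, h, hE.one] at h2
    · simp [State.setReg_reg, hE.one]
    · simp [State.setReg_reg, hE.zero]
    · simpa [State.setReg_reg, hj, hk] using h3
    · have h2 : R k j := by
        by_contra h
        simp [State.setReg_reg, State.setReg_arr, hR, h, hE.one] at h2
      have h3 : ¬ k < j := by simpa [State.setReg_reg, hj, hk] using h3
      rw [if_neg fun h => h.2.elim (fun h => h h2) h3]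
      simp [State.setReg_reg]
  · have h1 : ¬ R j k := by
      intro h
      simp [State.setReg_reg, hR, h, hE.zero] at h1
    simp [State.setReg_reg, h1]

open Classical in
theorem WP.select (hW : n * n + 2 ≤ W) (hE : Env A x s) {R : Fin n → Fin n → Prop}
    (hR : ∀ v i : Fin n, s.arr 3 (v * n + i) = if R i v then 1 else 0) :
    WP W n select (fun s' => ∀ j : Fin n, s'.arr 1 j =
      if ∃ k, R j k ∧ (¬ R k j ∨ k < j) then 0 else 1) s := by
  have hn : n ≤ n * n := Nat.le_mul_self n
  refine WP.forLoop (fun m s' => ∀ j : Fin n, (j : ℕ) < m → s'.arr 1 j =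
      if ∃ k, R j k ∧ (¬ R k j ∨ k < j) then 0 else 1) (by decide) (by decide) rfl rfl rfl hE.size
      hE.one (by omega) ?_ ?_ ?_
  · intro j hj
    omega
  · intro j s₁ hI hj hF
    have hE₁ := hE.frame hF (by decide) (by decide)
    have hE₂ : Env A x (s₁.setReg 8 0) :=
      hE₁.frame (p := .const 8 0) (.setReg (by decide) _ _) (by decide) (by decide)
    refine WP.seq (WP.const (Nat.zero_le _) (WP.seq (WP.forLoop_exists (d := 8)
      (fun k => R j k ∧ (¬ R k j ∨ k < j)) (by decide) (by decide) (by decide) rfl rfl rfl hE₂.size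
      hE₂.one (by omega) (fun k s₃ hk hF₃ => ?_) (fun s₃ h₃ hF₃ => ?_))))
    · refine (WP.rejectTest hW (hE₂.frame hF₃ (by decide) (by decide)) (R := R) (j := j)
        (fun v i => ?_) ?_ hk).mono fun _ h _ => by convert h
      · rw [hF₃.arr 3 (by decide), State.setReg_arr, hF.arr 3 (by decide), hR]
      · rw [hF₃.reg 5 (by decide)]
        simpa [State.setReg_reg] using hj
    · have hE₃ := hE₂.frame hF₃ (by decide) (by decide)
      have hj₃ : s₃.reg 5 = j := by
        rw [hF₃.reg 5 (by decide)]
        simpa [State.setReg_reg] using hj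
      refine WP.seq (WP.sub (by rw [hE₃.one]; omega) (WP.store ?_ fun i hi => ?_))
      · simp [State.setReg_reg, hE₃.one]
        omega
      · simp only [State.setReg_arr, State.setArr_arr, State.setReg_reg, hE₃.one, h₃, hj₃]
        by_cases hij : i = j
        · subst hij
          by_cases hP : ∃ k, R i k ∧ (¬ R k i ∨ k < i) <;> simp [hP]
        · have : (i : ℕ) ≠ j := fun h => hij (Fin.ext h)
          rw [hF₃.arr 1 (by decide)]
          simpa [State.setReg_arr, this] using hI i (by omega)
  · intro s₁ hI _ j
    exact hI j j.2

/-- A blocked vertex has mark `2` itself and is recorded like a processed one, whereas `Escapes E T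
v v` is false. -/
theorem WP.clearDiag (hW : n * n + 2 ≤ W) (hE : Env A x s) :
    WP W n clearDiag (fun s' => ∀ v i : Fin n, s'.arr 4 (v * n + i) =
      if i = v then 0 else s.arr 4 (v * n + i)) s := by
  have hn : n ≤ n * n := Nat.le_mul_self n
  refine WP.forLoop (fun m s' => ∀ v i : Fin n, s'.arr 4 (v * n + i) =
      if i = v ∧ (v : ℕ) < m then 0 else s.arr 4 (v * n + i)) (by decide) (by decide) rfl rfl rfl
      hE.size hE.one (by omega) ?_ ?_ ?_
  · simp [State.setReg_arr]
  · intro j s₁ hI hj hF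
    have hE₁ := hE.frame hF (by decide) (by decide)
    refine WP.seq (WP.index hW (by decide) hE₁.size hj hj (WP.store ?_ fun v i => ?_))
    · simp [State.setReg_reg, hE₁.zero]
    · simp only [State.setReg_arr, State.setArr_arr, State.setReg_reg, hE₁.zero, if_true, true_and,
        index_inj, hI]
      by_cases h : v = j ∧ i = j
      · obtain ⟨rfl, rfl⟩ := h
        simp
      · rw [if_neg h]
        have : (i = v ∧ (v : ℕ) < j) ↔ (i = v ∧ (v : ℕ) < j + 1) := by
          refine and_congr_right fun hi => ?_
          have : (v : ℕ) ≠ j := fun h' => h ⟨Fin.ext h', hi.trans (Fin.ext h')⟩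
          omega
        simp only [this]
  · intro s₁ hI _ v i
    rw [hI]
    simp [v.2]

open Classical in
theorem WP.violationTest (hW : n * n + 2 ≤ W) (hE : Env A x s) {P : Fin n → Fin n → Prop}
    (hP : ∀ v i : Fin n, s.arr 4 (v * n + i) = if P v i then 1 else 0) {v j : Fin n}
    (hv : s.reg 5 = v) (hj : s.reg 6 = j) :
    WP W n violationTest (fun s' => s'.reg 13 =
      if P j x ∧ ¬ P v x ∧ ¬ P v j then 1 else s.reg 13) s := by
  have hle : ∀ i j : Fin n, s.arr 4 (i * n + j) ≤ 1 := by
    intro i j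
    rw [hP]
    split_ifs <;> omega
  refine WP.seq (WP.fetch hW (by decide) hE.size hv hE.driven (hle v x) (WP.ifLt (fun h1 => ?_)
    (fun h1 => WP.skip ?_)))
  · have h1 : ¬ P v x := by
      intro h
      simp [State.setReg_reg, hP, h, hE.one] at h1
    refine WP.seq (WP.fetch hW (i := v) (j := j) (by decide) (by simp [State.setReg_reg, hE.size])
      (by simp [State.setReg_reg, hv]) (by simp [State.setReg_reg, hj])
      (by simpa [State.setReg_arr] using hle v j) (WP.ifLt (fun h2 => ?_) (fun h2 => WP.skip ?_)))
    · have h2 : ¬ P v j := by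
        intro h
        simp [State.setReg_reg, State.setReg_arr, hP, h, hE.one] at h2
      refine WP.seq (WP.fetch hW (i := j) (j := x) (by decide) (by simp [State.setReg_reg, hE.size])
        (by simp [State.setReg_reg, hj]) (by simp [State.setReg_reg, hE.driven])
        (by simpa [State.setReg_arr] using hle j x) (WP.ifLt (fun h3 => WP.add ?_ ?_)
        (fun h3 => WP.skip ?_)))
      · simp [State.setReg_reg, hE.one, hE.zero]
        omega
      · have h3 : P j x := by
          by_contra h
          simp [State.setReg_reg, State.setReg_arr, hP, h, hE.zero] at h3
        simp [State.setReg_reg, hE.one, hE.zero, h1, h2, h3]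
      · have h3 : ¬ P j x := by
          intro h
          simp [State.setReg_reg, State.setReg_arr, hP, h, hE.zero] at h3
        simp [State.setReg_reg, h3]
    · have h2 : P v j := by
        by_contra h
        simp [State.setReg_reg, State.setReg_arr, hP, h, hE.one] at h2
      simp [State.setReg_reg, h2]
  · have h1 : P v x := by
      by_contra h
      simp [State.setReg_reg, hP, h, hE.one] at h1
    simp [State.setReg_reg, h1]

open Classical in
theorem WP.violation (hW : n * n + 2 ≤ W) (hE : Env A x s) {P : Fin n → Fin n → Prop}
    (hP : ∀ v i : Fin n, s.arr 4 (v * n + i) = if P v i then 1 else 0) :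
    WP W n (RAM.forLoop 5 (RAM.forLoop 6 RAM.violationTest)) (fun s' => s'.reg 13 =
      if ∃ v j, P j x ∧ ¬ P v x ∧ ¬ P v j then 1 else s.reg 13) s := by
  have hn : n ≤ n * n := Nat.le_mul_self n
  refine WP.forLoop_exists (d := 13) (fun v => ∃ j, P j x ∧ ¬ P v x ∧ ¬ P v j) (by decide)
    (by decide) (by decide) rfl rfl rfl hE.size hE.one (by omega) (fun v s₁ hv hF => ?_)
    fun s₁ h _ => by convert h
  have hE₁ := hE.frame hF (by decide) (by decide)
  refine WP.forLoop_exists (d := 13) (fun j => P j x ∧ ¬ P v x ∧ ¬ P v j) (by decide) (by decide)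
    (by decide) rfl rfl rfl hE₁.size hE₁.one (by omega) (fun j s₂ hj hF₂ => ?_)
    fun s₁ h _ => by convert h
  refine (WP.violationTest hW (hE₁.frame hF₂ (by decide) (by decide)) (fun v i => ?_)
    ((hF₂.reg 5 (by decide)).trans hv) hj).mono fun _ h _ => by convert h
  rw [hF₂.arr 4 (by decide), hF.arr 4 (by decide), hP]

/-! ### Representatives of the sink components -/

open Classical in
/-- The first vertices of the sink components of a digraph. -/
def sinkReps (E : Fin n → Fin n → Prop) : Finset (Fin n) :=
  Finset.univ.filter fun j =>
    ¬ ∃ k, ReflTransGen E j k ∧ (¬ ReflTransGen E k j ∨ k < j)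

theorem mem_sinkReps {E : Fin n → Fin n → Prop} {j : Fin n} : j ∈ sinkReps E ↔
    ¬ ∃ k, ReflTransGen E j k ∧ (¬ ReflTransGen E k j ∨ k < j) := by
  simp only [sinkReps, Finset.mem_filter, Finset.mem_univ, true_and]

theorem eq_of_mem_sinkReps {E : Fin n → Fin n → Prop} {i j : Fin n} (hi : i ∈ sinkReps E)
    (hj : j ∈ sinkReps E) (h : ReflTransGen E i j) : i = j := by
  rw [mem_sinkReps] at hi hj
  have h' : ReflTransGen E j i := by
    by_contra h'
    exact hi ⟨j, h, .inl h'⟩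
  rcases lt_trichotomy i j with hlt | heq | hlt
  · exact absurd ⟨i, h', .inr hlt⟩ hj
  · exact heq
  · exact absurd ⟨j, h, .inr hlt⟩ hi

/-- A vertex `k` reachable from `j` with the fewest reachable vertices lies in a sink component; its
least reachable vertex is the representative. -/
theorem exists_mem_sinkReps (E : Fin n → Fin n → Prop) (j : Fin n) :
    ∃ s ∈ sinkReps E, ReflTransGen E j s := by
  classical
  let r : Fin n → Finset (Fin n) := fun k => Finset.univ.filter fun m => ReflTransGen E k m
  have hr : ∀ {k m}, m ∈ r k ↔ ReflTransGen E k m := by simp [r]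
  obtain ⟨k, hk, hmin⟩ := (r j).exists_min_image (fun k => (r k).card) ⟨j, hr.2 .refl⟩
  have hsink : ∀ m, ReflTransGen E k m → ReflTransGen E m k := by
    intro m hm
    have hsub : r m ⊆ r k := fun a ha => hr.2 (hm.trans (hr.1 ha))
    have := Finset.eq_of_subset_of_card_le hsub (hmin m (hr.2 ((hr.1 hk).trans hm)))
    exact hr.1 (this ▸ hr.2 .refl)
  obtain ⟨s, hs, hsmin⟩ := (r k).exists_min_image id ⟨k, hr.2 .refl⟩
  refine ⟨s, ?_, (hr.1 hk).trans (hr.1 hs)⟩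
  rw [mem_sinkReps]
  rintro ⟨m, hm, h | h⟩
  · exact h ((hsink m ((hr.1 hs).trans hm)).trans (hr.1 hs))
  · exact absurd (hsmin m (hr.2 ((hr.1 hs).trans hm))) (not_le.2 h)

theorem reach_iff_update {E : Fin n → Fin n → Prop} {v i : Fin n} :
    (Function.update (fun _ => 0) v 1 i = 2 ∨ ∃ c, Function.update (fun _ => 0) v 1 c = 1 ∧
      AvoidReach E {j | Function.update (fun _ => 0) v 1 j = 2} i c) ↔ ReflTransGen E i v := by
  have hne : ∀ j, Function.update (fun _ => 0) v 1 j ≠ 2 := by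
    intro j
    by_cases h : j = v
    · subst h; simp
    · simp [h]
  have hset : {j | Function.update (fun _ => 0) v 1 j = 2} = ∅ :=
    Set.eq_empty_of_forall_notMem hne
  rw [hset]
  constructor
  · rintro (h | ⟨c, hc, h⟩)
    · exact absurd h (hne i)
    · by_cases hcv : c = v
      · exact hcv ▸ h.reach
      · simp [hcv] at hc
  · intro h
    exact .inr ⟨v, by simp, by simp, reach_mono h (by simp)⟩

open Classical in
theorem escapes_iff_update {E : Fin n → Fin n → Prop} {T : Finset (Fin n)} {v i : Fin n}
    (hi : i ≠ v) :
    (Function.update (fun j => if j ∈ T then 1 else 0) v 2 i = 2 ∨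
      ∃ c, Function.update (fun j => if j ∈ T then 1 else 0) v 2 c = 1 ∧
      AvoidReach E {j | Function.update (fun j => if j ∈ T then 1 else 0) v 2 j = 2} i c) ↔
      Escapes E T v i := by
  have hiff : ∀ j, Function.update (fun j => if j ∈ T then 1 else 0) v 2 j = 2 ↔ j = v := by
    intro j
    by_cases h : j = v
    · subst h; simp
    · simp only [ne_eq, h, not_false_eq_true, Function.update_of_ne, iff_false]
      split_ifs <;> norm_num
  have hset : {j | Function.update (fun j => if j ∈ T then 1 else 0) v 2 j = 2} = {v} :=
    Set.ext hiff
  rw [hset, hiff, or_iff_right hi]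
  refine exists_congr fun c => ?_
  by_cases hc : c = v
  · subst hc
    refine iff_of_false (by simp) fun h => h.2.notMem_right rfl
  · simp [hc]

open Classical in
theorem WP.placement (hW : n * n + 2 ≤ W) :
    WP W n placement (fun s => ∀ j : Fin n, s.arr 1 j =
      if j ∈ sinkReps (auxEdge A x) ∨ (j = x ∧ ∃ v k, Escapes (auxEdge A x) (sinkReps (auxEdge A x)) k x ∧
        ¬ Escapes (auxEdge A x) (sinkReps (auxEdge A x)) v x ∧
        ¬ Escapes (auxEdge A x) (sinkReps (auxEdge A x)) v k) then 1 else 0) (inputState A x) := by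
  set E := auxEdge A x with hEdef
  set T := sinkReps E with hTdef
  refine WP.seq (WP.const (by omega) (WP.seq (WP.const (by omega) (WP.seq ?_))))
  set s₀ := ((inputState A x).setReg 2 1).setReg 3 2 with hs₀
  have hE₀ : Env A x s₀ := by
    refine ⟨rfl, rfl, rfl, rfl, rfl, fun i j => ?_⟩
    simp only [hs₀, State.setReg_arr, inputState, true_and, index_inj]
    refine if_congr ⟨?_, fun h => ⟨i, j, ⟨rfl, rfl⟩, h⟩⟩ rfl rfl
    rintro ⟨i, j, ⟨rfl, rfl⟩, h⟩
    exact h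
  have h₀ : ∀ k i, k ≠ 0 → s₀.arr k i = 0 := by
    intro k i hk
    simp [hs₀, State.setReg_arr, inputState, hk]
  have h₀m : s₀.reg 2 = 1 := rfl
  -- Array `5` still holds its initial zeros and serves as the empty marking.
  refine (WP.table hW hE₀ (a := 5) (m := 2) (k := 3) (by decide) (by decide) (by decide)
    (by decide) (by decide) (by rw [h₀m]; omega) (w := fun _ => 0) (fun i => h₀ 5 i (by decide))
    (fun _ => Nat.zero_le _)).mono fun s₁ h₁ hF₁ => WP.seq ?_
  have hE₁ := hE₀.frame hF₁ (by decide) (by decide)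
  simp only [h₀m, reach_iff_update] at h₁
  refine (WP.select hW hE₁ (R := ReflTransGen E) fun v i =>
    (h₁ v i).trans (if_congr Iff.rfl rfl rfl)).mono fun s₂ h₂ hF₂ => WP.seq ?_
  have hE₂ := hE₁.frame hF₂ (by decide) (by decide)
  have hT₂ : ∀ j : Fin n, s₂.arr 1 j = if j ∈ T then 1 else 0 := by
    intro j
    rw [h₂]
    by_cases hj : ∃ k, ReflTransGen E j k ∧ (¬ ReflTransGen E k j ∨ k < j)
    · rw [if_pos hj, if_neg fun h => mem_sinkReps.1 h hj]
    · rw [if_neg hj, if_pos (mem_sinkReps.2 hj)]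
  refine (WP.table hW hE₂ (a := 1) (m := 3) (k := 4) (by decide) (by decide) (by decide)
    (by decide) (by decide) (by rw [hE₂.two]) hT₂ (fun j => by split_ifs <;> omega)).mono
    fun s₃ h₃ hF₃ => WP.seq ?_
  have hE₃ := hE₂.frame hF₃ (by decide) (by decide)
  refine (WP.clearDiag hW hE₃).mono fun s₄ h₄ hF₄ => WP.seq ?_
  have hE₄ := hE₃.frame hF₄ (by decide) (by decide)
  have hP : ∀ v i : Fin n, s₄.arr 4 (v * n + i) = if Escapes E T v i then 1 else 0 := by
    intro v i
    rw [h₄]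
    by_cases hi : i = v
    · rw [if_pos hi, if_neg fun h => h.ne hi]
    · rw [if_neg hi, h₃, hE₂.two]
      exact if_congr (escapes_iff_update hi) rfl rfl
  refine (WP.violation hW hE₄ hP).mono fun s₅ h₅ hF₅ => ?_
  have hE₅ := hE₄.frame hF₅ (by decide) (by decide)
  have hT₅ : ∀ j : Fin n, s₅.arr 1 j = if j ∈ T then 1 else 0 := by
    intro j
    rw [hF₅.arr 1 (by decide), hF₄.arr 1 (by decide), hF₃.arr 1 (by decide), hT₂]
  have h13 : s₄.reg 13 = 0 := by
    rw [hF₄.reg 13 (by decide), hF₃.reg 13 (by decide), hF₂.reg 13 (by decide),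
      hF₁.reg 13 (by decide)]
    rfl
  rw [h13] at h₅
  refine WP.ifLt (fun h => WP.store (by rw [hE₅.one]; omega) fun j => ?_)
    (fun h => WP.skip fun j => ?_)
  · have hV : ∃ v k, Escapes E T k x ∧ ¬ Escapes E T v x ∧ ¬ Escapes E T v k := by
      by_contra hV
      rw [h₅, if_neg hV, hE₅.zero] at h
      exact lt_irrefl _ h
    rw [State.setArr_arr, hE₅.driven, hE₅.one, hT₅]
    by_cases hj : j = x
    · simp [hj, hV]
    · have : (j : ℕ) ≠ x := fun h => hj (Fin.ext h)
      simp [hj, this]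
  · have hV : ¬ ∃ v k, Escapes E T k x ∧ ¬ Escapes E T v x ∧ ¬ Escapes E T v k := by
      intro hV
      rw [h₅, if_pos hV, hE₅.zero] at h
      exact h one_pos
    rw [State.setReg_arr, hT₅]
    simp only [hV, and_false, or_false]

theorem placement_time (hn : 0 < n) : placement.time n ≤ 2000 * n ^ 3 := by
  -- In terms of `m = n - 1` both sides are polynomials that can be compared coefficientwise.
  obtain ⟨m, rfl⟩ : ∃ m, n = m + 1 := ⟨n - 1, by omega⟩
  simp only [placement, table, select, clearDiag, violationTest, rejectTest, fetch, record,
    copyMarks, search, expand, markPred, scan, index, skip, RAM.forLoop, Prog.time]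
  ring_nf
  have := Nat.zero_le (m ^ 2)
  have := Nat.zero_le (m ^ 3)
  linarith [Nat.zero_le m]

end RAM
end

noncomputable section

open Relation

/-! ## Running time of the sensor placement algorithm -/

namespace RAM

theorem exists_program : ∃ (prog : Prog) (K : ℕ), ∀ (n : ℕ) (A : StructMatrix (Fin n) (Fin n))
    (x : Fin n), (∀ j, A j j = true) →
    ∃ (t : ℕ) (s : State) (T : Finset (Fin n)), Exec (K * n ^ K) prog (inputState A x) t s ∧
      (t : ℝ) ≤ (K : ℝ) * (n : ℝ) ^ (3.5 : ℝ) ∧ outputIs s T ∧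
      AlgorithmReturns A x (T.image Sum.inl) := by
  classical
  -- One `K` serves as the time constant and as the exponent of the word bound, where any `K ≥ 3`
  -- would do.
  obtain ⟨K, hK⟩ : ∃ K : ℕ, K = 2000 := ⟨_, rfl⟩
  refine ⟨placement, K, fun n A x hA => ?_⟩
  have hn : 0 < n := x.pos
  have hW : n * n + 2 ≤ K * n ^ K := by
    have h1 : n ^ 2 ≤ n ^ K := Nat.pow_le_pow_right hn (by omega)
    have h2 : 1 ≤ n ^ 2 := Nat.one_le_pow _ _ hn
    calc n * n + 2 ≤ 3 * n ^ 2 := by rw [← sq]; omega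
      _ ≤ K * n ^ K := Nat.mul_le_mul (by omega) h1
  obtain ⟨t, s, hs, ht, hout⟩ := WP.placement (A := A) (x := x) hW
  set T := sinkReps (auxEdge A x) with hT
  have hhits : Hits A x T := exists_mem_sinkReps _
  have hmin : IsMinPlacement (auxSystem A x) (T.image Sum.inl) :=
    (isMinPlacement_iff hA).2 ⟨T, rfl, hhits, fun i hi j hj => eq_of_mem_sinkReps hi hj⟩
  have hviol := hasViolation_iff (hhits x)
  rw [exists_comm] at hviol
  refine ⟨t, s, if HasViolation A x (T.image Sum.inl) then insert x T else T, hs, ?_, fun j => ?_,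
    T.image Sum.inl, hmin, ?_⟩
  · have h1 : (1 : ℝ) ≤ n := by exact_mod_cast hn
    have h2 : t ≤ K * n ^ 3 := by
      rw [hK]
      exact ht.trans (placement_time hn)
    calc (t : ℝ) ≤ (K : ℝ) * (n : ℝ) ^ 3 := by exact_mod_cast h2
      _ = (K : ℝ) * (n : ℝ) ^ (3 : ℝ) := by norm_cast
      _ ≤ (K : ℝ) * (n : ℝ) ^ (3.5 : ℝ) := by
        gcongr
        norm_num
  · rw [hout]
    by_cases hV : HasViolation A x (T.image Sum.inl)
    · rw [if_pos hV]
      refine if_congr ?_ rfl rfl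
      rw [Finset.mem_insert, and_iff_left (hviol.1 hV), or_comm]
    · rw [if_neg hV]
      refine if_congr ?_ rfl rfl
      rw [or_iff_left fun h => hV (hviol.2 h.2)]
  · by_cases hV : HasViolation A x (T.image Sum.inl)
    · exact .inl ⟨hV, by rw [if_pos hV, Finset.image_insert]⟩
    · exact .inr ⟨hV, by rw [if_neg hV]⟩

end RAM
end

theorem theorem4 :
    -- correctness: the algorithm has a result, and each possible result is a set of sensors on
    -- states that solves the minimal GSIO problem
    (∀ (n : ℕ) (A : StructMatrix (Fin n) (Fin n)) (x : Fin n),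
      (∀ j, A j j = true) →
      1 < numReachableSinkSCC (stateDigraph (auxSystem A x)) (Sum.inr ()) →
      (∃ R, AlgorithmReturns A x R) ∧
      ∀ R, AlgorithmReturns A x R →
        ∃ T : Finset (Fin n), R = T.image Sum.inl ∧
          IsOptimal A (dedicatedInput x) (sensorMatrix T)) ∧
    -- running time: one program carries out the algorithm within `K * n ^ 3.5` steps, on words of
    -- `O(log n)` bits
    (∃ (prog : RAM.Prog) (K : ℕ), ∀ (n : ℕ) (A : StructMatrix (Fin n) (Fin n)) (x : Fin n),
      (∀ j, A j j = true) →
      ∃ (t : ℕ) (s : RAM.State) (T : Finset (Fin n)),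
        RAM.Exec (K * n ^ K) prog (RAM.inputState A x) t s ∧
        (t : ℝ) ≤ (K : ℝ) * (n : ℝ) ^ (3.5 : ℝ) ∧
        RAM.outputIs s T ∧
        AlgorithmReturns A x (T.image Sum.inl)) := by
  refine ⟨fun n A x hA hL => ⟨exists_algorithmReturns hA, fun R hR => ?_⟩, RAM.exists_program⟩
  exact isOptimal_of_algorithmReturns hA hL hR
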